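/- Let $N\ge 2$, let $H$ be an $N\times N$ random matrix of the Gaussian Orthogonal Ensemble, i.e. $H$ is real symmetric and its entries are jointly Gaussian, centered, with covariance $$\langle H_{ij}H_{kl}\rangle=\frac1N\bigl(\delta(jk)\delta(il)+\delta(ik)\delta(jl)\bigr),$$ where $\langle\cdot\rangle$ is the expectation and $\delta$ the Kronecker delta. Let $E\in\mathbb R$, $\epsilon>0$, $E_\epsilon=E-i\epsilon$, and $G(z)=(z-H)^{-1}$. For $s,t>0$, $\alpha\in(-1,1)$ and $z\in\mathbb C\setminus\{0\}$ put $$F(s,t,z,\alpha)=iE_\epsilon(s+t)+s^2+t^2-\tfrac12\ln s-\tfrac12\ln t+iE_\epsilon z-\tfrac12z^2+\ln z+2st\alpha^2-\tfrac12\ln(1-\alpha^2),$$ $$B(s,t,z,\alpha)=\frac1N+(z-iE_\epsilon)^2-2(z-iE_\epsilon)(s+t)+4st(1-\alpha^2).$$ (The branch of $\ln z$ does not matter, since only $e^{-NF}$ is used.) Let $\oint dz$ denote integration along a closed contour in $\mathbb C\setminus\{0\}$ going once counterclockwise about $0$ (winding number $1$). Then $$\frac1N\langle\mathrm{tr}\,G(E_\epsilon)\rangle=\frac{(-1)^N2^NN^2}{8\pi^2}\int_0^\infty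 ds\int_0^\infty dt\int_{-1}^1d\alpha\oint dz\; z\,\frac{s+t}{st}\,(1-\alpha^2)^{-3/2}\,B(s,t,z,\alpha)\,e^{-NF(s,t,z,\alpha)}$$ and $$i=\frac{(-1)^N2^NN^2}{8\pi^2}\int_0^\infty ds\int_0^\infty dt\int_{-1}^1d\alpha\oint dz\; z\,\frac{1}{st}\,(1-\alpha^2)^{-3/2}\,B(s,t,z,\alpha)\,e^{-NF(s,t,z,\alpha)},$$ where the expectation and both fourfold integrals converge absolutely. -/

import Mathlib

open MeasureTheory ProbabilityTheory Set

noncomputable section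

/-- The random `N × N` matrix `H` on the probability space `(Ω, P)` belongs to the Gaussian
Orthogonal Ensemble: it is (almost surely) real symmetric, its entries are jointly Gaussian and
centered, and `⟨H i j * H k l⟩ = (δ(jk) δ(il) + δ(ik) δ(jl)) / N`. -/
structure IsGOE {Ω : Type*} [MeasurableSpace Ω] (P : Measure Ω) (N : ℕ)
    (H : Ω → Matrix (Fin N) (Fin N) ℝ) : Prop where
  isSymm : ∀ᵐ ω ∂P, (H ω).IsSymm
  gaussian : HasGaussianLaw (fun ω (p : Fin N × Fin N) => H ω p.1 p.2) P
  centered : ∀ i j, ∫ ω, H ω i j ∂P = 0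
  covariance : ∀ i j k l, ∫ ω, H ω i j * H ω k l ∂P =
    (1 / (N : ℝ)) * ((if j = k then 1 else 0) * (if i = l then 1 else 0) +
      (if i = k then 1 else 0) * (if j = l then 1 else 0))

/-- The regularized energy `E - i ε`. -/
def regEnergy (E ε : ℝ) : ℂ := (E : ℂ) - Complex.I * (ε : ℂ)

/-- The resolvent `G(z) = (z - H)⁻¹` of a real matrix `H` at a complex point `z`. -/
def matResolvent {N : ℕ} (H : Matrix (Fin N) (Fin N) ℝ) (z : ℂ) : Matrix (Fin N) (Fin N) ℂ :=
  (z • (1 : Matrix (Fin N) (Fin N) ℂ) - H.map Complex.ofReal)⁻¹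

/-- The contour integral `∮ f(z) dz` along a curve `γ` parametrized by `[0, 1]`. -/
def contourIntegral (γ : ℝ → ℂ) (f : ℂ → ℂ) : ℂ :=
  ∫ τ in (0 : ℝ)..1, f (γ τ) * deriv γ τ

/-- `γ`, parametrized by `[0, 1]`, is a closed contour going once counterclockwise about `0`:
it is continuous and closed, differentiable off a finite set with integrable derivative (every
piecewise `C¹` curve is such), avoids `0`, and has winding number `1` about `0`. -/
structure IsContourAboutZero (γ : ℝ → ℂ) : Prop where
  continuousOn : ContinuousOn γ (Icc 0 1)
  closed : γ 0 = γ 1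
  differentiable : ∃ S : Set ℝ, S.Finite ∧ ∀ τ ∈ Ioo (0 : ℝ) 1 \ S, DifferentiableAt ℝ γ τ
  integrable_deriv : IntervalIntegrable (deriv γ) volume 0 1
  ne_zero : ∀ τ ∈ Icc (0 : ℝ) 1, γ τ ≠ 0
  winding : contourIntegral γ (fun z => z⁻¹) = 2 * Real.pi * Complex.I

/-- The action `F(s, t, z, α)`; `w` stands for the regularized energy. -/
def goeAction (w : ℂ) (s t α : ℝ) (z : ℂ) : ℂ :=
  (Complex.I * w * (s + t) + (s : ℂ) ^ 2 + (t : ℂ) ^ 2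
      - (1 / 2) * (Real.log s : ℂ) - (1 / 2) * (Real.log t : ℂ))
    + (Complex.I * w * z - (1 / 2) * z ^ 2 + Complex.log z)
    + (2 * s * t * (α : ℂ) ^ 2 - (1 / 2) * (Real.log (1 - α ^ 2) : ℂ))

/-- The factor `1/N + (z - i w)² - 2 (z - i w) (s + t) + 4 s t (1 - α²)`. -/
def goeBracket (N : ℕ) (w : ℂ) (s t α : ℝ) (z : ℂ) : ℂ :=
  1 / (N : ℂ) + (z - Complex.I * w) ^ 2 - 2 * (z - Complex.I * w) * (s + t)
    + 4 * s * t * (1 - (α : ℂ) ^ 2)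

/-- The integrand of the formula for the averaged trace of the resolvent. -/
def goeIntegrand (N : ℕ) (w : ℂ) (s t α : ℝ) (z : ℂ) : ℂ :=
  z * (((s : ℂ) + t) / (s * t)) * (((1 - α ^ 2) ^ (-(3 / 2) : ℝ) : ℝ) : ℂ)
    * goeBracket N w s t α z * Complex.exp (-(N : ℂ) * goeAction w s t α z)

/-- The integrand of the companion formula, without the factor `s + t`. -/
def goeCompanionIntegrand (N : ℕ) (w : ℂ) (s t α : ℝ) (z : ℂ) : ℂ :=
  z * (1 / ((s : ℂ) * t)) * (((1 - α ^ 2) ^ (-(3 / 2) : ℝ) : ℝ) : ℂ)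
    * goeBracket N w s t α z * Complex.exp (-(N : ℂ) * goeAction w s t α z)

/-- The normalization `(-1)^N 2^N N² / (8 π²)`. -/
def goeConst (N : ℕ) : ℂ :=
  (-1) ^ N * 2 ^ N * (N : ℂ) ^ 2 / (8 * (Real.pi : ℂ) ^ 2)

/-- The fourfold integral `∫₀^∞ ds ∫₀^∞ dt ∫₋₁¹ dα ∮_γ dz f(s, t, α, z)`. -/
def fourfoldIntegral (γ : ℝ → ℂ) (f : ℝ → ℝ → ℝ → ℂ → ℂ) : ℂ :=
  ∫ s in Ioi (0 : ℝ), ∫ t in Ioi (0 : ℝ), ∫ α in (-1 : ℝ)..1, contourIntegral γ (f s t α)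

/-- Absolute convergence of the fourfold integral as an integral over
`(0, ∞) × (0, ∞) × (-1, 1) × (0, 1)`, the last variable being the parameter of `γ`. -/
def FourfoldIntegrable (γ : ℝ → ℂ) (f : ℝ → ℝ → ℝ → ℂ → ℂ) : Prop :=
  IntegrableOn
    (fun p : ℝ × ℝ × ℝ × ℝ => f p.1 p.2.1 p.2.2.1 (γ p.2.2.2) * deriv γ p.2.2.2)
    (Ioi (0 : ℝ) ×ˢ Ioi (0 : ℝ) ×ˢ Ioo (-1 : ℝ) 1 ×ˢ Ioo (0 : ℝ) 1)

end

/-! Put c = i(E - iε), so that Re c = ε > 0. For a real symmetric H the Gaussian integral of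
exp(-N(c|x|² - i xᵀHx)) over ℝ^N squares to (π/N)^N / det(c - iH). With two vectors x, y the product
of the two integrals is therefore cancelled by det(c - iH). Inserting |x|² + |y|² produces in
addition -i/N times the trace of the resolvent (`Matrix.IsHermitian.integral_quadWeight_prod`). Both
formulas arise in this way, with a factor h(|x|² + |y|²), where h is the identity or the constant 1.

The phase has modulus one, so the average over H can be taken first. With A = xxᵀ + yyᵀ it is the
average of exp(iN tr HA) det(c - iH). The determinant is at most quadratic in each independent entry
of H. Computing the Gaussian moments entry by entry, the phase shifts the matrix by 2A and gives
exp(-N tr A²). An off-diagonal coupling -ix(E_ab + E_ba) may be replaced by x(E_aa + E_bb), because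
both have the same quadratic coefficient. The resulting diagonal noise has the law of a common
scalar of variance 1/N plus independent diagonal noise. The latter disappears, as the determinant is
affine in each diagonal entry. What remains is exp(-N tr A²) times the mean of det(c + g + 2A) with
one real Gaussian g (`integral_cexp_mul_det_symOfUpper`). As A has rank two, this is a combination
of the moments of c + g of orders N, N - 1 and N - 2, with coefficients depending on the Gram data
of x and y.

By the generating function exp(-N(cz - z²/2)) of these moments, they are Laurent coefficients, hence
contour integrals about 0. Integration by parts in z brings the three orders to the same power of z
and creates the bracket B (`IsContourAboutZero.integral_bracket`).

Finally, the integral over x and y is pushed forward to s = |x|², t = |y|² and the cosine α of their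
angle (`map_gramMap`). The areas of the two spheres combine by the duplication formula and give the
stated constant. -/

/-! ### Gaussian integrability, integration by parts and one-variable moments. -/

theorem integrable_of_norm_le_one_add_norm_pow {E F : Type*} [NormedAddCommGroup E]
    [NormedSpace ℝ E] [MeasurableSpace E] [BorelSpace E] [CompleteSpace E]
    [SecondCountableTopology E] [NormedAddCommGroup F] (μ : Measure E) [IsGaussian μ] {Φ : E → F}
    (hΦ : AEStronglyMeasurable Φ μ) (C : ℝ) (n : ℕ) (h : ∀ x, ‖Φ x‖ ≤ C * (1 + ‖x‖) ^ n) :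
    Integrable Φ μ := by
  have h1 : MemLp (fun x : E => 1 + ‖x‖) n μ :=
    (memLp_const (1 : ℝ)).add (IsGaussian.memLp_id μ n (by simp)).norm
  have h2 : Integrable (fun x : E => C * (1 + ‖x‖) ^ n) μ := by
    refine Integrable.const_mul ?_ C
    rcases Nat.eq_zero_or_pos n with rfl | hn
    · simp
    refine (h1.integrable_norm_pow hn.ne').congr (Filter.Eventually.of_forall fun x => ?_)
    simp only [Real.norm_eq_abs]
    rw [abs_of_nonneg (by positivity)]
  exact h2.mono' hΦ (Filter.Eventually.of_forall h)

theorem isGaussian_pi_gaussianReal {ι : Type*} [Fintype ι] (v : ι → NNReal) :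
    IsGaussian (Measure.pi fun i => gaussianReal 0 (v i)) := by
  have h : iIndepFun (fun (i : ι) (g : ι → ℝ) => g i)
      (Measure.pi fun i => gaussianReal 0 (v i)) :=
    iIndepFun_pi (X := fun i x => x) (fun i => by fun_prop)
  have h2 := iIndepFun.hasGaussianLaw (fun i => ?_) h
  · have := h2.isGaussian_map
    simpa using this
  · refine ⟨?_⟩
    have := (measurePreserving_eval (fun i => gaussianReal 0 (v i)) i).map_eq
    change IsGaussian (Measure.map (Function.eval i) (Measure.pi fun i => gaussianReal 0 (v i)))
    rw [this]; infer_instance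

theorem integrable_smul_gaussianPDFReal {v : NNReal} (hv : v ≠ 0) {f : ℝ → ℂ}
    (hf : Integrable f (gaussianReal 0 v)) :
    Integrable (fun x => gaussianPDFReal 0 v x • f x) := by
  rw [gaussianReal_of_var_ne_zero _ hv,
    integrable_withDensity_iff_integrable_smul' (by fun_prop) (by simp [gaussianPDF])] at hf
  refine hf.congr (Filter.Eventually.of_forall fun x => ?_)
  simp [toReal_gaussianPDF]

theorem hasDerivAt_gaussianPDFReal {v : NNReal} (hv : v ≠ 0) (x : ℝ) :
    HasDerivAt (gaussianPDFReal 0 v) (-(x / v) * gaussianPDFReal 0 v x) x := by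
  have hv' : (v : ℝ) ≠ 0 := by exact_mod_cast hv
  have h1 : HasDerivAt (fun y : ℝ => -(y - 0) ^ 2 / (2 * v)) (-(x / v)) x := by
    have h : HasDerivAt (fun y : ℝ => -(y - 0) ^ 2 / (2 * v)) _ x :=
      (((hasDerivAt_id x).sub_const 0).pow 2).neg.div_const (2 * (v : ℝ))
    refine h.congr_deriv ?_
    simp; field_simp
  have h : HasDerivAt (gaussianPDFReal 0 v) _ x := h1.exp.const_mul (√(2 * Real.pi * v))⁻¹
  refine h.congr_deriv ?_
  unfold gaussianPDFReal
  ring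

/-- Gaussian integration by parts. -/
theorem integral_id_mul_gaussianReal {v : NNReal} (hv : v ≠ 0) {f f' : ℝ → ℂ}
    (hd : ∀ x, HasDerivAt f (f' x) x) (hf : Integrable f (gaussianReal 0 v))
    (hxf : Integrable (fun x : ℝ => (x : ℂ) * f x) (gaussianReal 0 v))
    (hf' : Integrable f' (gaussianReal 0 v)) :
    ∫ x : ℝ, (x : ℂ) * f x ∂gaussianReal 0 v = v * ∫ x, f' x ∂gaussianReal 0 v := by
  have hv' : (v : ℂ) ≠ 0 := by exact_mod_cast hv
  -- The density p satisfies p' = -(x/v) p, so (p f)' = p f' - (x/v) p f. This derivative is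
  -- integrable and has total integral zero.
  have h0 := integral_eq_zero_of_hasDerivAt_of_integrable
    (f := fun x => gaussianPDFReal 0 v x • f x)
    (f' := fun x => gaussianPDFReal 0 v x • f' x
      - (v : ℂ)⁻¹ * (gaussianPDFReal 0 v x • ((x : ℂ) * f x)))
    (fun x => by
      have h : HasDerivAt (fun x => gaussianPDFReal 0 v x • f x) _ x :=
        (hasDerivAt_gaussianPDFReal hv x).smul (hd x)
      refine h.congr_deriv ?_
      simp only [Complex.real_smul]
      push_cast
      field_simp
      ring)
    ((integrable_smul_gaussianPDFReal hv hf').sub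
      ((integrable_smul_gaussianPDFReal hv hxf).const_mul _))
    (integrable_smul_gaussianPDFReal hv hf)
  rw [integral_sub (integrable_smul_gaussianPDFReal hv hf')
    ((integrable_smul_gaussianPDFReal hv hxf).const_mul _), integral_const_mul,
    ← integral_gaussianReal_eq_integral_smul hv, ← integral_gaussianReal_eq_integral_smul hv,
    sub_eq_zero] at h0
  rw [h0]
  field_simp

theorem integrable_gaussianReal_of_bound {v : NNReal} {f : ℝ → ℂ} (hf : Continuous f) (C : ℝ)
    (n : ℕ) (h : ∀ x, ‖f x‖ ≤ C * (1 + |x|) ^ n) : Integrable f (gaussianReal 0 v) :=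
  integrable_of_norm_le_one_add_norm_pow _ hf.aestronglyMeasurable C n h

theorem norm_cexp_mul_I_ofReal (b x : ℝ) : ‖Complex.exp (b * x * Complex.I)‖ = 1 := by
  rw [← Complex.ofReal_mul, Complex.norm_exp_ofReal_mul_I]

theorem integrable_pow_mul_cexp_gaussianReal {v : NNReal} (b : ℝ) (n : ℕ) :
    Integrable (fun x : ℝ => (x : ℂ) ^ n * Complex.exp (b * x * Complex.I))
      (gaussianReal 0 v) := by
  refine integrable_gaussianReal_of_bound (by fun_prop) 1 n fun x => ?_
  rw [norm_mul, norm_cexp_mul_I_ofReal, mul_one, one_mul, norm_pow, Complex.norm_real,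
    Real.norm_eq_abs]
  gcongr
  linarith

theorem integral_cexp_gaussianReal (v : NNReal) (b : ℝ) :
    ∫ x : ℝ, Complex.exp (b * x * Complex.I) ∂gaussianReal 0 v
      = Complex.exp (-(v * b ^ 2 / 2)) := by
  rw [← charFun_apply_real, charFun_gaussianReal]
  simp

theorem hasDerivAt_cexp_mul_I (b x : ℝ) :
    HasDerivAt (fun x : ℝ => Complex.exp (b * x * Complex.I))
      (b * Complex.I * Complex.exp (b * x * Complex.I)) x := by
  have h : HasDerivAt (fun x : ℝ => Complex.exp (b * x * Complex.I)) _ x :=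
    (((Complex.ofRealCLM.hasDerivAt (x := x)).const_mul (b : ℂ)).mul_const Complex.I).cexp
  refine h.congr_deriv ?_
  simp; ring

theorem integral_id_mul_cexp_gaussianReal {v : NNReal} (hv : v ≠ 0) (b : ℝ) :
    ∫ x : ℝ, (x : ℂ) * Complex.exp (b * x * Complex.I) ∂gaussianReal 0 v
      = v * b * Complex.I * Complex.exp (-(v * b ^ 2 / 2)) := by
  have h0 := integrable_pow_mul_cexp_gaussianReal (v := v) b 0
  have h1 := integrable_pow_mul_cexp_gaussianReal (v := v) b 1
  simp only [pow_zero, one_mul, pow_one] at h0 h1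
  rw [integral_id_mul_gaussianReal hv (hasDerivAt_cexp_mul_I b) h0 h1 (h0.const_mul _),
    integral_const_mul, integral_cexp_gaussianReal]
  ring

theorem integral_sq_mul_cexp_gaussianReal {v : NNReal} (hv : v ≠ 0) (b : ℝ) :
    ∫ x : ℝ, (x : ℂ) ^ 2 * Complex.exp (b * x * Complex.I) ∂gaussianReal 0 v
      = (v - v ^ 2 * b ^ 2) * Complex.exp (-(v * b ^ 2 / 2)) := by
  have h0 := integrable_pow_mul_cexp_gaussianReal (v := v) b 0
  have h1 := integrable_pow_mul_cexp_gaussianReal (v := v) b 1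
  have h2 := integrable_pow_mul_cexp_gaussianReal (v := v) b 2
  simp only [pow_zero, one_mul, pow_one] at h0 h1
  have hd : ∀ x : ℝ, HasDerivAt (fun x : ℝ => (x : ℂ) * Complex.exp (b * x * Complex.I))
      (Complex.exp (b * x * Complex.I)
        + b * Complex.I * ((x : ℂ) * Complex.exp (b * x * Complex.I))) x := fun x => by
    have h : HasDerivAt (fun x : ℝ => (x : ℂ) * Complex.exp (b * x * Complex.I)) _ x :=
      (Complex.ofRealCLM.hasDerivAt (x := x)).mul (hasDerivAt_cexp_mul_I b x)
    refine h.congr_deriv ?_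
    simp; ring
  have h := integral_id_mul_gaussianReal hv hd h1
    (h2.congr (Filter.Eventually.of_forall fun x => by simp only; ring))
    (h0.add (h1.const_mul _))
  rw [integral_add h0 (h1.const_mul _), integral_const_mul, integral_cexp_gaussianReal,
    integral_id_mul_cexp_gaussianReal hv] at h
  calc _ = ∫ x : ℝ, (x : ℂ) * ((x : ℂ) * Complex.exp (b * x * Complex.I)) ∂gaussianReal 0 v :=
        integral_congr_ae (Filter.Eventually.of_forall fun x => by simp only; ring)
    _ = _ := by
      rw [h]
      linear_combination (v ^ 2 * b ^ 2 * Complex.exp (-(v * b ^ 2 / 2))) * Complex.I_sq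

/-- Degree two suffices for the application, since a determinant is at most quadratic in one entry
of a symmetric matrix. -/
theorem integral_quadratic_mul_cexp_gaussianReal {v : NNReal} (hv : v ≠ 0) (b : ℝ)
    (c₀ c₁ c₂ : ℂ) :
    ∫ x : ℝ, Complex.exp (b * x * Complex.I) * (c₀ + x * c₁ + x ^ 2 * c₂) ∂gaussianReal 0 v
      = Complex.exp (-(v * b ^ 2 / 2)) * (c₀ + v * b * Complex.I * c₁
        + (v - v ^ 2 * b ^ 2) * c₂) := by
  have h0 := integrable_pow_mul_cexp_gaussianReal (v := v) b 0
  have h1 := integrable_pow_mul_cexp_gaussianReal (v := v) b 1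
  have h2 := integrable_pow_mul_cexp_gaussianReal (v := v) b 2
  simp only [pow_zero, one_mul, pow_one] at h0 h1
  have e : ∀ x : ℝ, Complex.exp (b * x * Complex.I) * (c₀ + x * c₁ + x ^ 2 * c₂)
      = c₀ * Complex.exp (b * x * Complex.I) + c₁ * ((x : ℂ) * Complex.exp (b * x * Complex.I))
        + c₂ * ((x : ℂ) ^ 2 * Complex.exp (b * x * Complex.I)) := fun x => by ring
  simp_rw [e]
  have h01 : Integrable (fun x : ℝ => c₀ * Complex.exp (b * x * Complex.I)
      + c₁ * ((x : ℂ) * Complex.exp (b * x * Complex.I))) (gaussianReal 0 v) :=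
    (h0.const_mul _).add (h1.const_mul _)
  rw [integral_add h01 (h2.const_mul _), integral_add (h0.const_mul _) (h1.const_mul _),
    integral_const_mul, integral_const_mul,
    integral_const_mul, integral_cexp_gaussianReal, integral_id_mul_cexp_gaussianReal hv,
    integral_sq_mul_cexp_gaussianReal hv]
  ring

theorem integral_quadratic_gaussianReal {v : NNReal} (hv : v ≠ 0) (c₀ c₁ c₂ : ℂ) :
    ∫ x : ℝ, (c₀ + x * c₁ + x ^ 2 * c₂) ∂gaussianReal 0 v = c₀ + v * c₂ := by
  have := integral_quadratic_mul_cexp_gaussianReal hv 0 c₀ c₁ c₂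
  simpa using this

/-- The moments of `c + g`, where `g` is a centered Gaussian variable of variance `v`. -/
noncomputable def shiftedMoment (v : NNReal) (c : ℂ) (k : ℕ) : ℂ :=
  ∫ x : ℝ, (c + x) ^ k ∂gaussianReal 0 v

theorem integrable_shifted_pow (v : NNReal) (c : ℂ) (m k : ℕ) :
    Integrable (fun x : ℝ => (x : ℂ) ^ m * (c + x) ^ k) (gaussianReal 0 v) := by
  refine integrable_gaussianReal_of_bound (by fun_prop) ((1 + ‖c‖) ^ k) (m + k) fun x => ?_
  rw [norm_mul, norm_pow, norm_pow, Complex.norm_real, Real.norm_eq_abs, pow_add]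
  have h1 : ‖c + x‖ ≤ (1 + ‖c‖) * (1 + |x|) := by
    refine (norm_add_le _ _).trans ?_
    rw [Complex.norm_real, Real.norm_eq_abs]
    nlinarith [norm_nonneg c, abs_nonneg x, mul_nonneg (norm_nonneg c) (abs_nonneg x)]
  calc |x| ^ m * ‖c + x‖ ^ k ≤ (1 + |x|) ^ m * ((1 + ‖c‖) * (1 + |x|)) ^ k := by
        gcongr; linarith
    _ = _ := by rw [mul_pow]; ring

theorem shiftedMoment_zero (v : NNReal) (c : ℂ) : shiftedMoment v c 0 = 1 := by
  simp [shiftedMoment]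

/-- The Hermite recursion, from integration by parts; it identifies the moments with Laurent
coefficients later on. At k = 0 the truncated index k - 1 is harmless because of the factor k. -/
theorem shiftedMoment_succ {v : NNReal} (hv : v ≠ 0) (c : ℂ) (k : ℕ) :
    shiftedMoment v c (k + 1) = c * shiftedMoment v c k + v * (k * shiftedMoment v c (k - 1)) := by
  have i0 := integrable_shifted_pow v c 0 k
  have i1 := integrable_shifted_pow v c 1 k
  have i2 := integrable_shifted_pow v c 0 (k - 1)
  simp only [pow_zero, one_mul, pow_one] at i0 i1 i2
  have hd : ∀ x : ℝ, HasDerivAt (fun x : ℝ => (c + x) ^ k) (k * (c + x) ^ (k - 1)) x := fun x => by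
    have h : HasDerivAt (fun x : ℝ => (c + x) ^ k) _ x :=
      ((Complex.ofRealCLM.hasDerivAt (x := x)).const_add c).pow k
    refine h.congr_deriv ?_
    simp
  have h := integral_id_mul_gaussianReal hv hd i0 i1 (i2.const_mul _)
  rw [integral_const_mul] at h
  simp only [shiftedMoment]
  rw [← h, ← integral_const_mul, ← integral_add (i0.const_mul _) i1]
  exact integral_congr_ae (Filter.Eventually.of_forall fun x => by simp only; ring)

/-! ### Determinants as functions of a single Gaussian coupling. -/

open Matrix in
theorem det_updateRow_updateRow_add_smul {n : Type*} [Fintype n] [DecidableEq n]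
    (K : Matrix n n ℂ) {a b : n} (hab : a ≠ b) (p q : n → ℂ) (x : ℂ) :
    ((K.updateRow a (K a + x • p)).updateRow b (K b + x • q)).det
      = K.det + x * ((K.updateRow a p).det + (K.updateRow b q).det)
        + x ^ 2 * ((K.updateRow a p).updateRow b q).det := by
  have h1 : (K.updateRow a (K a)).updateRow b (K b) = K := by simp
  have h2 : (K.updateRow a p).updateRow b (K b) = K.updateRow a p := by
    rw [updateRow_comm _ hab]; simp
  rw [det_updateRow_add, det_updateRow_smul, updateRow_comm _ hab, updateRow_comm _ hab,
    det_updateRow_add, det_updateRow_add, det_updateRow_smul, det_updateRow_smul,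
    updateRow_comm _ hab.symm, updateRow_comm _ hab.symm, updateRow_comm _ hab.symm,
    updateRow_comm _ hab.symm, h1, h2, updateRow_eq_self]
  ring

open Matrix in
theorem add_smul_single_add_single {n : Type*} [DecidableEq n]
    (K : Matrix n n ℂ) {a b : n} (hab : a ≠ b) (c d : n) (x : ℂ) :
    K + x • (single a c 1 + single b d 1)
      = (K.updateRow a (K a + x • Pi.single c 1)).updateRow b (K b + x • Pi.single d 1) := by
  ext i j
  by_cases hb : i = b
  · subst hb
    simp [Matrix.single_apply, Pi.single_apply, hab, eq_comm]
  · by_cases ha : i = a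
    · subst ha
      simp [Matrix.updateRow_apply, Matrix.single_apply, Pi.single_apply, hab, hab.symm, eq_comm]
    · simp [Matrix.updateRow_apply, ha, hb, Ne.symm ha, Ne.symm hb]

/-- Minus the principal minor obtained by deleting the rows and columns `a`, `b`. -/
noncomputable def swapMinor {n : Type*} [Fintype n] [DecidableEq n] (K : Matrix n n ℂ) (a b : n) :
    ℂ :=
  ((K.updateRow a (Pi.single b 1)).updateRow b (Pi.single a 1)).det

open Matrix in
-- Interchanging the two unit rows costs a sign. The quadratic coefficients of E_aa + E_bb and E_ab
-- + E_ba are thus opposite, and the factor (-i)² makes them agree.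
theorem det_updateRow_updateRow_single {n : Type*} [Fintype n] [DecidableEq n]
    (K : Matrix n n ℂ) {a b : n} (hab : a ≠ b) :
    ((K.updateRow a (Pi.single a 1)).updateRow b (Pi.single b 1)).det = -swapMinor K a b := by
  have h := det_permute (Equiv.swap a b)
    ((K.updateRow a (Pi.single b 1)).updateRow b (Pi.single a 1))
  rw [Equiv.Perm.sign_swap hab] at h
  rw [swapMinor]
  simp only [Units.val_neg, Units.val_one, Int.cast_neg, Int.cast_one, neg_mul, one_mul] at h
  rw [← h]
  congr 1
  ext i j
  simp only [submatrix_apply, id]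
  by_cases hb : i = b
  · subst hb
    simp [updateRow_apply, hab]
  · by_cases ha : i = a
    · subst ha
      simp [updateRow_apply, hab]
    · simp [updateRow_apply, ha, hb, Equiv.swap_apply_of_ne_of_ne ha hb]

open Matrix in
-- The perturbation touches only rows a and b, which the minor overwrites.
theorem swapMinor_add_smul {n : Type*} [Fintype n] [DecidableEq n]
    (K : Matrix n n ℂ) {a b : n} (hab : a ≠ b) (c d : n) (x : ℂ) :
    swapMinor (K + x • (single a c 1 + single b d 1)) a b = swapMinor K a b := by
  rw [add_smul_single_add_single K hab, swapMinor, swapMinor, updateRow_comm _ hab.symm]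
  congr 1
  ext i j
  simp only [updateRow_apply]
  split_ifs <;> rfl

/-- The coupling `x (E_ab + E_ba)` of a Gaussian variable can be replaced, after a shift, by
`x (E_aa + E_bb)`. -/
theorem integral_cexp_mul_det_offDiag {n : Type*} [Fintype n] [DecidableEq n]
    {v : NNReal} (hv : v ≠ 0) (β : ℝ) (K : Matrix n n ℂ) {a b : n} (hab : a ≠ b) :
    ∫ x : ℝ, Complex.exp (β * x * Complex.I) *
        (K + (-(Complex.I * x)) • (Matrix.single a b 1 + Matrix.single b a 1)).det
          ∂gaussianReal 0 v
      = ∫ x : ℝ, Complex.exp (-(v * β ^ 2 / 2)) *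
        (K + ((v * β : ℂ) • (Matrix.single a b 1 + Matrix.single b a 1)
          + (x : ℂ) • (Matrix.single a a 1 + Matrix.single b b 1))).det ∂gaussianReal 0 v := by
  -- The shifted matrix. On the diagonal side the linear term averages to zero, leaving det K' plus
  -- v times the quadratic coefficient.
  set K' := K + (v * β : ℂ) • (Matrix.single a b 1 + Matrix.single b a 1) with hK'
  have hm : swapMinor K' a b = swapMinor K a b := swapMinor_add_smul K hab _ _ _
  simp_rw [← add_assoc, ← hK', add_smul_single_add_single K hab,
    add_smul_single_add_single K' hab, det_updateRow_updateRow_add_smul _ hab,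
    det_updateRow_updateRow_single K' hab, hm]
  rw [integral_const_mul, integral_quadratic_gaussianReal hv]
  rw [hK', add_smul_single_add_single K hab, det_updateRow_updateRow_add_smul _ hab]
  set q := (K.updateRow a (Pi.single b 1)).det + (K.updateRow b (Pi.single a 1)).det
  -- Up to the common exponential, the phase turns 1, x, x² into 1, ivβ, v - v²β². The terms in vβ
  -- and v²β² rebuild det K' from det K, and the remaining v is the second moment on the diagonal
  -- side.
  have h := integral_quadratic_mul_cexp_gaussianReal hv β K.det (-Complex.I * q)
    (-swapMinor K a b)
  have hs : ((K.updateRow a (Pi.single b 1)).updateRow b (Pi.single a 1)).det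
    = swapMinor K a b := rfl
  calc _ = ∫ x : ℝ, Complex.exp (β * x * Complex.I) *
        (K.det + x * (-Complex.I * q) + x ^ 2 * (-swapMinor K a b)) ∂gaussianReal 0 v := by
        refine integral_congr_ae (Filter.Eventually.of_forall fun x => ?_)
        simp only [hs]
        linear_combination Complex.exp (β * x * Complex.I) * (x ^ 2 * swapMinor K a b)
          * Complex.I_sq
    _ = _ := by
        rw [h, hs]
        linear_combination (- Complex.exp (-(v * β ^ 2 / 2)) * v * β * q) * Complex.I_sq

theorem det_add_smul_single {n : Type*} [Fintype n] [DecidableEq n]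
    (K : Matrix n n ℂ) (a : n) (x : ℂ) :
    (K + x • Matrix.single a a 1).det = K.det + x * (K.updateRow a (Pi.single a 1)).det := by
  have h : K + x • Matrix.single a a 1 = K.updateRow a (K a + x • Pi.single a 1) := by
    ext i j
    by_cases ha : i = a
    · subst ha
      simp [Matrix.single_apply, Pi.single_apply, eq_comm]
    · simp [Matrix.updateRow_apply, ha, Ne.symm ha]
  rw [h, Matrix.det_updateRow_add, Matrix.det_updateRow_smul, Matrix.updateRow_eq_self]

/-- The determinant is affine in a diagonal entry, so the phase only shifts that entry by vβ and no
noise is left. The right side stays an integral so that it can be used in the exchange of couplings.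
-/
theorem integral_cexp_mul_det_diag {n : Type*} [Fintype n] [DecidableEq n]
    {v : NNReal} (hv : v ≠ 0) (β : ℝ) (K : Matrix n n ℂ) (a : n) :
    ∫ x : ℝ, Complex.exp (β * x * Complex.I) *
        (K + (-(Complex.I * x)) • Matrix.single a a 1).det ∂gaussianReal 0 v
      = ∫ _ : ℝ, Complex.exp (-(v * β ^ 2 / 2)) *
        (K + (v * β : ℂ) • Matrix.single a a 1).det ∂gaussianReal 0 v := by
  simp_rw [det_add_smul_single]
  set q := (K.updateRow a (Pi.single a 1)).det
  have h := integral_quadratic_mul_cexp_gaussianReal hv β K.det (-Complex.I * q) 0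
  calc _ = ∫ x : ℝ, Complex.exp (β * x * Complex.I) *
        (K.det + x * (-Complex.I * q) + x ^ 2 * 0) ∂gaussianReal 0 v := by
        refine integral_congr_ae (Filter.Eventually.of_forall fun x => ?_)
        simp only
        ring
    _ = _ := by
        rw [h]
        simp only [integral_const, probReal_univ, one_smul]
        linear_combination (- Complex.exp (-(v * β ^ 2 / 2)) * v * β * q) * Complex.I_sq

theorem integral_det_add_smul_single (v : NNReal) {n : Type*} [Fintype n]
    [DecidableEq n] (K : Matrix n n ℂ) (a : n) :
    ∫ x : ℝ, (K + (x : ℂ) • Matrix.single a a 1).det ∂gaussianReal 0 v = K.det := by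
  simp_rw [det_add_smul_single]
  have h : Integrable (fun x : ℝ => (x : ℂ)) (gaussianReal 0 v) := by
    simpa using integrable_pow_mul_cexp_gaussianReal (v := v) 0 1
  rw [integral_add (integrable_const _) (h.mul_const _), integral_mul_const,
    integral_complex_ofReal]
  simp

/-! ### Exchanging couplings one coordinate at a time in a product measure. -/

/-- The old coordinate is discarded and redrawn independently from the same law; the discarded
factor has mass one. -/
theorem measurePreserving_update_pi {ι : Type*} [Fintype ι] [DecidableEq ι]
    (μ : ι → Measure ℝ) [∀ i, IsProbabilityMeasure (μ i)] (e : ι) :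
    MeasurePreserving (fun p : (ι → ℝ) × ℝ => Function.update p.1 e p.2)
      ((Measure.pi μ).prod (μ e)) (Measure.pi μ) := by
  have hm : Measurable (fun p : (ι → ℝ) × ℝ => Function.update p.1 e p.2) := by
    rw [measurable_pi_iff]
    intro i
    by_cases h : i = e
    · subst h; simpa using measurable_snd
    · simp only [Function.update_of_ne h]; fun_prop
  refine ⟨hm, (Measure.pi_eq fun s hs => ?_).symm⟩
  rw [Measure.map_apply hm (MeasurableSet.univ_pi hs)]
  have : (fun p : (ι → ℝ) × ℝ => Function.update p.1 e p.2) ⁻¹' univ.pi s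
      = (univ.pi (Function.update s e univ)) ×ˢ s e := by
    ext p
    simp only [mem_preimage, mem_pi, mem_univ, true_imp_iff, mem_prod]
    constructor
    · intro h
      refine ⟨fun i => ?_, by simpa using h e⟩
      by_cases hi : i = e
      · subst hi; simp
      · simpa [hi] using h i
    · rintro ⟨h1, h2⟩ i
      by_cases hi : i = e
      · subst hi; simpa using h2
      · simpa [hi] using h1 i
  rw [this, Measure.prod_prod, Measure.pi_pi, ← Finset.mul_prod_erase _ _ (Finset.mem_univ e),
    ← Finset.mul_prod_erase Finset.univ (fun i => μ i (s i)) (Finset.mem_univ e),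
    Function.update_self, measure_univ, one_mul, mul_comm]
  congr 1
  refine Finset.prod_congr rfl fun i hi => ?_
  rw [Function.update_of_ne (Finset.ne_of_mem_erase hi)]

theorem integral_pi_eq_integral_update {ι : Type*} [Fintype ι] [DecidableEq ι]
    (μ : ι → Measure ℝ) [∀ i, IsProbabilityMeasure (μ i)] (e : ι) {Φ : (ι → ℝ) → ℂ}
    (hΦ : Integrable Φ (Measure.pi μ)) :
    ∫ g, Φ g ∂Measure.pi μ = ∫ g, ∫ x, Φ (Function.update g e x) ∂μ e ∂Measure.pi μ := by
  have hp := measurePreserving_update_pi μ e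
  have hi : Integrable (fun p : (ι → ℝ) × ℝ => Φ (Function.update p.1 e p.2))
      ((Measure.pi μ).prod (μ e)) := hp.integrable_comp_of_integrable hΦ
  rw [← integral_prod _ hi]
  conv_lhs => rw [← hp.map_eq]
  rw [integral_map hp.measurable.aemeasurable]
  rw [hp.map_eq]
  exact hΦ.aestronglyMeasurable

theorem norm_det_le_factorial_mul_pow {n : Type*} [Fintype n] [DecidableEq n]
    (M : Matrix n n ℂ) {x : ℝ} (h : ∀ i j, ‖M i j‖ ≤ x) :
    ‖M.det‖ ≤ (Fintype.card n).factorial * x ^ Fintype.card n := by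
  have := Matrix.det_le (A := M) (abv := NormedField.toAbsoluteValue ℂ) (x := x) h
  rw [nsmul_eq_mul] at this
  exact this

theorem norm_entry_le_sum_norm {m n : Type*} [Fintype m] [Fintype n]
    (K : Matrix m n ℂ) (i : m) (j : n) : ‖K i j‖ ≤ ∑ i, ∑ j, ‖K i j‖ :=
  (Finset.single_le_sum (f := fun j => ‖K i j‖) (fun _ _ => norm_nonneg _)
    (Finset.mem_univ j)).trans
  (Finset.single_le_sum (f := fun i => ∑ j, ‖K i j‖)
    (fun _ _ => Finset.sum_nonneg fun _ _ => norm_nonneg _) (Finset.mem_univ i))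

theorem integrable_prod_mul_det_pi {ι n : Type*} [Fintype ι] [Fintype n] [DecidableEq n]
    (v : ι → NNReal) (φ : ι → ℝ → ℂ) (A : ι → ℝ → Matrix n n ℂ) (C : ℝ)
    (hφ : ∀ e, Continuous (φ e)) (hA : ∀ e, Continuous (A e)) (hφC : ∀ e x, ‖φ e x‖ ≤ C)
    (hAC : ∀ e x i j, ‖A e x i j‖ ≤ C * (1 + |x|)) (K : Matrix n n ℂ) :
    Integrable (fun g : ι → ℝ => (∏ e, φ e (g e)) * (K + ∑ e, A e (g e)).det)
      (Measure.pi fun e => gaussianReal 0 (v e)) := by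
  have := isGaussian_pi_gaussianReal v
  set k := ∑ i, ∑ j, ‖K i j‖
  have hk : 0 ≤ k := Finset.sum_nonneg fun _ _ => Finset.sum_nonneg fun _ _ => norm_nonneg _
  refine integrable_of_norm_le_one_add_norm_pow _ (Continuous.aestronglyMeasurable ?_)
    (|C| ^ Fintype.card ι * ((Fintype.card n).factorial *
      (k + Fintype.card ι * |C|) ^ Fintype.card n)) (Fintype.card n) fun g => ?_
  · refine Continuous.mul (continuous_finsetProd _ fun e _ =>
      (hφ e).comp (continuous_apply e)) (Continuous.matrix_det (continuous_const.add
      (continuous_finsetSum _ fun e _ => (hA e).comp (continuous_apply e))))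
  · rw [norm_mul, norm_prod]
    have h1 : ∏ e, ‖φ e (g e)‖ ≤ |C| ^ Fintype.card ι := by
      refine (Finset.prod_le_prod (fun _ _ => norm_nonneg _)
        fun e _ => (hφC e _).trans (le_abs_self C)).trans ?_
      simp
    have h2 : ∀ i j, ‖(K + ∑ e, A e (g e)) i j‖ ≤ (k + Fintype.card ι * |C|) * (1 + ‖g‖) := by
      intro i j
      rw [Matrix.add_apply, Matrix.sum_apply]
      refine (norm_add_le _ _).trans ?_
      have h3 : ‖∑ e, A e (g e) i j‖ ≤ Fintype.card ι * (|C| * (1 + ‖g‖)) := by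
        refine (norm_sum_le _ _).trans ?_
        rw [← nsmul_eq_mul]
        refine Finset.sum_le_card_nsmul _ _ _ fun e _ => (hAC e _ i j).trans ?_
        have := norm_le_pi_norm g e
        rw [Real.norm_eq_abs] at this
        gcongr
        exact le_abs_self C
      have h4 := norm_entry_le_sum_norm K i j
      nlinarith [mul_nonneg hk (norm_nonneg g)]
    calc _ ≤ |C| ^ Fintype.card ι * ((Fintype.card n).factorial *
        ((k + Fintype.card ι * |C|) * (1 + ‖g‖)) ^ Fintype.card n) := by
          gcongr
          exact norm_det_le_factorial_mul_pow _ h2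
      _ = _ := by rw [mul_pow]; ring

/-- Independent Gaussian couplings inside a determinant may be exchanged one at a time. -/
theorem integral_prod_mul_det_pi_congr {ι n : Type*} [Fintype ι] [Fintype n]
    [DecidableEq n] (v : ι → NNReal) (φ ψ : ι → ℝ → ℂ) (A B : ι → ℝ → Matrix n n ℂ) (C : ℝ)
    (hφ : ∀ e, Continuous (φ e)) (hA : ∀ e, Continuous (A e)) (hφC : ∀ e x, ‖φ e x‖ ≤ C)
    (hAC : ∀ e x i j, ‖A e x i j‖ ≤ C * (1 + |x|))
    (hψ : ∀ e, Continuous (ψ e)) (hB : ∀ e, Continuous (B e)) (hψC : ∀ e x, ‖ψ e x‖ ≤ C)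
    (hBC : ∀ e x i j, ‖B e x i j‖ ≤ C * (1 + |x|))
    (h : ∀ e (K : Matrix n n ℂ), ∫ x, φ e x * (K + A e x).det ∂gaussianReal 0 (v e)
      = ∫ x, ψ e x * (K + B e x).det ∂gaussianReal 0 (v e)) (K : Matrix n n ℂ) :
    ∫ g, (∏ e, φ e (g e)) * (K + ∑ e, A e (g e)).det ∂Measure.pi (fun e => gaussianReal 0 (v e))
      = ∫ g, (∏ e, ψ e (g e)) * (K + ∑ e, B e (g e)).det
          ∂Measure.pi fun e => gaussianReal 0 (v e) := by
  classical
  -- Interpolation: couplings in T are of the first kind, the others of the second. Induction on T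
  -- shows that the integral does not depend on T.
  let Φ : Finset ι → ι → ℝ → ℂ := fun T e => if e ∈ T then φ e else ψ e
  let D : Finset ι → ι → ℝ → Matrix n n ℂ := fun T e => if e ∈ T then A e else B e
  let Y : Finset ι → (ι → ℝ) → ℂ := fun T g => (∏ e, Φ T e (g e)) * (K + ∑ e, D T e (g e)).det
  have hint : ∀ T, Integrable (Y T) (Measure.pi fun e => gaussianReal 0 (v e)) := fun T =>
    integrable_prod_mul_det_pi v (Φ T) (D T) C
      (fun e => by by_cases he : e ∈ T <;> simp [Φ, he, hφ, hψ])
      (fun e => by by_cases he : e ∈ T <;> simp [D, he, hA, hB])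
      (fun e => by by_cases he : e ∈ T <;> simp [Φ, he, hφC, hψC])
      (fun e => by by_cases he : e ∈ T <;> simp [D, he, hAC, hBC]) K
  have hupd : ∀ T e (g : ι → ℝ) x, Y T (Function.update g e x)
      = (∏ i ∈ Finset.univ.erase e, Φ T i (g i)) *
        (Φ T e x * ((K + ∑ i ∈ Finset.univ.erase e, D T i (g i)) + D T e x).det) := by
    intro T e g x
    simp only [Y]
    rw [← Finset.mul_prod_erase _ _ (Finset.mem_univ e),
      ← Finset.add_sum_erase _ _ (Finset.mem_univ e), Function.update_self,
      Finset.prod_congr rfl fun i hi => by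
        rw [Function.update_of_ne (Finset.ne_of_mem_erase hi)],
      Finset.sum_congr rfl fun i hi => by
        rw [Function.update_of_ne (Finset.ne_of_mem_erase hi)],
      add_comm (D T e x), add_assoc]
    ring
  have hstep : ∀ T : Finset ι, ∫ g, Y T g ∂Measure.pi (fun e => gaussianReal 0 (v e))
      = ∫ g, Y ∅ g ∂Measure.pi fun e => gaussianReal 0 (v e) := by
    intro T
    induction T using Finset.induction_on with
    | empty => rfl
    | insert e T he ih =>
      -- Only the coordinate e differs between the two integrands. It is integrated first, with all
      -- other couplings frozen into the matrix of hypothesis `h`.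
      rw [← ih, integral_pi_eq_integral_update _ e (hint _),
        integral_pi_eq_integral_update _ e (hint T)]
      refine integral_congr_ae (Filter.Eventually.of_forall fun g => ?_)
      simp only [hupd]
      rw [integral_const_mul, integral_const_mul,
        Finset.prod_congr rfl fun i hi => by
          rw [show Φ (insert e T) i = Φ T i by
            simp [Φ, Finset.ne_of_mem_erase hi]],
        Finset.sum_congr rfl fun i hi => by
          rw [show D (insert e T) i = D T i by
            simp [D, Finset.ne_of_mem_erase hi]]]
      simp only [Φ, D, Finset.mem_insert_self, if_true, he, if_false, h]
  have := hstep Finset.univ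
  simpa [Y, Φ, D] using this

/-! ### Laws of linear images of independent Gaussians. -/

theorem integral_cexp_sum_pi_gaussianReal {ι : Type*} [Fintype ι] (v : ι → NNReal)
    (θ : ι → ℝ) :
    ∫ g : ι → ℝ, Complex.exp (((∑ e, θ e * g e : ℝ) : ℂ) * Complex.I)
        ∂Measure.pi (fun e => gaussianReal 0 (v e))
      = Complex.exp (((-(∑ e, v e * θ e ^ 2) / 2 : ℝ) : ℂ)) := by
  have : ∀ g : ι → ℝ, Complex.exp (((∑ e, θ e * g e : ℝ) : ℂ) * Complex.I)
      = ∏ e, Complex.exp (θ e * g e * Complex.I) := fun g => by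
    rw [← Complex.exp_sum]; push_cast; rw [Finset.sum_mul]
  simp_rw [this]
  rw [integral_fintype_prod_eq_prod (fun e (x : ℝ) => Complex.exp (θ e * x * Complex.I))]
  simp_rw [integral_cexp_gaussianReal]
  rw [← Complex.exp_sum]
  push_cast
  congr 1
  rw [neg_div, Finset.sum_div, Finset.sum_neg_distrib]

/-- Linear images of independent centered Gaussians agree in law if their covariances do. -/
theorem map_pi_gaussianReal_eq_of_variance_eq {ι κ n : Type*} [Fintype ι] [Fintype κ] [Fintype n]
    (v : ι → NNReal) (v' : κ → NNReal) (w : ι → n → ℝ) (w' : κ → n → ℝ)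
    (h : ∀ l : n → ℝ, ∑ e, v e * (∑ a, l a * w e a) ^ 2 = ∑ e, v' e * (∑ a, l a * w' e a) ^ 2) :
    Measure.map (fun (g : ι → ℝ) a => ∑ e, g e * w e a)
        (Measure.pi fun e => gaussianReal 0 (v e))
      = Measure.map (fun (g : κ → ℝ) a => ∑ e, g e * w' e a)
        (Measure.pi fun e => gaussianReal 0 (v' e)) := by
  classical
  have hm : Measurable (fun (g : ι → ℝ) a => ∑ e, g e * w e a) := by fun_prop
  have hm' : Measurable (fun (g : κ → ℝ) a => ∑ e, g e * w' e a) := by fun_prop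
  have := Measure.isProbabilityMeasure_map (μ := Measure.pi fun e => gaussianReal 0 (v e))
    hm.aemeasurable
  have := Measure.isProbabilityMeasure_map (μ := Measure.pi fun e => gaussianReal 0 (v' e))
    hm'.aemeasurable
  -- A law is determined by its characteristic function, and that of a centered Gaussian involves
  -- only the variances of its linear functionals.
  refine Measure.ext_of_charFunDual (funext fun L => ?_)
  have hL : ∀ y : n → ℝ, L y = ∑ a, L (Pi.single a 1) * y a := fun y => by
    conv_lhs => rw [pi_eq_sum_univ' y]
    simp [map_sum, mul_comm]
  rw [charFunDual_apply, charFunDual_apply, integral_map hm.aemeasurable (by fun_prop),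
    integral_map hm'.aemeasurable (by fun_prop)]
  have hs : ∀ g : ι → ℝ, L (fun a => ∑ e, g e * w e a)
      = ∑ e, (∑ a, L (Pi.single a 1) * w e a) * g e := fun g => by
    rw [hL]
    simp only [Finset.mul_sum, Finset.sum_mul]
    rw [Finset.sum_comm]
    exact Finset.sum_congr rfl fun _ _ => Finset.sum_congr rfl fun _ _ => by ring
  have hs' : ∀ g : κ → ℝ, L (fun a => ∑ e, g e * w' e a)
      = ∑ e, (∑ a, L (Pi.single a 1) * w' e a) * g e := fun g => by
    rw [hL]
    simp only [Finset.mul_sum, Finset.sum_mul]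
    rw [Finset.sum_comm]
    exact Finset.sum_congr rfl fun _ _ => Finset.sum_congr rfl fun _ _ => by ring
  simp_rw [hs, hs']
  rw [integral_cexp_sum_pi_gaussianReal, integral_cexp_sum_pi_gaussianReal, h]

/-! ### Averaging over a GOE matrix in its upper-triangular coordinates. -/

/-- The positions on and above the diagonal of an `N × N` matrix. -/
abbrev UpperIndex (N : ℕ) := {p : Fin N × Fin N // p.1 ≤ p.2}

theorem sum_upperIndex {M : Type*} [AddCommMonoid M] {N : ℕ} (F : Fin N → Fin N → M) :
    ∑ e : UpperIndex N, (if e.1.1 = e.1.2 then F e.1.1 e.1.1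
      else F e.1.1 e.1.2 + F e.1.2 e.1.1) = ∑ a, ∑ b, F a b := by
  rw [← Finset.sum_subtype (Finset.univ.filter fun p : Fin N × Fin N => p.1 ≤ p.2)
    (fun p => by simp) (fun p : Fin N × Fin N => if p.1 = p.2 then F p.1 p.1
      else F p.1 p.2 + F p.2 p.1), Finset.sum_filter, Fintype.sum_prod_type]
  have h1 : ∀ a b : Fin N, (if a ≤ b then (if a = b then F a a else F a b + F b a) else 0)
      = (if a ≤ b then F a b else 0) + (if a < b then F b a else 0) := by
    intro a b
    rcases lt_trichotomy a b with h | h | h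
    · simp [h, h.le, h.ne]
    · subst h; simp
    · simp [h.not_ge, h.le]
  simp only [h1, Finset.sum_add_distrib]
  rw [Finset.sum_comm (f := fun a b => if a < b then F b a else 0), ← Finset.sum_add_distrib]
  refine Finset.sum_congr rfl fun a _ => ?_
  rw [← Finset.sum_add_distrib]
  refine Finset.sum_congr rfl fun b _ => ?_
  rcases lt_or_ge b a with h | h
  · simp [h, h.not_ge]
  · simp [h, h.not_gt]

/-- The variances of the entries of a GOE matrix. -/
noncomputable def goeVar {N : ℕ} (e : UpperIndex N) : NNReal :=
  if e.1.1 = e.1.2 then 2 / N else 1 / N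

/-- The symmetric matrix unit at a position. -/
def symUnit {N : ℕ} (R : Type*) [Ring R] (e : UpperIndex N) : Matrix (Fin N) (Fin N) R :=
  if e.1.1 = e.1.2 then Matrix.single e.1.1 e.1.1 1
  else Matrix.single e.1.1 e.1.2 1 + Matrix.single e.1.2 e.1.1 1

/-- The symmetric matrix with given entries on and above the diagonal. -/
def symOfUpper {N : ℕ} (g : UpperIndex N → ℝ) : Matrix (Fin N) (Fin N) ℝ :=
  ∑ e, g e • symUnit ℝ e

theorem sum_smul_symUnit {N : ℕ} {R : Type*} [CommRing R] (A : Matrix (Fin N) (Fin N) R)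
    (hA : A.IsSymm) : ∑ e : UpperIndex N, A e.1.1 e.1.2 • symUnit R e = A := by
  conv_rhs => rw [Matrix.matrix_eq_sum_single A]
  rw [← sum_upperIndex]
  refine Finset.sum_congr rfl fun e _ => ?_
  unfold symUnit
  split_ifs with h
  · rw [← h, Matrix.smul_single, smul_eq_mul, mul_one]
  · rw [smul_add, Matrix.smul_single, Matrix.smul_single, smul_eq_mul, mul_one, hA.apply]

theorem map_symOfUpper {N : ℕ} (g : UpperIndex N → ℝ) :
    (symOfUpper g).map Complex.ofReal = ∑ e, (g e : ℂ) • symUnit ℂ e := by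
  ext i j
  simp only [symOfUpper, Matrix.map_apply, Matrix.sum_apply, Matrix.smul_apply, smul_eq_mul,
    Complex.ofReal_sum, Complex.ofReal_mul]
  refine Finset.sum_congr rfl fun e _ => ?_
  congr 1
  unfold symUnit
  split_ifs <;> simp [Matrix.single_apply, Matrix.add_apply, apply_ite Complex.ofReal]

theorem sum_symOfUpper_mul {N : ℕ} (g : UpperIndex N → ℝ) (A : Matrix (Fin N) (Fin N) ℝ)
    (hA : A.IsSymm) :
    ∑ i, ∑ j, symOfUpper g i j * A i j
      = ∑ e : UpperIndex N, (if e.1.1 = e.1.2 then 1 else 2) * A e.1.1 e.1.2 * g e := by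
  have h : ∀ e : UpperIndex N, ∑ i, ∑ j, symUnit ℝ e i j * A i j
      = (if e.1.1 = e.1.2 then 1 else 2) * A e.1.1 e.1.2 := by
    intro e
    unfold symUnit
    split_ifs with h
    · rw [← h]
      simp [Matrix.single_apply, ite_and]
    · simp [Matrix.single_apply, ite_and, add_mul, Finset.sum_add_distrib]
      rw [hA.apply]; ring
  have h1 : ∀ i, ∑ j, symOfUpper g i j * A i j
      = ∑ e : UpperIndex N, ∑ j, symUnit ℝ e i j * A i j * g e := fun i => by
    rw [Finset.sum_comm]
    refine Finset.sum_congr rfl fun j _ => ?_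
    simp only [symOfUpper, Matrix.sum_apply, Matrix.smul_apply, smul_eq_mul, Finset.sum_mul]
    exact Finset.sum_congr rfl fun _ _ => by ring
  simp_rw [h1]
  rw [Finset.sum_comm]
  simp_rw [← h, Finset.sum_mul]

/-- Two expressions for the variance of a linear functional of the diagonal noise. On the left every
pair {a, b} adds one variable of variance 1/N to the entries a and b. On the right stand a common
scalar of variance 1/N and independent entries of variance (N - 2)/N. -/
theorem sum_upperIndex_var_mul_sq {N : ℕ} (hN : 2 ≤ N) (l : Fin N → ℝ) :
    ∑ e : UpperIndex N, (if e.1.1 = e.1.2 then 0 else (1 / N : ℝ) * (l e.1.1 + l e.1.2) ^ 2)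
      = (1 / N : ℝ) * (∑ a, l a) ^ 2 + ((N - 2) / N : ℝ) * ∑ a, l a ^ 2 := by
  have hN' : (N : ℝ) ≠ 0 := by positivity
  have h := sum_upperIndex (N := N)
    (fun a b => if a = b then 0 else (1 / (2 * N) : ℝ) * (l a + l b) ^ 2)
  have h1 : ∑ e : UpperIndex N, (if e.1.1 = e.1.2 then 0 else (1 / N : ℝ) * (l e.1.1 + l e.1.2) ^ 2)
      = ∑ a, ∑ b, (if a = b then 0 else (1 / (2 * N) : ℝ) * (l a + l b) ^ 2) := by
    rw [← h]
    refine Finset.sum_congr rfl fun e _ => ?_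
    by_cases he : e.1.1 = e.1.2
    · simp [he]
    · simp only [he, if_false, Ne.symm he]
      field_simp
      ring
  have h2 : ∀ a b, (if a = b then 0 else (1 / (2 * N) : ℝ) * (l a + l b) ^ 2)
      = (1 / (2 * N) : ℝ) * (l a ^ 2 + 2 * (l a * l b) + l b ^ 2)
        - (if a = b then (2 / N : ℝ) * l a ^ 2 else 0) := by
    intro a b
    split_ifs with hab
    · subst hab; field_simp; ring
    · ring
  rw [h1]
  simp_rw [h2, Finset.sum_sub_distrib, ← Finset.mul_sum, Finset.sum_add_distrib, ← Finset.mul_sum]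
  simp only [Finset.sum_ite_eq, Finset.mem_univ, if_true, Finset.sum_const, Finset.card_univ,
    Fintype.card_fin, nsmul_eq_mul]
  rw [← Finset.sum_mul, ← Finset.mul_sum, ← Finset.mul_sum]
  field_simp
  ring

/-- Diagonal Gaussian couplings with the covariance of the pair couplings reduce to a scalar
coupling. -/
theorem integral_det_add_pairDiag {N : ℕ} (hN : 2 ≤ N) (K : Matrix (Fin N) (Fin N) ℂ) :
    ∫ g : UpperIndex N → ℝ, (K + ∑ e, if e.1.1 = e.1.2 then 0 else
        (g e : ℂ) • (Matrix.single e.1.1 e.1.1 1 + Matrix.single e.1.2 e.1.2 1)).det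
        ∂Measure.pi (fun e => gaussianReal 0 (goeVar e))
      = ∫ x : ℝ, (K + (x : ℂ) • (1 : Matrix (Fin N) (Fin N) ℂ)).det
          ∂gaussianReal 0 (1 / N : NNReal) := by
  have hN' : (2 : ℝ) ≤ N := by exact_mod_cast hN
  let w : UpperIndex N → Fin N → ℝ := fun e a => if e.1.1 = e.1.2 then 0 else
    (Pi.single e.1.1 1 : Fin N → ℝ) a + (Pi.single e.1.2 1 : Fin N → ℝ) a
  let w' : Option (Fin N) → Fin N → ℝ := fun o => o.elim (fun _ => 1) fun b => Pi.single b 1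
  -- The index `none` carries the common scalar, `some b` the independent noise at entry b. The
  -- truncated subtraction is exact since N ≥ 2.
  let v' : Option (Fin N) → NNReal := fun o => o.elim (1 / N) fun _ => ((N - 2 : ℕ) / N : NNReal)
  let Ψ : (Fin N → ℝ) → ℂ := fun d => (K + Matrix.diagonal fun a => (d a : ℂ)).det
  have hΨ : Continuous Ψ := by
    refine Continuous.matrix_det (continuous_const.add ?_)
    exact Continuous.matrix_diagonal (by fun_prop)
  have hlaw := map_pi_gaussianReal_eq_of_variance_eq (fun e : UpperIndex N => goeVar e) v' w w'
    (fun l => by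
      rw [Fintype.sum_option]
      have h1 := sum_upperIndex_var_mul_sq hN l
      simp only [v', w', Option.elim, mul_one, Pi.single_apply, mul_ite, mul_zero,
        Finset.sum_ite_eq', Finset.mem_univ, if_true, ← Finset.mul_sum]
      have h3 : (((N - 2 : ℕ) / N : NNReal) : ℝ) = ((N - 2) / N : ℝ) := by
        rw [NNReal.coe_div, NNReal.coe_natCast, NNReal.coe_natCast, Nat.cast_sub hN]; norm_num
      rw [h3]
      refine Eq.trans (Finset.sum_congr rfl fun e _ => ?_) (h1.trans (by push_cast; rfl))
      by_cases he : e.1.1 = e.1.2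
      · simp [w, he]
      · simp [w, he, goeVar, mul_add, Finset.sum_add_distrib, Pi.single_apply])
  have hm : Measurable (fun (g : UpperIndex N → ℝ) a => ∑ e, g e * w e a) := by fun_prop
  have hm' : Measurable (fun (g : Option (Fin N) → ℝ) a => ∑ e, g e * w' e a) := by fun_prop
  have e1 : ∀ g : UpperIndex N → ℝ, (K + ∑ e, if e.1.1 = e.1.2 then 0 else
        (g e : ℂ) • (Matrix.single e.1.1 e.1.1 1 + Matrix.single e.1.2 e.1.2 1)).det
      = Ψ (fun a => ∑ e, g e * w e a) := fun g => by
    simp only [Ψ]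
    congr 2
    ext i j
    rw [Matrix.sum_apply, Matrix.diagonal_apply]
    split_ifs with hij
    · subst hij
      push_cast
      refine Finset.sum_congr rfl fun e _ => ?_
      simp only [w]
      split_ifs <;> simp [Matrix.single_apply, Pi.single_apply, eq_comm, apply_ite Complex.ofReal]
    · refine Finset.sum_eq_zero fun e _ => ?_
      split_ifs
      · rfl
      · have : ∀ a : Fin N, ¬(a = i ∧ a = j) := fun a h => hij (h.1.symm.trans h.2)
        simp [this]
  have e2 : ∀ g : Option (Fin N) → ℝ, Ψ (fun a => ∑ e, g e * w' e a)
      = (∏ _e : Option (Fin N), (1 : ℂ)) * (K + ∑ e : Option (Fin N), e.elim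
        ((g e : ℂ) • (1 : Matrix (Fin N) (Fin N) ℂ))
        fun a => (g e : ℂ) • Matrix.single a a 1).det := fun g => by
    simp only [Ψ, Finset.prod_const_one, one_mul]
    congr 2
    rw [Fintype.sum_option]
    ext i j
    simp only [Option.elim, Matrix.add_apply, Matrix.sum_apply, Matrix.smul_apply,
      Matrix.diagonal_apply, Matrix.one_apply, Matrix.single_apply, Fintype.sum_option, w']
    split_ifs with hij
    · subst hij
      simp [Pi.single_apply]
    · have : ∀ a : Fin N, ¬(a = i ∧ a = j) := fun a h => hij (h.1.symm.trans h.2)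
      simp [this]
  simp_rw [e1]
  rw [← integral_map (f := Ψ) hm.aemeasurable hΨ.aestronglyMeasurable, hlaw,
    integral_map hm'.aemeasurable hΨ.aestronglyMeasurable]
  simp_rw [e2]
  -- The independent diagonal couplings are exchanged for zero: the determinant is affine in each of
  -- them and they are centered.
  rw [integral_prod_mul_det_pi_congr v' (fun _ _ => 1) (fun _ _ => 1)
    (fun (o : Option (Fin N)) (x : ℝ) => o.elim ((x : ℂ) • (1 : Matrix (Fin N) (Fin N) ℂ))
      fun a => (x : ℂ) • Matrix.single a a 1)
    (fun (o : Option (Fin N)) (x : ℝ) => o.elim ((x : ℂ) • (1 : Matrix (Fin N) (Fin N) ℂ))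
      fun a => 0) 1 (fun _ => continuous_const) ?_ (by simp) ?_ (fun _ => continuous_const)
    ?_ (by simp) ?_ ?_]
  · simp only [Finset.prod_const_one, one_mul, Fintype.sum_option, Option.elim,
      Finset.sum_const_zero, add_zero]
    have hp := measurePreserving_eval (fun e => gaussianReal 0 (v' e)) none
    have hc : Continuous fun x : ℝ => (K + (x : ℂ) • (1 : Matrix (Fin N) (Fin N) ℂ)).det :=
      Continuous.matrix_det (continuous_const.add
        (Complex.continuous_ofReal.smul continuous_const))
    have := integral_map (μ := Measure.pi fun e => gaussianReal 0 (v' e))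
      (f := fun x : ℝ => (K + (x : ℂ) • (1 : Matrix (Fin N) (Fin N) ℂ)).det)
      hp.measurable.aemeasurable hc.aestronglyMeasurable
    rw [hp.map_eq] at this
    exact this.symm
  · rintro (_ | a) <;> simp only [Option.elim] <;>
      exact Complex.continuous_ofReal.smul continuous_const
  · rintro (_ | a) x i j
    · simp only [Option.elim, Matrix.smul_apply, Matrix.one_apply]
      split_ifs <;> (simp; try positivity)
    · simp only [Option.elim, Matrix.smul_apply, Matrix.single_apply]
      split_ifs <;> (simp; try positivity)
  · rintro (_ | a) <;> simp only [Option.elim]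
    · exact Complex.continuous_ofReal.smul continuous_const
    · exact continuous_const
  · rintro (_ | a) x i j
    · simp only [Option.elim, Matrix.smul_apply, Matrix.one_apply]
      split_ifs <;> (simp; try positivity)
    · simp only [Option.elim]
      simp; positivity
  · rintro (_ | a) K
    · rfl
    · simp only [Option.elim, one_mul, add_zero]
      rw [integral_det_add_smul_single]
      simp

theorem integral_cexp_mul_det_symUnit {N : ℕ} (hN : 2 ≤ N) (e : UpperIndex N) (β : ℝ)
    (K : Matrix (Fin N) (Fin N) ℂ) :
    ∫ x : ℝ, Complex.exp (β * x * Complex.I) * (K + (-(Complex.I * x)) • symUnit ℂ e).det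
        ∂gaussianReal 0 (goeVar e)
      = ∫ x : ℝ, Complex.exp (-(goeVar e * β ^ 2 / 2)) *
        (K + (((goeVar e * β : ℝ) : ℂ) • symUnit ℂ e + if e.1.1 = e.1.2 then 0 else
          (x : ℂ) • (Matrix.single e.1.1 e.1.1 1 + Matrix.single e.1.2 e.1.2 1))).det
        ∂gaussianReal 0 (goeVar e) := by
  have hN' : (N : NNReal) ≠ 0 := by positivity
  have hv : goeVar e ≠ 0 := by
    unfold goeVar; split_ifs <;> simp [hN']
  unfold symUnit
  push_cast
  by_cases h : e.1.1 = e.1.2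
  · simp only [h, if_true, add_zero]
    exact integral_cexp_mul_det_diag hv β K _
  · simp only [h, if_false]
    exact integral_cexp_mul_det_offDiag hv β K h

theorem norm_symUnit_le_one {N : ℕ} (e : UpperIndex N) (i j : Fin N) :
    ‖symUnit ℂ e i j‖ ≤ 1 := by
  unfold symUnit
  split_ifs with h
  · rw [Matrix.single_apply]; split_ifs <;> simp
  · rw [Matrix.add_apply, Matrix.single_apply, Matrix.single_apply]
    by_cases h1 : e.1.1 = i ∧ e.1.2 = j
    · have h2 : ¬ (e.1.2 = i ∧ e.1.1 = j) := fun h2 => h (h1.1.trans h2.1.symm)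
      rw [if_pos h1, if_neg h2]
      simp
    · simp only [h1, if_false, zero_add]
      split_ifs <;> simp

theorem integral_cexp_mul_det_symOfUpper {N : ℕ} (hN : 2 ≤ N) (K : Matrix (Fin N) (Fin N) ℂ)
    (A : Matrix (Fin N) (Fin N) ℝ) (hA : A.IsSymm) :
    ∫ g : UpperIndex N → ℝ, Complex.exp (N * ((∑ i, ∑ j, symOfUpper g i j * A i j : ℝ) : ℂ)
        * Complex.I) * (K - Complex.I • (symOfUpper g).map Complex.ofReal).det
        ∂Measure.pi (fun e => gaussianReal 0 (goeVar e))
      = Complex.exp (-N * ((∑ i, ∑ j, A i j ^ 2 : ℝ) : ℂ)) *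
        ∫ x : ℝ, (K + (2 : ℂ) • A.map Complex.ofReal
          + (x : ℂ) • (1 : Matrix (Fin N) (Fin N) ℂ)).det ∂gaussianReal 0 (1 / N : NNReal) := by
  have hN' : (N : ℝ) ≠ 0 := by positivity
  have hNc : (N : ℂ) ≠ 0 := by exact_mod_cast hN'
  -- The coefficient of g_e in N tr(HA). Variance times coefficient is 2A_e both on the diagonal,
  -- (2/N)·N, and off it, (1/N)·2N; this yields the uniform shift by 2A.
  let β : UpperIndex N → ℝ := fun e => N * ((if e.1.1 = e.1.2 then 1 else 2) * A e.1.1 e.1.2)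
  have hvβ : ∀ e, (goeVar e : ℝ) * β e = 2 * A e.1.1 e.1.2 := fun e => by
    simp only [goeVar, β]
    split_ifs <;> push_cast <;> field_simp
  have hvβ2 : ∑ e, (goeVar e : ℝ) * β e ^ 2 / 2 = N * ∑ i, ∑ j, A i j ^ 2 := by
    rw [← sum_upperIndex (fun i j => A i j ^ 2), Finset.mul_sum]
    refine Finset.sum_congr rfl fun e _ => ?_
    rw [sq (β e), ← mul_assoc, hvβ]
    simp only [β]
    split_ifs with h
    · rw [← h]; ring
    · rw [hA.apply]; ring
  let W : UpperIndex N → ℝ → Matrix (Fin N) (Fin N) ℂ := fun e x =>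
    if e.1.1 = e.1.2 then 0 else
      (x : ℂ) • (Matrix.single e.1.1 e.1.1 1 + Matrix.single e.1.2 e.1.2 1)
  -- One constant for all the bounds: 2 covers the phases and the entries linear in x, the sum
  -- covers the shifts.
  set C : ℝ := 2 + ∑ e, |goeVar e * β e| with hC
  have hC0 : 2 ≤ C := le_add_of_nonneg_right (Finset.sum_nonneg fun _ _ => abs_nonneg _)
  have hWb : ∀ e x i j, ‖W e x i j‖ ≤ 2 * |x| := by
    intro e x i j
    simp only [W]
    split_ifs
    · simp
    · simp only [Matrix.smul_apply, Matrix.add_apply, Matrix.single_apply, smul_eq_mul, norm_mul,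
        Complex.norm_real, Real.norm_eq_abs]
      rw [mul_comm]
      gcongr
      refine (norm_add_le _ _).trans ?_
      split_ifs <;> norm_num
  have key := integral_prod_mul_det_pi_congr (fun e : UpperIndex N => goeVar e)
    (fun e x => Complex.exp (β e * x * Complex.I))
    (fun e _ => Complex.exp (-(goeVar e * β e ^ 2 / 2)))
    (fun e x => (-(Complex.I * x)) • symUnit ℂ e)
    (fun e x => ((goeVar e * β e : ℝ) : ℂ) • symUnit ℂ e + W e x) C
    (fun e => by fun_prop)
    (fun e => Continuous.smul (continuous_const.mul Complex.continuous_ofReal).neg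
      continuous_const)
    (fun e x => by rw [norm_cexp_mul_I_ofReal]; linarith)
    (fun e x i j => by
      simp only [Matrix.smul_apply, smul_eq_mul, norm_mul, norm_neg, Complex.norm_I, one_mul,
        Complex.norm_real, Real.norm_eq_abs]
      nlinarith [norm_symUnit_le_one e i j, abs_nonneg x, norm_nonneg (symUnit ℂ e i j)])
    (fun e => continuous_const)
    (fun e => by
      refine continuous_const.add ?_
      simp only [W]
      split_ifs
      · exact continuous_const
      · exact Complex.continuous_ofReal.smul continuous_const)
    (fun e x => by
      rw [Complex.norm_exp]
      have : (-((goeVar e : ℂ) * (β e : ℂ) ^ 2 / 2)).re = -((goeVar e : ℝ) * β e ^ 2 / 2) := by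
        rw [← Complex.ofReal_re (-((goeVar e : ℝ) * β e ^ 2 / 2))]; push_cast; rfl
      rw [this]
      have : Real.exp (-((goeVar e : ℝ) * β e ^ 2 / 2)) ≤ 1 := by
        rw [Real.exp_le_one_iff]
        have : 0 ≤ (goeVar e : ℝ) * β e ^ 2 / 2 := by positivity
        linarith
      linarith)
    (fun e x i j => by
      simp only [Matrix.add_apply, Matrix.smul_apply, smul_eq_mul]
      refine (norm_add_le _ _).trans ?_
      rw [norm_mul, Complex.norm_real, Real.norm_eq_abs]
      have h1 := hWb e x i j
      have h2 : |goeVar e * β e| ≤ ∑ e, |goeVar e * β e| :=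
        Finset.single_le_sum (f := fun e => |(goeVar e : ℝ) * β e|) (fun _ _ => abs_nonneg _)
          (Finset.mem_univ e)
      have h3 := mul_le_of_le_one_right (abs_nonneg ((goeVar e : ℝ) * β e))
        (norm_symUnit_le_one e i j)
      nlinarith [abs_nonneg x, abs_nonneg ((goeVar e : ℝ) * β e)])
    (fun e K => integral_cexp_mul_det_symUnit hN e (β e) K) K
  have hA2 : ∑ e, ((goeVar e * β e : ℝ) : ℂ) • symUnit ℂ e = (2 : ℂ) • A.map Complex.ofReal := by
    rw [← sum_smul_symUnit (A.map Complex.ofReal) (hA.map _), Finset.smul_sum]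
    refine Finset.sum_congr rfl fun e _ => ?_
    rw [hvβ, smul_smul]
    simp
  calc _ = _ := by
        refine integral_congr_ae (Filter.Eventually.of_forall fun g => ?_)
        simp only
        rw [map_symOfUpper, sum_symOfUpper_mul g A hA, ← Complex.exp_sum, Finset.smul_sum,
          sub_eq_add_neg, ← Finset.sum_neg_distrib]
        congr 2
        · push_cast
          rw [Finset.mul_sum, Finset.sum_mul]
          refine Finset.sum_congr rfl fun e _ => ?_
          simp only [β]
          push_cast
          ring
        · congr 1
          refine Finset.sum_congr rfl fun e _ => ?_
          rw [smul_smul, neg_smul]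
    _ = _ := key
    _ = _ := by
      rw [← integral_det_add_pairDiag hN, ← integral_const_mul]
      refine integral_congr_ae (Filter.Eventually.of_forall fun g => ?_)
      simp only
      rw [← Complex.exp_sum, Finset.sum_add_distrib, hA2, add_assoc]
      congr 2
      rw [Finset.sum_neg_distrib, neg_mul, ← Complex.ofReal_natCast, ← Complex.ofReal_mul, ← hvβ2]
      push_cast
      rfl

/-! ### The averaged determinant for a perturbation of rank two. -/

open Matrix in
theorem det_smul_one_add_rank_two {N : ℕ} (hN : 2 ≤ N) (u : ℂ) (x y : Fin N → ℝ) :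
    (u • (1 : Matrix (Fin N) (Fin N) ℂ)
      + (2 : ℂ) • (vecMulVec x x + vecMulVec y y).map Complex.ofReal).det
      = u ^ N + 2 * ((x ⬝ᵥ x + y ⬝ᵥ y : ℝ) : ℂ) * u ^ (N - 1)
        + 4 * (((x ⬝ᵥ x) * (y ⬝ᵥ y) - (x ⬝ᵥ y) ^ 2 : ℝ) : ℂ) * u ^ (N - 2) := by
  -- The sign is put into U, so the determinant is the characteristic polynomial of UV at u. It
  -- equals u^(N-2) times that of the 2 × 2 matrix VU, which is -2 times the Gram matrix of x and y.
  let U : Matrix (Fin N) (Fin 2) ℂ := Matrix.of fun i k => -2 * (![x, y] k i : ℂ)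
  let V : Matrix (Fin 2) (Fin N) ℂ := Matrix.of fun k i => (![x, y] k i : ℂ)
  have h := congrArg (Polynomial.eval u) (charpoly_mul_comm_of_le U V (by simpa using hN))
  have h1 : u • (1 : Matrix (Fin N) (Fin N) ℂ)
      + (2 : ℂ) • (vecMulVec x x + vecMulVec y y).map Complex.ofReal
      = scalar (Fin N) u - U * V := by
    ext i j
    by_cases hij : i = j
    · subst hij
      simp [U, V, mul_apply, Fin.sum_univ_two, vecMulVec_apply]
      ring
    · simp [U, V, mul_apply, Fin.sum_univ_two, vecMulVec_apply, hij]
      ring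
  rw [h1, ← eval_charpoly, h, charpoly_fin_two]
  have hd : ∀ a b : Fin N → ℝ, ∑ i, (a i : ℂ) * (-2 * (b i : ℂ)) = -2 * ((a ⬝ᵥ b : ℝ) : ℂ) := by
    intro a b
    simp only [dotProduct]
    push_cast
    rw [Finset.mul_sum]
    exact Finset.sum_congr rfl fun _ _ => by ring
  have hVU : ∀ k l, (V * U) k l = -2 * ((![x, y] k ⬝ᵥ ![x, y] l : ℝ) : ℂ) := by
    intro k l
    rw [← hd]
    simp [U, V, mul_apply]
  simp only [trace_fin_two, det_fin_two, hVU, Polynomial.eval_mul, Polynomial.eval_pow,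
    Polynomial.eval_X, Polynomial.eval_add, Polynomial.eval_sub, Polynomial.eval_C,
    Fintype.card_fin, cons_val_zero, cons_val_one, dotProduct_comm y x]
  obtain ⟨m, rfl⟩ := Nat.exists_eq_add_of_le hN
  simp only [show 2 + m - 2 = m by omega, show 2 + m - 1 = m + 1 by omega]
  push_cast
  ring

theorem integral_det_rank_two {N : ℕ} (hN : 2 ≤ N) (v : NNReal) (c : ℂ) (x y : Fin N → ℝ) :
    ∫ g : ℝ, (c • (1 : Matrix (Fin N) (Fin N) ℂ)
      + (2 : ℂ) • (Matrix.vecMulVec x x + Matrix.vecMulVec y y).map Complex.ofReal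
      + (g : ℂ) • (1 : Matrix (Fin N) (Fin N) ℂ)).det ∂gaussianReal 0 v
      = shiftedMoment v c N
        + 2 * ((x ⬝ᵥ x + y ⬝ᵥ y : ℝ) : ℂ) * shiftedMoment v c (N - 1)
        + 4 * (((x ⬝ᵥ x) * (y ⬝ᵥ y) - (x ⬝ᵥ y) ^ 2 : ℝ) : ℂ) * shiftedMoment v c (N - 2) := by
  have i : ∀ k, Integrable (fun g : ℝ => (c + g) ^ k) (gaussianReal 0 v) := fun k => by
    simpa using integrable_shifted_pow v c 0 k
  have h : ∀ g : ℝ, c • (1 : Matrix (Fin N) (Fin N) ℂ)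
      + (2 : ℂ) • (Matrix.vecMulVec x x + Matrix.vecMulVec y y).map Complex.ofReal
      + (g : ℂ) • (1 : Matrix (Fin N) (Fin N) ℂ) = (c + g) • (1 : Matrix (Fin N) (Fin N) ℂ)
      + (2 : ℂ) • (Matrix.vecMulVec x x + Matrix.vecMulVec y y).map Complex.ofReal := fun g => by
    rw [add_smul]; abel
  simp_rw [h, det_smul_one_add_rank_two hN]
  rw [integral_add ?_ ((i _).const_mul _), integral_add (i _) ((i _).const_mul _),
    integral_const_mul, integral_const_mul]
  · rfl
  · exact (i _).add ((i _).const_mul _)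

/-! ### The law of a GOE matrix and its average against the Gram phase. -/

section

variable {Ω : Type*} [MeasurableSpace Ω] {P : Measure Ω} {N : ℕ}
  {H : Ω → Matrix (Fin N) (Fin N) ℝ}

/-- Jointly Gaussian and uncorrelated variables are independent, and distinct entries on and above
the diagonal are uncorrelated. -/
theorem IsGOE.map_upper [IsProbabilityMeasure P] (hH : IsGOE P N H) :
    Measure.map (fun ω (e : UpperIndex N) => H ω e.1.1 e.1.2) P
      = Measure.pi fun e => gaussianReal 0 (goeVar e) := by
  have hg : ∀ p : Fin N × Fin N, HasGaussianLaw (fun ω => H ω p.1 p.2) P :=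
    fun p => hH.gaussian.eval p
  have hcov : ∀ i j k l, cov[fun ω => H ω i j, fun ω => H ω k l; P]
      = (1 / (N : ℝ)) * ((if j = k then 1 else 0) * (if i = l then 1 else 0) +
      (if i = k then 1 else 0) * (if j = l then 1 else 0)) := fun i j k l => by
    rw [covariance_eq_sub (hg (i, j)).memLp_two (hg (k, l)).memLp_two, hH.centered, hH.centered,
      ← hH.covariance]
    simp
  have hgu : HasGaussianLaw (fun ω (e : UpperIndex N) => H ω e.1.1 e.1.2) P :=
    hH.gaussian.map (ContinuousLinearMap.pi fun e : UpperIndex N =>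
      ContinuousLinearMap.proj (R := ℝ) (φ := fun _ : Fin N × Fin N => ℝ) e.1)
  have hind : iIndepFun (fun (e : UpperIndex N) ω => H ω e.1.1 e.1.2) P := by
    refine HasGaussianLaw.iIndepFun_of_covariance_eq_zero hgu fun e e' hee' => ?_
    rw [hcov]
    have h1 : ¬ (e.1.1 = e'.1.1 ∧ e.1.2 = e'.1.2) := fun h =>
      hee' (Subtype.ext (Prod.ext h.1 h.2))
    -- If e' were the transpose of e, both lying on or above the diagonal would force e = e'.
    have h2 : ¬ (e.1.2 = e'.1.1 ∧ e.1.1 = e'.1.2) := fun h => by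
      have h3 := e.2
      have h4 := e'.2
      rw [h.1, h.2] at h3
      have h5 := le_antisymm h3 h4
      exact h1 ⟨by rw [h.2, h5], by rw [h.1, h5]⟩
    rcases not_and_or.1 h2 with h | h <;> rcases not_and_or.1 h1 with h' | h' <;> simp [h, h']
  refine ((iIndepFun_iff_map_fun_eq_pi_map
    (f := fun (e : UpperIndex N) ω => H ω e.1.1 e.1.2)
    fun e => (hg e.1).aemeasurable).1 hind).trans ?_
  congr 1
  funext e
  rw [(hg e.1).map_eq_gaussianReal, hH.centered, ← covariance_self (hg e.1).aemeasurable, hcov]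
  congr 1
  unfold goeVar
  by_cases h : e.1.1 = e.1.2
  · simp [h, ← NNReal.coe_inj]
    ring
  · simp [h, Ne.symm h, ← NNReal.coe_inj]

theorem IsGOE.ae_eq_symOfUpper (hH : IsGOE P N H) :
    ∀ᵐ ω ∂P, H ω = symOfUpper fun e => H ω e.1.1 e.1.2 := by
  filter_upwards [hH.isSymm] with ω hω
  exact (sum_smul_symUnit (H ω) hω).symm

/-- As H is almost surely symmetric, it is almost surely rebuilt from its upper entries, whose law
is known; everything else can be done for that model. -/
theorem IsGOE.integral_eq [IsProbabilityMeasure P] (hH : IsGOE P N H)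
    {Φ : Matrix (Fin N) (Fin N) ℝ → ℂ}
    (hΦ : Integrable (fun g => Φ (symOfUpper g))
      (Measure.pi fun e : UpperIndex N => gaussianReal 0 (goeVar e))) :
    Integrable (fun ω => Φ (H ω)) P ∧ ∫ ω, Φ (H ω) ∂P
      = ∫ g, Φ (symOfUpper g) ∂Measure.pi fun e : UpperIndex N => gaussianReal 0 (goeVar e) := by
  have hm : AEMeasurable (fun ω (e : UpperIndex N) => H ω e.1.1 e.1.2) P :=
    aemeasurable_pi_lambda _ fun e => (hH.gaussian.eval e.1).aemeasurable
  have hae : (fun ω => Φ (symOfUpper fun e => H ω e.1.1 e.1.2)) =ᵐ[P] fun ω => Φ (H ω) := by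
    filter_upwards [hH.ae_eq_symOfUpper] with ω hω
    rw [← hω]
  rw [← hH.map_upper] at hΦ ⊢
  exact ⟨(hΦ.comp_aemeasurable hm).congr hae, (integral_congr_ae hae).symm.trans
    (integral_map (f := fun g => Φ (symOfUpper g)) hm hΦ.aestronglyMeasurable).symm⟩

end

theorem integrable_det_symOfUpper {N : ℕ} (c : ℂ) :
    Integrable (fun g : UpperIndex N → ℝ =>
      (c • (1 : Matrix (Fin N) (Fin N) ℂ) - Complex.I • (symOfUpper g).map Complex.ofReal).det)
      (Measure.pi fun e => gaussianReal 0 (goeVar e)) := by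
  refine (integrable_prod_mul_det_pi (fun e : UpperIndex N => goeVar e) (fun _ _ => 1)
    (fun e x => (-(Complex.I * x)) • symUnit ℂ e) 1 (fun _ => continuous_const)
    (fun e => Continuous.smul (continuous_const.mul Complex.continuous_ofReal).neg
      continuous_const) (by simp) (fun e x i j => ?_) (c • 1)).congr
    (Filter.Eventually.of_forall fun g => ?_)
  · simp only [Matrix.smul_apply, smul_eq_mul, norm_mul, norm_neg, Complex.norm_I, one_mul,
      Complex.norm_real, Real.norm_eq_abs]
    nlinarith [norm_symUnit_le_one e i j, abs_nonneg x, norm_nonneg (symUnit ℂ e i j)]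
  · simp only [Finset.prod_const_one, one_mul]
    rw [map_symOfUpper, Finset.smul_sum, sub_eq_add_neg, ← Finset.sum_neg_distrib]
    congr 2
    refine Finset.sum_congr rfl fun e _ => ?_
    rw [smul_smul, neg_smul]

open Matrix in
-- The case A = xxᵀ + yyᵀ, where the sum of the squared entries of A is a polynomial in the Gram
-- data.
theorem integral_cexp_mul_det_gram {N : ℕ} (hN : 2 ≤ N) (c : ℂ) (x y : Fin N → ℝ) :
    ∫ g : UpperIndex N → ℝ, Complex.exp (N *
        ((x ⬝ᵥ symOfUpper g *ᵥ x + y ⬝ᵥ symOfUpper g *ᵥ y : ℝ) : ℂ) * Complex.I)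
        * (c • (1 : Matrix (Fin N) (Fin N) ℂ) - Complex.I • (symOfUpper g).map Complex.ofReal).det
        ∂Measure.pi (fun e => gaussianReal 0 (goeVar e))
      = Complex.exp (-N * (((x ⬝ᵥ x) ^ 2 + (y ⬝ᵥ y) ^ 2 + 2 * (x ⬝ᵥ y) ^ 2 : ℝ) : ℂ))
        * (shiftedMoment (1 / N) c N
        + 2 * ((x ⬝ᵥ x + y ⬝ᵥ y : ℝ) : ℂ) * shiftedMoment (1 / N) c (N - 1)
        + 4 * (((x ⬝ᵥ x) * (y ⬝ᵥ y) - (x ⬝ᵥ y) ^ 2 : ℝ) : ℂ)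
          * shiftedMoment (1 / N) c (N - 2)) := by
  set A : Matrix (Fin N) (Fin N) ℝ := vecMulVec x x + vecMulVec y y with hAdef
  have hA : A.IsSymm := by
    ext i j; simp [A, vecMulVec_apply]; ring
  have hHA : ∀ M : Matrix (Fin N) (Fin N) ℝ, x ⬝ᵥ M *ᵥ x + y ⬝ᵥ M *ᵥ y
      = ∑ i, ∑ j, M i j * A i j := fun M => by
    simp only [dotProduct, mulVec, A, Matrix.add_apply, vecMulVec_apply, Finset.mul_sum,
      ← Finset.sum_add_distrib]
    exact Finset.sum_congr rfl fun _ _ => Finset.sum_congr rfl fun _ _ => by ring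
  have hA2 : ∑ i, ∑ j, A i j ^ 2 = (x ⬝ᵥ x) ^ 2 + (y ⬝ᵥ y) ^ 2 + 2 * (x ⬝ᵥ y) ^ 2 := by
    have h : ∀ i j, A i j ^ 2 = (x i * x i) * (x j * x j) + (y i * y i) * (y j * y j)
        + (2 * (x i * y i)) * (x j * y j) := fun i j => by
      simp only [A, Matrix.add_apply, vecMulVec_apply]; ring
    simp only [h, Finset.sum_add_distrib, ← Finset.mul_sum, ← Finset.sum_mul, dotProduct]
    ring
  simp_rw [hHA]
  rw [integral_cexp_mul_det_symOfUpper hN _ A hA, hA2, integral_det_rank_two hN]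

/-! ### Contour integrals about the origin. -/

section

variable {γ : ℝ → ℂ}

theorem IsContourAboutZero.intervalIntegrable (hγ : IsContourAboutZero γ) {f : ℂ → ℂ}
    (hf : ContinuousOn f {0}ᶜ) :
    IntervalIntegrable (fun τ => f (γ τ) * deriv γ τ) volume 0 1 := by
  refine hγ.integrable_deriv.continuousOn_mul ?_
  rw [uIcc_of_le zero_le_one]
  exact hf.comp hγ.continuousOn fun τ hτ => hγ.ne_zero τ hτ

theorem IsContourAboutZero.integral_congr (hγ : IsContourAboutZero γ) {f g : ℂ → ℂ}
    (h : ∀ z, z ≠ 0 → f z = g z) : contourIntegral γ f = contourIntegral γ g := by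
  refine intervalIntegral.integral_congr fun τ hτ => ?_
  rw [uIcc_of_le zero_le_one] at hτ
  simp only [h _ (hγ.ne_zero τ hτ)]

theorem contourIntegral_const_mul (γ : ℝ → ℂ) (a : ℂ) (f : ℂ → ℂ) :
    contourIntegral γ (fun z => a * f z) = a * contourIntegral γ f := by
  simp only [contourIntegral, mul_assoc]
  exact intervalIntegral.integral_const_mul _ _

theorem IsContourAboutZero.integral_linear (hγ : IsContourAboutZero γ) {f g : ℂ → ℂ}
    (hf : ContinuousOn f {0}ᶜ) (hg : ContinuousOn g {0}ᶜ) (a b : ℂ) :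
    contourIntegral γ (fun z => a * f z + b * g z)
      = a * contourIntegral γ f + b * contourIntegral γ g := by
  rw [← contourIntegral_const_mul, ← contourIntegral_const_mul]
  simp only [contourIntegral, add_mul]
  exact intervalIntegral.integral_add (hγ.intervalIntegrable (continuousOn_const.mul hf))
    (hγ.intervalIntegrable (continuousOn_const.mul hg))

/-- The fundamental theorem of calculus along the closed curve; the finitely many points of
non-differentiability do not matter. -/
theorem IsContourAboutZero.integral_deriv (hγ : IsContourAboutZero γ) {F f : ℂ → ℂ}
    (hF : ∀ z, z ≠ 0 → HasDerivAt F (f z) z) (hf : ContinuousOn f {0}ᶜ) :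
    contourIntegral γ f = 0 := by
  obtain ⟨S, hS, hd⟩ := hγ.differentiable
  have h := integral_eq_of_hasDerivAt_off_countable (fun τ => F (γ τ))
    (fun τ => f (γ τ) * deriv γ τ) (a := 0) (b := 1) hS.countable ?_ ?_
    (hγ.intervalIntegrable hf)
  · rw [contourIntegral, h, hγ.closed, sub_self]
  · rw [uIcc_of_le zero_le_one]
    intro τ hτ
    exact (hF _ (hγ.ne_zero τ hτ)).continuousAt.comp_continuousWithinAt (hγ.continuousOn τ hτ)
  · intro τ hτ
    rw [min_eq_left zero_le_one, max_eq_right zero_le_one] at hτ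
    exact (hF _ (hγ.ne_zero τ ⟨hτ.1.1.le, hτ.1.2.le⟩)).comp τ (hd τ hτ).hasDerivAt

theorem IsContourAboutZero.integral_entire (hγ : IsContourAboutZero γ) {f : ℂ → ℂ}
    (hf : Differentiable ℂ f) : contourIntegral γ f = 0 := by
  obtain ⟨F, hF⟩ := hf.isExactOn_univ
  exact hγ.integral_deriv (fun z _ => hF z (mem_univ z)) hf.continuous.continuousOn

theorem continuousOn_inv_pow_mul {f : ℂ → ℂ} (hf : Continuous f) (m : ℕ) :
    ContinuousOn (fun z : ℂ => (z ^ m)⁻¹ * f z) {0}ᶜ :=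
  ((continuousOn_pow m).inv₀ fun _ hz => pow_ne_zero m hz).mul hf.continuousOn

/-- The integral of `f z / z` picks up the value at the origin. -/
theorem IsContourAboutZero.integral_inv_mul (hγ : IsContourAboutZero γ) {f : ℂ → ℂ}
    (hf : Differentiable ℂ f) :
    contourIntegral γ (fun z => (z ^ 1)⁻¹ * f z) = 2 * Real.pi * Complex.I * f 0 := by
  have hd : Differentiable ℂ (dslope f 0) := fun z => by
    have h : DifferentiableOn ℂ (dslope f 0) univ :=
      (Complex.differentiableOn_dslope Filter.univ_mem).2 hf.differentiableOn
    exact h.differentiableAt Filter.univ_mem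
  -- The difference quotient is entire and contributes nothing; the rest is f(0) times the winding
  -- integral.
  have h1 : ∀ z : ℂ, z ≠ 0 → (z ^ 1)⁻¹ * f z = f 0 * z⁻¹ + 1 * dslope f 0 z := fun z hz => by
    rw [dslope_of_ne _ hz, slope_def_field]
    field_simp
    ring
  rw [hγ.integral_congr h1, hγ.integral_linear continuousOn_inv₀
    hd.continuous.continuousOn, hγ.winding, hγ.integral_entire hd]
  ring

theorem IsContourAboutZero.integral_by_parts (hγ : IsContourAboutZero γ) {f f' : ℂ → ℂ}
    (hf : ∀ z, HasDerivAt f (f' z) z) (hf' : Continuous f') (m : ℕ) :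
    contourIntegral γ (fun z => (z ^ m)⁻¹ * f' z)
      = m * contourIntegral γ (fun z => (z ^ (m + 1))⁻¹ * f z) := by
  have hc : Continuous f := continuous_iff_continuousAt.2 fun z => (hf z).continuousAt
  have h := hγ.integral_deriv (F := fun z => (z ^ m)⁻¹ * f z)
    (f := fun z => (-m : ℂ) * ((z ^ (m + 1))⁻¹ * f z) + 1 * ((z ^ m)⁻¹ * f' z))
    (fun z hz => by
      have h1 : HasDerivAt (fun z : ℂ => (z ^ m)⁻¹ * f z) _ z :=
        ((hasDerivAt_pow m z).inv (pow_ne_zero m hz)).mul (hf z)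
      refine h1.congr_deriv ?_
      rw [one_mul]
      congr 1
      rcases m with _ | m
      · simp
      · simp only [Nat.add_sub_cancel]
        field_simp
        ring)
    ((continuousOn_const.mul (continuousOn_inv_pow_mul hc _)).add
      (continuousOn_const.mul (continuousOn_inv_pow_mul hf' _)))
  rw [hγ.integral_linear (continuousOn_inv_pow_mul hc _) (continuousOn_inv_pow_mul hf' _)] at h
  linear_combination h

/-- The fermionic weight `exp (-N (c z - z²/2))`. -/
noncomputable def contourWeight (N : ℕ) (c z : ℂ) : ℂ := Complex.exp (-N * (c * z - z ^ 2 / 2))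

theorem hasDerivAt_contourWeight (N : ℕ) (c z : ℂ) :
    HasDerivAt (contourWeight N c) (N * ((z - c) * contourWeight N c z)) z := by
  have h : HasDerivAt (contourWeight N c) _ z :=
    ((((hasDerivAt_id z).const_mul c).sub (((hasDerivAt_id z).pow 2).div_const 2)).const_mul
      (-(N : ℂ))).cexp
  refine h.congr_deriv ?_
  simp only [contourWeight, id, Pi.sub_apply]
  simp
  ring

theorem continuous_contourWeight (N : ℕ) (c : ℂ) : Continuous (contourWeight N c) := by
  unfold contourWeight; fun_prop

/-- The source of the summand 1/N in the bracket: for the weight W one has (z - c)W = W'/N, hence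
(1/N + (z - c)²)W = W''/N². -/
theorem hasDerivAt_sub_mul_contourWeight {N : ℕ} (hN : N ≠ 0) (c z : ℂ) :
    HasDerivAt (fun z => (z - c) * contourWeight N c z)
      (N * ((1 / N + (z - c) ^ 2) * contourWeight N c z)) z := by
  have hN' : (N : ℂ) ≠ 0 := by exact_mod_cast hN
  have h : HasDerivAt (fun z => (z - c) * contourWeight N c z) _ z :=
    ((hasDerivAt_id z).sub_const c).mul (hasDerivAt_contourWeight N c z)
  refine h.congr_deriv ?_
  simp only [id]
  field_simp

/-- The Laurent coefficients of the weight are Gaussian moments. -/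
theorem IsContourAboutZero.integral_inv_pow_mul_contourWeight (hγ : IsContourAboutZero γ)
    {N : ℕ} (hN : N ≠ 0) (c : ℂ) (k : ℕ) :
    contourIntegral γ (fun z => (z ^ (k + 1))⁻¹ * contourWeight N c z)
      = 2 * Real.pi * Complex.I * ((-N) ^ k / k.factorial * shiftedMoment (1 / N) c k) := by
  have hN' : (N : ℂ) ≠ 0 := by exact_mod_cast hN
  have hv : (1 / N : NNReal) ≠ 0 := by positivity
  have hf : Differentiable ℂ (contourWeight N c) := fun z =>
    (hasDerivAt_contourWeight N c z).differentiableAt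
  have hc := continuous_contourWeight N c
  have hrec : ∀ m : ℕ, contourIntegral γ (fun z => (z ^ (m + 1))⁻¹ *
      (N * ((z - c) * contourWeight N c z)))
      = N * (contourIntegral γ (fun z => (z ^ m)⁻¹ * contourWeight N c z)
        - c * contourIntegral γ (fun z => (z ^ (m + 1))⁻¹ * contourWeight N c z)) := by
    intro m
    have h1 : ∀ z : ℂ, z ≠ 0 → (z ^ (m + 1))⁻¹ * (N * ((z - c) * contourWeight N c z))
        = N * ((z ^ m)⁻¹ * contourWeight N c z)
          + (-(N * c)) * ((z ^ (m + 1))⁻¹ * contourWeight N c z) := fun z hz => by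
      field_simp
      ring
    rw [hγ.integral_congr h1, hγ.integral_linear
      (continuousOn_inv_pow_mul hc _) (continuousOn_inv_pow_mul hc _)]
    ring
  -- By W' = N(z - c)W and integration by parts, the Laurent coefficients obey the Hermite recursion
  -- up to the normalization (-N)^k/k!.
  have hstep : ∀ m : ℕ, ((m + 1 : ℕ) : ℂ) *
      contourIntegral γ (fun z => (z ^ (m + 2))⁻¹ * contourWeight N c z)
      = N * (contourIntegral γ (fun z => (z ^ m)⁻¹ * contourWeight N c z)
        - c * contourIntegral γ (fun z => (z ^ (m + 1))⁻¹ * contourWeight N c z)) := fun m => by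
    rw [← hrec, ← hγ.integral_by_parts (hasDerivAt_contourWeight N c) (by fun_prop)]
  induction k using Nat.twoStepInduction with
  | zero =>
    rw [hγ.integral_inv_mul hf, shiftedMoment_zero]
    simp [contourWeight]
  | one =>
    have h := hstep 0
    simp only [pow_zero, inv_one, one_mul] at h
    rw [hγ.integral_entire hf, hγ.integral_inv_mul hf] at h
    rw [shiftedMoment_succ hv, shiftedMoment_zero]
    simp [contourWeight] at h ⊢
    rw [h]
    ring
  | more k ih1 ih2 =>
    have h := hstep (k + 1)
    rw [ih1, ih2] at h
    have hk : ((k : ℂ) + 1 + 1) ≠ 0 := by exact_mod_cast Nat.succ_ne_zero (k + 1)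
    have hk1 : ((k : ℂ) + 1) ≠ 0 := by exact_mod_cast Nat.succ_ne_zero k
    have hkf : (k.factorial : ℂ) ≠ 0 := by exact_mod_cast k.factorial_ne_zero
    have h' : contourIntegral γ (fun z => (z ^ (k + 2 + 1))⁻¹ * contourWeight N c z)
        = (N : ℂ) / (k + 1 + 1) * (2 * Real.pi * Complex.I * ((-N) ^ k / k.factorial *
          shiftedMoment (1 / N) c k) - c * (2 * Real.pi * Complex.I *
          ((-N) ^ (k + 1) / (k + 1).factorial * shiftedMoment (1 / N) c (k + 1)))) := by
      rw [div_mul_eq_mul_div, eq_div_iff hk, ← h]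
      push_cast
      ring
    rw [h', shiftedMoment_succ hv c (k + 1)]
    simp only [Nat.factorial_succ, Nat.add_sub_cancel]
    push_cast
    field_simp
    ring

/-- The contour integral of the bracket reproduces the averaged determinant. -/
theorem IsContourAboutZero.integral_bracket (hγ : IsContourAboutZero γ) {N : ℕ} (hN : 2 ≤ N)
    (c τ δ : ℂ) :
    contourIntegral γ (fun z => z * (z ^ N)⁻¹ *
        (1 / N + (z - c) ^ 2 - 2 * (z - c) * τ + 4 * δ) * contourWeight N c z)
      = 2 * Real.pi * Complex.I * (-N) ^ (N - 2) / (N - 2).factorial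
        * (shiftedMoment (1 / N) c N + 2 * τ * shiftedMoment (1 / N) c (N - 1)
          + 4 * δ * shiftedMoment (1 / N) c (N - 2)) := by
  obtain ⟨n, rfl⟩ := Nat.exists_eq_add_of_le hN
  simp only [show 2 + n - 2 = n by omega, show 2 + n - 1 = n + 1 by omega]
  set N := 2 + n with hNdef
  have hN0 : N ≠ 0 := by omega
  have hN' : (N : ℂ) ≠ 0 := by exact_mod_cast hN0
  have hc := continuous_contourWeight N c
  -- With z·z^(-N) = z^(-(n+1)), the three parts of the bracket are multiples of z^(-(n+1)) against
  -- W'', W' and W. Two, one and no integrations by parts give the moments of orders N, N - 1 and N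
  -- - 2.
  have h1 : ∀ z : ℂ, z ≠ 0 → z * (z ^ N)⁻¹ *
        (1 / N + (z - c) ^ 2 - 2 * (z - c) * τ + 4 * δ) * contourWeight N c z
      = 1 * ((N : ℂ)⁻¹ * ((z ^ (n + 1))⁻¹ * (N * ((1 / N + (z - c) ^ 2) * contourWeight N c z)))
        + (-(2 * τ / N)) * ((z ^ (n + 1))⁻¹ * (N * ((z - c) * contourWeight N c z))))
        + (4 * δ) * ((z ^ (n + 1))⁻¹ * contourWeight N c z) := fun z hz => by
    rw [show z ^ N = z ^ (n + 1) * z by rw [hNdef]; ring]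
    field_simp
    ring
  have c1 : ContinuousOn (fun z : ℂ => (z ^ (n + 1))⁻¹ *
      (N * ((1 / N + (z - c) ^ 2) * contourWeight N c z))) {0}ᶜ :=
    continuousOn_inv_pow_mul (by fun_prop) _
  have c2 : ContinuousOn (fun z : ℂ => (z ^ (n + 1))⁻¹ *
      (N * ((z - c) * contourWeight N c z))) {0}ᶜ := continuousOn_inv_pow_mul (by fun_prop) _
  have c12 : ContinuousOn (fun z : ℂ => (N : ℂ)⁻¹ * ((z ^ (n + 1))⁻¹ *
      (N * ((1 / N + (z - c) ^ 2) * contourWeight N c z))) + (-(2 * τ / N)) *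
      ((z ^ (n + 1))⁻¹ * (N * ((z - c) * contourWeight N c z)))) {0}ᶜ :=
    (continuousOn_const.mul c1).add (continuousOn_const.mul c2)
  rw [hγ.integral_congr h1, hγ.integral_linear c12
      (continuousOn_inv_pow_mul hc _), hγ.integral_linear c1 c2,
    hγ.integral_by_parts (hasDerivAt_sub_mul_contourWeight hN0 c) (by fun_prop),
    hγ.integral_by_parts (hasDerivAt_contourWeight N c) (by fun_prop)]
  · have h2 := hγ.integral_by_parts (hasDerivAt_contourWeight N c) (by fun_prop) (n + 1 + 1)
    have h3 : ∀ z : ℂ, z ≠ 0 → (z ^ (n + 1 + 1))⁻¹ * (N * ((z - c) * contourWeight N c z))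
        = N * ((z ^ (n + 1 + 1))⁻¹ * ((z - c) * contourWeight N c z)) := fun z hz => by ring
    rw [hγ.integral_congr h3, contourIntegral_const_mul,
      hγ.integral_inv_pow_mul_contourWeight hN0] at h2
    have h4 : contourIntegral γ
        (fun z => (z ^ (n + 1 + 1))⁻¹ * ((z - c) * contourWeight N c z)) = _ :=
      mul_left_cancel₀ hN' (h2.trans (mul_div_cancel₀ _ hN').symm)
    rw [h4, hγ.integral_inv_pow_mul_contourWeight hN0,
      hγ.integral_inv_pow_mul_contourWeight hN0]
    have hn1 : ((n : ℂ) + 1) ≠ 0 := by exact_mod_cast Nat.succ_ne_zero n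
    have hn2 : ((n : ℂ) + 1 + 1) ≠ 0 := by exact_mod_cast Nat.succ_ne_zero (n + 1)
    have hnf : (n.factorial : ℂ) ≠ 0 := by exact_mod_cast n.factorial_ne_zero
    have hNn : (N : ℂ) = n + 1 + 1 := by rw [hNdef]; push_cast; ring
    rw [show N = n + 1 + 1 by omega]
    simp only [Nat.factorial_succ]
    push_cast
    field_simp
    ring

end

/-! ### The image of Lebesgue measure under the Gram data of two vectors. -/

theorem lintegral_fun_norm_addHaar {E : Type*} [NormedAddCommGroup E] [NormedSpace ℝ E]
    [MeasurableSpace E] [BorelSpace E] [FiniteDimensional ℝ E] [Nontrivial E] (μ : Measure E)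
    [μ.IsAddHaarMeasure] {f : ℝ → ENNReal} (hf : Measurable f) :
    ∫⁻ x, f ‖x‖ ∂μ = Module.finrank ℝ E * μ (Metric.ball 0 1) *
      ∫⁻ r in Ioi (0 : ℝ), ENNReal.ofReal (r ^ (Module.finrank ℝ E - 1)) * f r := by
  calc
    ∫⁻ x, f ‖x‖ ∂μ = ∫⁻ x : ({(0)}ᶜ : Set E), f ‖x.1‖ ∂(μ.comap (↑)) := by
      rw [lintegral_subtype_comap (measurableSet_singleton _).compl fun x => f ‖x‖,
        restrict_compl_singleton]
    _ = ∫⁻ x, f x.2 ∂μ.toSphere.prod (.volumeIoiPow (Module.finrank ℝ E - 1)) := by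
      simpa using μ.measurePreserving_homeomorphUnitSphereProd.lintegral_comp_emb
        (Homeomorph.measurableEmbedding _) (f ∘ Subtype.val ∘ Prod.snd)
    _ = μ.toSphere univ * ∫⁻ x : Ioi (0 : ℝ), f x ∂.volumeIoiPow (Module.finrank ℝ E - 1) := by
      rw [lintegral_prod _ (by fun_prop)]
      simp [mul_comm]
    _ = _ := by
      rw [Measure.toSphere_apply_univ, Measure.volumeIoiPow,
        lintegral_withDensity_eq_lintegral_mul _ (by fun_prop) (by fun_prop)]
      congr 1
      exact lintegral_subtype_comap measurableSet_Ioi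
        fun r => ENNReal.ofReal (r ^ (Module.finrank ℝ E - 1)) * f r

theorem lintegral_Ioi_comp_sq (G : ℝ → ENNReal) :
    ∫⁻ s in Ioi (0 : ℝ), G s = ∫⁻ r in Ioi (0 : ℝ), ENNReal.ofReal (2 * r) * G (r ^ 2) := by
  have himg : (fun r : ℝ => r ^ 2) '' Ioi 0 = Ioi 0 := by
    ext s
    simp only [mem_image, mem_Ioi]
    constructor
    · rintro ⟨r, hr, rfl⟩; positivity
    · intro hs; exact ⟨√s, Real.sqrt_pos.2 hs, Real.sq_sqrt hs.le⟩
  have hinj : InjOn (fun r : ℝ => r ^ 2) (Ioi 0) := fun a ha b hb hab =>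
    (sq_eq_sq₀ (le_of_lt ha) (le_of_lt hb)).1 hab
  rw [← himg, lintegral_image_eq_lintegral_abs_deriv_mul measurableSet_Ioi
    (f' := fun r => 2 * r) (fun r _ => by
      simpa using (hasDerivAt_pow 2 r).hasDerivWithinAt) hinj, himg]
  refine setLIntegral_congr_fun measurableSet_Ioi fun r hr => ?_
  have : (0 : ℝ) < r := hr
  simp only [abs_of_pos (by positivity : 0 < 2 * r)]

theorem lintegral_Ioo_comp_cos (G : ℝ → ENNReal) :
    ∫⁻ α in Ioo (-1 : ℝ) 1, G α
      = ∫⁻ θ in Ioo 0 Real.pi, ENNReal.ofReal (Real.sin θ) * G (Real.cos θ) := by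
  have himg : Real.cos '' Ioo 0 Real.pi = Ioo (-1) 1 := by
    ext a
    simp only [mem_image, mem_Ioo]
    constructor
    · rintro ⟨θ, ⟨h0, h1⟩, rfl⟩
      have hs := Real.sin_pos_of_pos_of_lt_pi h0 h1
      have := Real.sin_sq_add_cos_sq θ
      constructor <;> nlinarith
    · rintro ⟨h0, h1⟩
      exact ⟨Real.arccos a, ⟨Real.arccos_pos.2 h1, Real.arccos_lt_pi.2 h0⟩,
        Real.cos_arccos h0.le h1.le⟩
  have hinj : InjOn Real.cos (Ioo 0 Real.pi) := Real.injOn_cos.mono Ioo_subset_Icc_self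
  rw [← himg, lintegral_image_eq_lintegral_abs_deriv_mul measurableSet_Ioo
    (f' := fun θ => -Real.sin θ) (fun θ _ => (Real.hasDerivAt_cos θ).hasDerivWithinAt) hinj]
  refine setLIntegral_congr_fun measurableSet_Ioo fun θ hθ => ?_
  simp only [abs_neg, abs_of_pos (Real.sin_pos_of_pos_of_lt_pi hθ.1 hθ.2)]

theorem lintegral_halfPlane_polar {Φ : ℝ × ℝ → ENNReal} (hΦ : Measurable Φ) :
    ∫⁻ a, ∫⁻ r in Ioi (0 : ℝ), Φ (a, r)
      = ∫⁻ ρ in Ioi (0 : ℝ), ∫⁻ θ in Ioo 0 Real.pi,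
        ENNReal.ofReal ρ * Φ (ρ * Real.cos θ, ρ * Real.sin θ) := by
  have hm : Measurable fun p : ℝ × ℝ => (Ioi (0 : ℝ)).indicator (fun r => Φ (p.1, r)) p.2 := by
    have : (fun p : ℝ × ℝ => (Ioi (0 : ℝ)).indicator (fun r => Φ (p.1, r)) p.2)
        = (univ ×ˢ Ioi (0 : ℝ)).indicator Φ := by
      ext p; simp [indicator]
    rw [this]
    exact hΦ.indicator (MeasurableSet.univ.prod measurableSet_Ioi)
  calc _ = ∫⁻ a, ∫⁻ r, (Ioi (0 : ℝ)).indicator (fun r => Φ (a, r)) r := by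
        refine lintegral_congr fun a => ?_
        rw [lintegral_indicator measurableSet_Ioi]
    _ = ∫⁻ p : ℝ × ℝ, (Ioi (0 : ℝ)).indicator (fun r => Φ (p.1, r)) p.2 := by
        rw [Measure.volume_eq_prod, lintegral_prod _ hm.aemeasurable]
    _ = _ := by
        rw [← lintegral_comp_polarCoord_symm]
        simp only [polarCoord_target, polarCoord_symm_apply, smul_eq_mul]
        rw [Measure.volume_eq_prod, ← Measure.prod_restrict, lintegral_prod _ ?_]
        · refine setLIntegral_congr_fun measurableSet_Ioi fun ρ hρ => ?_
          have hρ' : (0 : ℝ) < ρ := hρ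
          have hsub : Ioo 0 Real.pi ⊆ Ioo (-Real.pi) Real.pi :=
            Ioo_subset_Ioo_left (by linarith [Real.pi_pos])
          have hind : ∀ F : ℝ → ENNReal, ∫⁻ θ in Ioo 0 Real.pi, F θ
              = ∫⁻ θ in Ioo (-Real.pi) Real.pi, (Ioo 0 Real.pi).indicator F θ := fun F => by
            rw [lintegral_indicator measurableSet_Ioo, Measure.restrict_restrict measurableSet_Ioo,
              inter_eq_self_of_subset_left hsub]
          simp only [hind]
          refine setLIntegral_congr_fun measurableSet_Ioo fun θ hθ => ?_
          by_cases h : θ ∈ Ioo 0 Real.pi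
          · have : ρ * Real.sin θ ∈ Ioi (0 : ℝ) :=
              mul_pos hρ' (Real.sin_pos_of_pos_of_lt_pi h.1 h.2)
            simp only [indicator_of_mem h, indicator_of_mem this]
          · have : ρ * Real.sin θ ∉ Ioi (0 : ℝ) := by
              have h0 : θ ≤ 0 := by
                by_contra h0; exact h ⟨not_le.1 h0, hθ.2⟩
              have := Real.sin_nonpos_of_nonpos_of_neg_pi_le h0 hθ.1.le
              simp only [mem_Ioi, not_lt]
              exact mul_nonpos_of_nonneg_of_nonpos hρ'.le this
            simp only [indicator_of_notMem h, indicator_of_notMem this, mul_zero]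
        · refine Measurable.aemeasurable ?_
          refine Measurable.mul (by fun_prop) ?_
          exact hm.comp (g := fun p : ℝ × ℝ => (Ioi (0 : ℝ)).indicator (fun r => Φ (p.1, r)) p.2)
            (f := fun p : ℝ × ℝ => (p.1 * Real.cos p.2, p.1 * Real.sin p.2)) (by fun_prop)

theorem lintegral_euclideanSpace_fin_succ {n : ℕ} {Φ : ℝ → ℝ → ENNReal}
    (hΦ : Measurable (Function.uncurry Φ)) :
    ∫⁻ y : EuclideanSpace ℝ (Fin (n + 1)), Φ (y 0) (‖y‖ ^ 2)
      = ∫⁻ a : ℝ, ∫⁻ y : EuclideanSpace ℝ (Fin n), Φ a (a ^ 2 + ‖y‖ ^ 2) := by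
  have e1 := (EuclideanSpace.volume_preserving_symm_measurableEquiv_toLp (Fin (n + 1))).symm
  have e2 := (volume_preserving_piFinSuccAbove (fun _ : Fin (n + 1) => ℝ) 0).symm
  have e3 := (EuclideanSpace.volume_preserving_symm_measurableEquiv_toLp (Fin n)).symm
  rw [← e1.lintegral_comp_emb (MeasurableEquiv.measurableEmbedding _),
    ← e2.lintegral_comp_emb (MeasurableEquiv.measurableEmbedding _), Measure.volume_eq_prod,
    lintegral_prod]
  · refine lintegral_congr fun a => ?_
    rw [← e3.lintegral_comp_emb (MeasurableEquiv.measurableEmbedding _)]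
    refine lintegral_congr fun y => ?_
    simp [EuclideanSpace.norm_sq_eq, Fin.sum_univ_succ]
  · refine Measurable.aemeasurable ?_
    have : Measurable fun y : EuclideanSpace ℝ (Fin (n + 1)) => Φ (y 0) (‖y‖ ^ 2) :=
      hΦ.comp (f := fun y : EuclideanSpace ℝ (Fin (n + 1)) => (y 0, ‖y‖ ^ 2)) (by fun_prop)
    exact (this.comp (MeasurableEquiv.measurable _)).comp (MeasurableEquiv.measurable _)

theorem sq_rpow_half_natCast {n : ℕ} (hn : 1 ≤ n) {r : ℝ} (hr : 0 < r) :
    (r ^ 2) ^ (((n : ℝ) - 1) / 2) = r ^ (n - 1) := by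
  rw [← Real.rpow_natCast, ← Real.rpow_natCast, ← Real.rpow_mul hr.le]
  congr 1
  push_cast [Nat.cast_sub hn]
  ring

theorem lintegral_norm_sq {n : ℕ} (hn : 1 ≤ n) {g : ℝ → ENNReal} (hg : Measurable g) :
    ∫⁻ x : EuclideanSpace ℝ (Fin (n + 1)), g (‖x‖ ^ 2)
      = ((n + 1 : ℕ) * volume (Metric.ball (0 : EuclideanSpace ℝ (Fin (n + 1))) 1)) *
        ∫⁻ s in Ioi (0 : ℝ), ENNReal.ofReal (1 / 2 * s ^ (((n : ℝ) - 1) / 2)) * g s := by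
  rw [lintegral_fun_norm_addHaar volume (f := fun r => g (r ^ 2)) (by fun_prop),
    finrank_euclideanSpace_fin]
  conv_rhs => rw [lintegral_Ioi_comp_sq]
  congr 1
  refine setLIntegral_congr_fun measurableSet_Ioi fun r hr => ?_
  have hr' : (0 : ℝ) < r := hr
  rw [← mul_assoc, ← ENNReal.ofReal_mul (by positivity), sq_rpow_half_natCast hn hr']
  congr 2
  obtain ⟨m, rfl⟩ := Nat.exists_eq_add_of_le hn
  simp only [Nat.add_sub_cancel, Nat.add_sub_cancel_left]
  ring

theorem sin_mul_rpow_half {n : ℕ} (hn : 1 ≤ n) {θ : ℝ} (h : 0 < Real.sin θ) :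
    Real.sin θ * (1 - Real.cos θ ^ 2) ^ (((n : ℝ) - 2) / 2) = Real.sin θ ^ (n - 1) := by
  rw [← Real.sin_sq, ← Real.rpow_natCast (Real.sin θ) 2, ← Real.rpow_mul h.le,
    ← Real.rpow_natCast (Real.sin θ) (n - 1)]
  nth_rw 1 [← Real.rpow_one (Real.sin θ)]
  rw [← Real.rpow_add h]
  congr 1
  push_cast [Nat.cast_sub hn]
  ring

/-- Let a be the component of y along u and r the norm of the orthogonal part. Polar coordinates in
the orthogonal ℝ^n give the density r^(n-1) on a half-plane. There a = ρ cos θ, r = ρ sin θ, and the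
substitutions t = ρ², α = cos θ give the claim. -/
theorem lintegral_norm_sq_cos {n : ℕ} (hn : 1 ≤ n) (u : EuclideanSpace ℝ (Fin (n + 1)))
    (hu : ‖u‖ = 1) {f : ℝ × ℝ → ENNReal} (hf : Measurable f) :
    ∫⁻ y : EuclideanSpace ℝ (Fin (n + 1)), f (‖y‖ ^ 2, inner ℝ u y / ‖y‖)
      = (n * volume (Metric.ball (0 : EuclideanSpace ℝ (Fin n)) 1)) *
        ∫⁻ t in Ioi (0 : ℝ), ∫⁻ α in Ioo (-1 : ℝ) 1,
          ENNReal.ofReal (1 / 2 * t ^ (((n : ℝ) - 1) / 2) * (1 - α ^ 2) ^ (((n : ℝ) - 2) / 2))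
            * f (t, α) := by
  have : Nonempty (Fin n) := ⟨⟨0, hn⟩⟩
  have horth : Orthonormal ℝ (({0} : Set (Fin (n + 1))).domRestrict fun _ => u) := by
    refine ⟨fun _ => hu, fun i j hij => ?_⟩
    exact absurd (Subsingleton.elim i j) hij
  -- Rotation invariance: u may be taken as the first coordinate vector.
  obtain ⟨b, hb⟩ := horth.exists_orthonormalBasis_extension_of_card_eq (by simp)
  have hb0 : b 0 = u := hb 0 rfl
  let Φ : ℝ → ℝ → ENNReal := fun a q => f (q, a / √q)
  have hΦ : Measurable (Function.uncurry Φ) :=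
    hf.comp (f := fun p : ℝ × ℝ => (p.2, p.1 / √p.2)) (by fun_prop)
  have hm : Measurable fun y : EuclideanSpace ℝ (Fin (n + 1)) => Φ (y 0) (‖y‖ ^ 2) :=
    hΦ.comp (f := fun y : EuclideanSpace ℝ (Fin (n + 1)) => (y 0, ‖y‖ ^ 2)) (by fun_prop)
  calc _ = ∫⁻ y, Φ (b.repr y 0) (‖b.repr y‖ ^ 2) := by
        refine lintegral_congr fun y => ?_
        simp [Φ, b.repr_apply_apply, hb0, Real.sqrt_sq]
    _ = ∫⁻ y : EuclideanSpace ℝ (Fin (n + 1)), Φ (y 0) (‖y‖ ^ 2) :=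
        b.repr.measurePreserving.lintegral_comp hm
    _ = ∫⁻ a, (n * volume (Metric.ball (0 : EuclideanSpace ℝ (Fin n)) 1)) *
          ∫⁻ r in Ioi (0 : ℝ), ENNReal.ofReal (r ^ (n - 1)) * Φ a (a ^ 2 + r ^ 2) := by
        rw [lintegral_euclideanSpace_fin_succ hΦ]
        refine lintegral_congr fun a => ?_
        rw [lintegral_fun_norm_addHaar volume (f := fun r => Φ a (a ^ 2 + r ^ 2)) (by fun_prop),
          finrank_euclideanSpace_fin]
    _ = (n * volume (Metric.ball (0 : EuclideanSpace ℝ (Fin n)) 1)) *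
          ∫⁻ a, ∫⁻ r in Ioi (0 : ℝ), ENNReal.ofReal (r ^ (n - 1)) * Φ a (a ^ 2 + r ^ 2) := by
        refine lintegral_const_mul _ ?_
        refine Measurable.lintegral_prod_right' (f := fun p : ℝ × ℝ =>
          ENNReal.ofReal (p.2 ^ (n - 1)) * Φ p.1 (p.1 ^ 2 + p.2 ^ 2)) ?_
        exact Measurable.mul (by fun_prop)
          (hΦ.comp (f := fun p : ℝ × ℝ => (p.1, p.1 ^ 2 + p.2 ^ 2)) (by fun_prop))
    _ = _ := by
        congr 1
        rw [lintegral_halfPlane_polar (Φ := fun p : ℝ × ℝ =>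
          ENNReal.ofReal (p.2 ^ (n - 1)) * Φ p.1 (p.1 ^ 2 + p.2 ^ 2)) (Measurable.mul (by fun_prop)
          (hΦ.comp (f := fun p : ℝ × ℝ => (p.1, p.1 ^ 2 + p.2 ^ 2)) (by fun_prop)))]
        conv_rhs => rw [lintegral_Ioi_comp_sq]
        refine setLIntegral_congr_fun measurableSet_Ioi fun ρ hρ => ?_
        have hρ' : (0 : ℝ) < ρ := hρ
        simp only
        rw [lintegral_Ioo_comp_cos, ← lintegral_const_mul' _ _ ENNReal.ofReal_ne_top]
        refine setLIntegral_congr_fun measurableSet_Ioo fun θ hθ => ?_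
        have hs := Real.sin_pos_of_pos_of_lt_pi hθ.1 hθ.2
        have h1 : (ρ * Real.cos θ) ^ 2 + (ρ * Real.sin θ) ^ 2 = ρ ^ 2 := by
          linear_combination ρ ^ 2 * Real.sin_sq_add_cos_sq θ
        simp only [Φ, h1, Real.sqrt_sq hρ'.le, mul_div_cancel_left₀ _ hρ'.ne']
        rw [← mul_assoc, ← mul_assoc, ← mul_assoc, ← ENNReal.ofReal_mul hρ'.le,
          ← ENNReal.ofReal_mul (by positivity), ← ENNReal.ofReal_mul (by positivity)]
        congr 2
        rw [sq_rpow_half_natCast hn hρ', mul_pow, ← sin_mul_rpow_half hn hs]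
        ring

/-- The density of the Gram data of two independent Lebesgue-distributed vectors, without its
normalization. -/
noncomputable def gramDensity (n : ℕ) (p : ℝ × ℝ × ℝ) : ℝ :=
  p.1 ^ (((n : ℝ) - 1) / 2) * p.2.1 ^ (((n : ℝ) - 1) / 2)
    * (1 - p.2.2 ^ 2) ^ (((n : ℝ) - 2) / 2)

theorem measurable_gramDensity (n : ℕ) : Measurable (gramDensity n) := by
  unfold gramDensity; fun_prop

/-- Squared norms and the cosine of the angle of a pair of vectors. -/
noncomputable def gramMap {n : ℕ}
    (p : EuclideanSpace ℝ (Fin (n + 1)) × EuclideanSpace ℝ (Fin (n + 1))) : ℝ × ℝ × ℝ :=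
  (‖p.1‖ ^ 2, ‖p.2‖ ^ 2, inner ℝ p.1 p.2 / (‖p.1‖ * ‖p.2‖))

theorem measurable_gramMap (n : ℕ) : Measurable (gramMap (n := n)) := by
  unfold gramMap; fun_prop

/-- The product of the areas of the unit spheres in dimensions `n + 1` and `n`, divided by `4`. -/
noncomputable def gramConst (n : ℕ) : ENNReal :=
  ((n + 1 : ℕ) * volume (Metric.ball (0 : EuclideanSpace ℝ (Fin (n + 1))) 1)) *
    (n * volume (Metric.ball (0 : EuclideanSpace ℝ (Fin n)) 1)) * ENNReal.ofReal (1 / 4)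

theorem lintegral_gramMap {n : ℕ} (hn : 1 ≤ n) {f : ℝ × ℝ × ℝ → ENNReal} (hf : Measurable f) :
    ∫⁻ p, f (gramMap (n := n) p) = gramConst n * ∫⁻ q in Ioi (0 : ℝ) ×ˢ Ioi (0 : ℝ) ×ˢ
      Ioo (-1 : ℝ) 1, ENNReal.ofReal (gramDensity n q) * f q := by
  have hm : Measurable fun q => ENNReal.ofReal (gramDensity n q) * f q :=
    (measurable_gramDensity n).ennreal_ofReal.mul hf
  set V := volume (Metric.ball (0 : EuclideanSpace ℝ (Fin n)) 1)
  have hmi : Measurable fun s : ℝ => ∫⁻ t in Ioi (0 : ℝ), ∫⁻ α in Ioo (-1 : ℝ) 1,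
      ENNReal.ofReal (1 / 2 * t ^ (((n : ℝ) - 1) / 2) * (1 - α ^ 2) ^ (((n : ℝ) - 2) / 2))
        * f (s, t, α) := by
    refine Measurable.lintegral_prod_right' (f := fun p : ℝ × ℝ => ∫⁻ α in Ioo (-1 : ℝ) 1,
      ENNReal.ofReal (1 / 2 * p.2 ^ (((n : ℝ) - 1) / 2) * (1 - α ^ 2) ^ (((n : ℝ) - 2) / 2))
        * f (p.1, p.2, α)) ?_
    refine Measurable.lintegral_prod_right' (f := fun p : (ℝ × ℝ) × ℝ =>
      ENNReal.ofReal (1 / 2 * p.1.2 ^ (((n : ℝ) - 1) / 2) * (1 - p.2 ^ 2) ^ (((n : ℝ) - 2) / 2))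
        * f (p.1.1, p.1.2, p.2)) ?_
    exact Measurable.mul (by fun_prop) (hf.comp (f := fun p : (ℝ × ℝ) × ℝ =>
      (p.1.1, p.1.2, p.2)) (by fun_prop))
  have hfm : Measurable fun p => f (gramMap (n := n) p) := hf.comp (measurable_gramMap n)
  rw [Measure.volume_eq_prod, lintegral_prod _ hfm.aemeasurable]
  calc _ = ∫⁻ x : EuclideanSpace ℝ (Fin (n + 1)), (n * V) *
          ∫⁻ t in Ioi (0 : ℝ), ∫⁻ α in Ioo (-1 : ℝ) 1,
          ENNReal.ofReal (1 / 2 * t ^ (((n : ℝ) - 1) / 2) * (1 - α ^ 2) ^ (((n : ℝ) - 2) / 2))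
            * f (‖x‖ ^ 2, t, α) := by
        -- The direction of x is needed as unit vector for the inner integral, whose value then
        -- depends on x only through its norm.
        have hne : ∀ᵐ x : EuclideanSpace ℝ (Fin (n + 1)), x ≠ 0 := by
          simp [ae_iff, measure_singleton]
        refine lintegral_congr_ae ?_
        filter_upwards [hne] with x hx
        have hx' : ‖x‖ ≠ 0 := norm_ne_zero_iff.2 hx
        rw [← lintegral_norm_sq_cos hn (‖x‖⁻¹ • x) (by rw [norm_smul]; simp [hx'])
          (f := fun q => f (‖x‖ ^ 2, q.1, q.2)) (by fun_prop)]
        refine lintegral_congr fun y => ?_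
        simp only [gramMap, real_inner_smul_left]
        congr 3
        rw [inv_mul_eq_div, div_div]
    _ = _ := by
        have hmx : Measurable fun x : EuclideanSpace ℝ (Fin (n + 1)) =>
            ∫⁻ t in Ioi (0 : ℝ), ∫⁻ α in Ioo (-1 : ℝ) 1,
            ENNReal.ofReal (1 / 2 * t ^ (((n : ℝ) - 1) / 2) * (1 - α ^ 2) ^ (((n : ℝ) - 2) / 2))
              * f (‖x‖ ^ 2, t, α) :=
          hmi.comp (f := fun x : EuclideanSpace ℝ (Fin (n + 1)) => ‖x‖ ^ 2) (by fun_prop)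
        rw [lintegral_const_mul _ hmx, lintegral_norm_sq hn hmi, gramConst,
          Measure.volume_eq_prod, ← Measure.prod_restrict, lintegral_prod _ hm.aemeasurable,
          mul_left_comm, mul_assoc, mul_assoc,  mul_assoc,
          ← lintegral_const_mul' (ENNReal.ofReal (1 / 4)) _ ENNReal.ofReal_ne_top]
        simp only [V, mul_assoc]
        congr 4
        refine setLIntegral_congr_fun measurableSet_Ioi fun s hs => ?_
        have hs' : (0 : ℝ) < s := hs
        have hms : Measurable fun q : ℝ × ℝ => ENNReal.ofReal (gramDensity n (s, q)) * f (s, q) :=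
          hm.comp (f := fun q : ℝ × ℝ => (s, q)) (by fun_prop)
        rw [Measure.volume_eq_prod, ← Measure.prod_restrict, lintegral_prod _ hms.aemeasurable,
          ← lintegral_const_mul' _ _ ENNReal.ofReal_ne_top,
          ← lintegral_const_mul' _ _ ENNReal.ofReal_ne_top]
        refine setLIntegral_congr_fun measurableSet_Ioi fun t ht => ?_
        have ht' : (0 : ℝ) < t := ht
        rw [← lintegral_const_mul' _ _ ENNReal.ofReal_ne_top,
          ← lintegral_const_mul' _ _ ENNReal.ofReal_ne_top]
        refine setLIntegral_congr_fun measurableSet_Ioo fun α hα => ?_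
        simp only [gramDensity]
        rw [← mul_assoc, ← ENNReal.ofReal_mul (by positivity),
          ← mul_assoc (ENNReal.ofReal (1 / 4)), ← ENNReal.ofReal_mul (by norm_num)]
        congr 2
        ring

theorem map_gramMap {n : ℕ} (hn : 1 ≤ n) :
    Measure.map (gramMap (n := n)) volume = gramConst n •
      (volume.restrict (Ioi (0 : ℝ) ×ˢ Ioi (0 : ℝ) ×ˢ Ioo (-1 : ℝ) 1)).withDensity
        fun q => ENNReal.ofReal (gramDensity n q) := by
  refine Measure.ext_of_lintegral _ fun f hf => ?_
  rw [lintegral_map hf (measurable_gramMap n), lintegral_gramMap hn hf, lintegral_smul_measure,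
    lintegral_withDensity_eq_lintegral_mul _ (measurable_gramDensity n).ennreal_ofReal hf]
  rfl

/-- The sphere areas contain Γ(n/2) and Γ((n+1)/2), whose product is given by Legendre's duplication
formula in terms of Γ(n) = (n-1)!. -/
theorem gramConst_eq {n : ℕ} (hn : 1 ≤ n) :
    gramConst n = ENNReal.ofReal (Real.pi ^ n * 2 ^ (n - 1) / (n - 1).factorial) := by
  have : Nonempty (Fin n) := ⟨⟨0, hn⟩⟩
  have hn' : (0 : ℝ) < n := by exact_mod_cast hn
  have hπ := Real.pi_pos
  have hball : ∀ m : ℕ, 1 ≤ m → (m : ENNReal) *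
      volume (Metric.ball (0 : EuclideanSpace ℝ (Fin m)) 1)
      = ENNReal.ofReal (2 * √Real.pi ^ m / Real.Gamma ((m : ℝ) / 2)) := by
    intro m hm
    have : Nonempty (Fin m) := ⟨⟨0, hm⟩⟩
    have hm' : (0 : ℝ) < m := by exact_mod_cast hm
    rw [EuclideanSpace.volume_ball]
    simp only [ENNReal.ofReal_one, one_pow, one_mul, Fintype.card_fin]
    rw [← ENNReal.ofReal_natCast, ← ENNReal.ofReal_mul (by positivity),
      Real.Gamma_add_one (by positivity)]
    congr 1
    have := Real.Gamma_pos_of_pos (show (0 : ℝ) < m / 2 by positivity)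
    field_simp
  have hdup := Real.Gamma_mul_Gamma_add_half ((n : ℝ) / 2)
  have hG : Real.Gamma (2 * ((n : ℝ) / 2)) = (n - 1).factorial := by
    rw [← Real.Gamma_nat_eq_factorial]
    congr 1
    push_cast [Nat.cast_sub hn]
    ring
  have hpw : (2 : ℝ) ^ (1 - 2 * ((n : ℝ) / 2)) * 2 ^ (n - 1) = 1 := by
    rw [← Real.rpow_natCast 2 (n - 1), ← Real.rpow_add two_pos]
    push_cast [Nat.cast_sub hn]
    ring_nf
    simp
  rw [gramConst, hball n hn, hball (n + 1) (by omega), ← ENNReal.ofReal_mul (by positivity),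
    ← ENNReal.ofReal_mul (by positivity)]
  congr 1
  rw [hG] at hdup
  have g1 := Real.Gamma_pos_of_pos (show (0 : ℝ) < n / 2 by positivity)
  have g2 := Real.Gamma_pos_of_pos (show (0 : ℝ) < n / 2 + 1 / 2 by positivity)
  have hcast : (((n + 1 : ℕ) : ℝ) / 2) = n / 2 + 1 / 2 := by push_cast; ring
  have hs : √Real.pi ^ (n + 1) * √Real.pi ^ n = Real.pi ^ n * √Real.pi := by
    rw [← pow_add, show n + 1 + n = 2 * n + 1 by ring, pow_succ, pow_mul, Real.sq_sqrt hπ.le]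
  have hsp : 0 < √Real.pi := Real.sqrt_pos.2 hπ
  have hf : (0 : ℝ) < (n - 1).factorial := by exact_mod_cast (n - 1).factorial_pos
  rw [hcast]
  calc _ = √Real.pi ^ (n + 1) * √Real.pi ^ n /
        (Real.Gamma (n / 2) * Real.Gamma (n / 2 + 1 / 2)) := by
        field_simp
        norm_num
    _ = _ := by
        rw [hdup, hs, div_eq_div_iff (by positivity) (by positivity)]
        linear_combination (-Real.pi ^ n * √Real.pi * (n - 1).factorial) * hpw

/-! ### Complex Gaussian integrals and the bosonic representation of the resolvent. -/

theorem integrable_sq_mul_cexp_neg_mul_sq {b : ℂ} (hb : 0 < b.re) :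
    Integrable fun x : ℝ => (x : ℂ) ^ 2 * Complex.exp (-b * (x : ℂ) ^ 2) := by
  have h := integrable_rpow_mul_exp_neg_mul_sq hb (s := 2) (by norm_num)
  refine h.mono' (by fun_prop) (Filter.Eventually.of_forall fun x => ?_)
  rw [norm_mul, norm_cexp_neg_mul_sq, norm_pow, Complex.norm_real, Real.norm_eq_abs, sq_abs]
  simp

theorem integral_sq_mul_gaussian_complex {b : ℂ} (hb : 0 < b.re) :
    ∫ x : ℝ, (x : ℂ) ^ 2 * Complex.exp (-b * (x : ℂ) ^ 2)
      = 1 / (2 * b) * ∫ x : ℝ, Complex.exp (-b * (x : ℂ) ^ 2) := by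
  have hb0 : b ≠ 0 := by rintro rfl; simp at hb
  have h0 := integrable_cexp_neg_mul_sq hb
  have h1 := integrable_mul_cexp_neg_mul_sq hb
  have h2 := integrable_sq_mul_cexp_neg_mul_sq hb
  have hd : ∀ x : ℝ, HasDerivAt (fun x : ℝ => (x : ℂ) * Complex.exp (-b * (x : ℂ) ^ 2))
      (Complex.exp (-b * (x : ℂ) ^ 2)
        - 2 * b * ((x : ℂ) ^ 2 * Complex.exp (-b * (x : ℂ) ^ 2))) x := fun x => by
    have hx := Complex.ofRealCLM.hasDerivAt (x := x)
    have h : HasDerivAt (fun x : ℝ => (x : ℂ) * Complex.exp (-b * (x : ℂ) ^ 2)) _ x :=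
      hx.mul ((hx.pow 2).const_mul (-b)).cexp
    refine h.congr_deriv ?_
    simp
    ring
  have h := integral_eq_zero_of_hasDerivAt_of_integrable hd (h0.sub (h2.const_mul _)) h1
  rw [integral_sub h0 (h2.const_mul _), integral_const_mul] at h
  rw [one_div_mul_eq_div, eq_div_iff (by simp [hb0])]
  linear_combination -h

section

variable {N : ℕ} {M : Matrix (Fin N) (Fin N) ℝ}

open Matrix in
theorem Matrix.IsHermitian.dotProduct_mulVec_eq_sum (hM : M.IsHermitian)
    (x : EuclideanSpace ℝ (Fin N)) :
    x.ofLp ⬝ᵥ M *ᵥ x.ofLp = ∑ k, hM.eigenvalues k * hM.eigenvectorBasis.repr x k ^ 2 := by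
  have hinner : ∀ a b : EuclideanSpace ℝ (Fin N), inner ℝ a b = b.ofLp ⬝ᵥ a.ofLp := fun a b => by
    rw [EuclideanSpace.inner_eq_star_dotProduct]; simp
  set y : EuclideanSpace ℝ (Fin N) := WithLp.toLp 2 (M *ᵥ x.ofLp) with hy
  have h1 : x.ofLp ⬝ᵥ M *ᵥ x.ofLp = inner ℝ x y := by
    rw [hinner, hy, dotProduct_comm]
  rw [h1, ← hM.eigenvectorBasis.sum_inner_mul_inner x y]
  refine Finset.sum_congr rfl fun k _ => ?_
  have h2 : inner ℝ (hM.eigenvectorBasis k) y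
      = hM.eigenvalues k * inner ℝ (hM.eigenvectorBasis k) x := by
    rw [hinner, hinner, hy]
    have hMT : Mᵀ = M := by simpa using hM.eq
    calc (M *ᵥ x.ofLp) ⬝ᵥ (hM.eigenvectorBasis k).ofLp
        = x.ofLp ⬝ᵥ (M *ᵥ (hM.eigenvectorBasis k).ofLp) := by
          rw [dotProduct_comm, dotProduct_mulVec, ← mulVec_transpose, hMT, dotProduct_comm]
      _ = _ := by
          rw [hM.mulVec_eigenvectorBasis, dotProduct_smul, smul_eq_mul]
  rw [h2, OrthonormalBasis.repr_apply_apply, real_inner_comm]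
  ring

open Matrix in
theorem Matrix.IsHermitian.map_eq_conj (hM : M.IsHermitian) :
    ∃ U V : Matrix (Fin N) (Fin N) ℂ, U * V = 1 ∧ V * U = 1 ∧
      M.map Complex.ofReal = U * diagonal (fun k => (hM.eigenvalues k : ℂ)) * V := by
  set U := (hM.eigenvectorUnitary : Matrix (Fin N) (Fin N) ℝ)
  have hU : U * star U = 1 := Unitary.coe_mul_star_self _
  have hU' : star U * U = 1 := Unitary.coe_star_mul_self _
  have hsp : M = U * diagonal hM.eigenvalues * star U := by
    conv_lhs => rw [hM.spectral_theorem, Unitary.conjStarAlgAut_apply]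
    rfl
  have hmul : ∀ A B : Matrix (Fin N) (Fin N) ℝ,
      (A * B).map Complex.ofReal = A.map Complex.ofReal * B.map Complex.ofReal := fun A B =>
    Matrix.map_mul (f := Complex.ofRealHom)
  have hone : (1 : Matrix (Fin N) (Fin N) ℝ).map Complex.ofReal = 1 := by
    ext i j; by_cases h : i = j <;> simp [h, Matrix.one_apply]
  refine ⟨U.map Complex.ofReal, (star U).map Complex.ofReal, ?_, ?_, ?_⟩
  · rw [← hmul, hU, hone]
  · rw [← hmul, hU', hone]
  · conv_lhs => rw [hsp]
    rw [hmul, hmul, diagonal_map (by simp)]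

open Matrix in
theorem Matrix.IsHermitian.det_smul_one_sub_smul (hM : M.IsHermitian) (c d : ℂ) :
    (c • (1 : Matrix (Fin N) (Fin N) ℂ) - d • M.map Complex.ofReal).det
      = ∏ k, (c - d * hM.eigenvalues k) := by
  obtain ⟨U, V, hUV, hVU, h⟩ := hM.map_eq_conj
  have h1 : c • (1 : Matrix (Fin N) (Fin N) ℂ) - d • M.map Complex.ofReal
      = U * diagonal (fun k => c - d * hM.eigenvalues k) * V := by
    have h2 : diagonal (fun k => c - d * (hM.eigenvalues k : ℂ))
        = c • (1 : Matrix (Fin N) (Fin N) ℂ) - d • diagonal fun k => (hM.eigenvalues k : ℂ) := by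
      ext i j; by_cases hij : i = j <;> simp [hij]
    rw [h2, mul_sub, sub_mul, mul_smul_comm, mul_smul_comm, smul_mul_assoc, smul_mul_assoc,
      mul_one, hUV, h]
  have h3 : U.det * V.det = 1 := by rw [← det_mul, hUV, det_one]
  rw [h1, det_mul, det_mul, det_diagonal]
  linear_combination (∏ k, (c - d * (hM.eigenvalues k : ℂ))) * h3

open Matrix in
theorem Matrix.IsHermitian.trace_matResolvent (hM : M.IsHermitian) {w : ℂ} (hw : w.im ≠ 0) :
    (matResolvent M w).trace = ∑ k, (w - hM.eigenvalues k)⁻¹ := by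
  obtain ⟨U, V, hUV, hVU, h⟩ := hM.map_eq_conj
  have hne : ∀ k, w - hM.eigenvalues k ≠ 0 := fun k hk => hw (by
    have := congrArg Complex.im hk; simpa using this)
  have h1 : w • (1 : Matrix (Fin N) (Fin N) ℂ) - M.map Complex.ofReal
      = U * diagonal (fun k => w - hM.eigenvalues k) * V := by
    have h2 : diagonal (fun k => w - (hM.eigenvalues k : ℂ))
        = w • (1 : Matrix (Fin N) (Fin N) ℂ) - diagonal fun k => (hM.eigenvalues k : ℂ) := by
      ext i j; by_cases hij : i = j <;> simp [hij]
    rw [h2, mul_sub, sub_mul, mul_smul_comm, smul_mul_assoc, mul_one, hUV, h]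
  have h3 : matResolvent M w = U * diagonal (fun k => (w - hM.eigenvalues k)⁻¹) * V := by
    refine inv_eq_right_inv ?_
    rw [h1]
    calc U * diagonal (fun k => w - (hM.eigenvalues k : ℂ)) * V *
        (U * diagonal (fun k => (w - (hM.eigenvalues k : ℂ))⁻¹) * V)
        = U * diagonal (fun k => w - (hM.eigenvalues k : ℂ)) * (V * U) *
          diagonal (fun k => (w - (hM.eigenvalues k : ℂ))⁻¹) * V := by
          simp only [Matrix.mul_assoc]
      _ = U * (diagonal (fun k => w - (hM.eigenvalues k : ℂ)) *
          diagonal (fun k => (w - (hM.eigenvalues k : ℂ))⁻¹)) * V := by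
          rw [hVU, Matrix.mul_one, Matrix.mul_assoc U]
      _ = 1 := by
          rw [diagonal_mul_diagonal]
          simp only [mul_inv_cancel₀ (hne _), diagonal_one, Matrix.mul_one, hUV]
  rw [h3, trace_mul_comm, ← Matrix.mul_assoc, hVU, Matrix.one_mul, trace_diagonal]

/-- The bosonic weight `exp (-N (c |x|² - i xᵀ M x))`. -/
noncomputable def quadWeight (M : Matrix (Fin N) (Fin N) ℝ) (c : ℂ)
    (x : EuclideanSpace ℝ (Fin N)) : ℂ :=
  Complex.exp (-N * (c * ((‖x‖ ^ 2 : ℝ) : ℂ)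
    - Complex.I * ((x.ofLp ⬝ᵥ M.mulVec x.ofLp : ℝ) : ℂ)))

/-- The matrix is real, so it enters through a pure phase. This bound, uniform in the matrix, is
what permits Fubini. -/
theorem norm_quadWeight (M : Matrix (Fin N) (Fin N) ℝ) (c : ℂ) (x : EuclideanSpace ℝ (Fin N)) :
    ‖quadWeight M c x‖ = Real.exp (-(N * c.re) * ‖x‖ ^ 2) := by
  rw [quadWeight, Complex.norm_exp]
  congr 1
  have : -(N : ℂ) * (c * ((‖x‖ ^ 2 : ℝ) : ℂ)
    - Complex.I * ((x.ofLp ⬝ᵥ M.mulVec x.ofLp : ℝ) : ℂ))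
    = ((-N : ℝ) : ℂ) * (c * ((‖x‖ ^ 2 : ℝ) : ℂ)
    - Complex.I * ((x.ofLp ⬝ᵥ M.mulVec x.ofLp : ℝ) : ℂ)) := by push_cast; rfl
  rw [this, Complex.re_ofReal_mul, Complex.sub_re, Complex.re_mul_ofReal, Complex.mul_re,
    Complex.ofReal_im, Complex.I_re]
  ring

theorem Matrix.IsHermitian.quadWeight_eq_prod (hM : M.IsHermitian) (c : ℂ)
    (x : EuclideanSpace ℝ (Fin N)) :
    quadWeight M c x = ∏ k, Complex.exp (-(N * (c - Complex.I * hM.eigenvalues k))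
      * (hM.eigenvectorBasis.repr x k : ℂ) ^ 2) := by
  have h1 : ‖x‖ ^ 2 = ∑ k, hM.eigenvectorBasis.repr x k ^ 2 := by
    rw [← hM.eigenvectorBasis.repr.norm_map x, EuclideanSpace.real_norm_sq_eq]
  rw [quadWeight, h1, hM.dotProduct_mulVec_eq_sum, ← Complex.exp_sum]
  congr 1
  push_cast
  rw [Finset.mul_sum, Finset.mul_sum, ← Finset.sum_sub_distrib, Finset.mul_sum]
  exact Finset.sum_congr rfl fun _ _ => by ring

theorem integral_orthonormalBasis_repr (b : OrthonormalBasis (Fin N) ℝ (EuclideanSpace ℝ (Fin N)))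
    (f : (Fin N → ℝ) → ℂ) : ∫ x, f (b.repr x).ofLp = ∫ y, f y := by
  rw [b.repr.measurePreserving.integral_comp b.repr.toHomeomorph.measurableEmbedding
    (fun y : EuclideanSpace ℝ (Fin N) => f y.ofLp)]
  exact (EuclideanSpace.volume_preserving_symm_measurableEquiv_toLp (Fin N)).integral_comp' f

/-- A linear factor is absorbed at the price of half the decay rate. -/
theorem one_add_mul_exp_neg_le {a u : ℝ} (ha : 0 < a) (hu : 0 ≤ u) :
    (1 + u) * Real.exp (-a * u) ≤ (1 + 2 / a) * Real.exp (-(a / 2) * u) := by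
  have h1 : u ≤ 2 / a * Real.exp (a / 2 * u) := by
    have := Real.add_one_le_exp (a / 2 * u)
    calc u = 2 / a * (a / 2 * u) := by field_simp
      _ ≤ _ := by gcongr; linarith
  have h2 : 1 ≤ Real.exp (a / 2 * u) := Real.one_le_exp (by positivity)
  have h3 : Real.exp (-(a / 2) * u) = Real.exp (a / 2 * u) * Real.exp (-a * u) := by
    rw [← Real.exp_add]; congr 1; ring
  rw [h3, ← mul_assoc]
  gcongr
  linarith

theorem integrable_exp_neg_mul_norm_sq {a : ℝ} (ha : 0 < a) :
    Integrable fun x : EuclideanSpace ℝ (Fin N) => Real.exp (-a * ‖x‖ ^ 2) := by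
  have := (GaussianFourier.integrable_cexp_neg_mul_sq_norm_add (V := EuclideanSpace ℝ (Fin N))
    (b := a) (by simpa using ha) 0 0).norm
  refine this.congr (Filter.Eventually.of_forall fun x => ?_)
  simp [Complex.norm_exp, ← Complex.ofReal_pow]

theorem continuous_quadWeight (M : Matrix (Fin N) (Fin N) ℝ) (c : ℂ) :
    Continuous (quadWeight M c) := by
  unfold quadWeight
  have h : Continuous fun x : EuclideanSpace ℝ (Fin N) => x.ofLp ⬝ᵥ M.mulVec x.ofLp := by
    simp only [dotProduct, Matrix.mulVec]
    fun_prop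
  fun_prop

theorem integrable_quadWeight (hN : N ≠ 0) (M : Matrix (Fin N) (Fin N) ℝ) {c : ℂ}
    (hc : 0 < c.re) : Integrable (quadWeight M c) := by
  have hN' : (0 : ℝ) < N := by positivity
  refine (integrable_exp_neg_mul_norm_sq (N := N) (mul_pos hN' hc)).mono'
    (continuous_quadWeight M c).aestronglyMeasurable (Filter.Eventually.of_forall fun x => ?_)
  rw [norm_quadWeight]

theorem integrable_norm_sq_mul_quadWeight (hN : N ≠ 0) (M : Matrix (Fin N) (Fin N) ℝ) {c : ℂ}
    (hc : 0 < c.re) :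
    Integrable fun x : EuclideanSpace ℝ (Fin N) => ((‖x‖ ^ 2 : ℝ) : ℂ) * quadWeight M c x := by
  have hN' : (0 : ℝ) < N := by positivity
  have ha := mul_pos hN' hc
  refine ((integrable_exp_neg_mul_norm_sq (N := N) (half_pos ha)).const_mul
    (1 + 2 / (N * c.re))).mono' ?_ (Filter.Eventually.of_forall fun x => ?_)
  · have := continuous_quadWeight M c
    exact Continuous.aestronglyMeasurable (by fun_prop)
  · rw [norm_mul, norm_quadWeight, Complex.norm_real, Real.norm_eq_abs,
      abs_of_nonneg (by positivity)]
    refine le_trans ?_ (one_add_mul_exp_neg_le ha (sq_nonneg ‖x‖))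
    gcongr
    linarith

/-- In an eigenbasis the weight is a product of one-dimensional Gaussians. Squaring the integral
removes the branch of the square root of each factor, which is why two vectors are used. -/
theorem Matrix.IsHermitian.integral_quadWeight (hN : N ≠ 0) (hM : M.IsHermitian) {c : ℂ}
    (hc : 0 < c.re) :
    (∫ x, quadWeight M c x) ^ 2
        = (Real.pi / N) ^ N / ∏ k, (c - Complex.I * hM.eigenvalues k) ∧
      ∫ x, ((‖x‖ ^ 2 : ℝ) : ℂ) * quadWeight M c x
        = (∑ k, 1 / (2 * (N * (c - Complex.I * hM.eigenvalues k)))) * ∫ x, quadWeight M c x := by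
  have hN' : (0 : ℝ) < N := by positivity
  set b : Fin N → ℂ := fun k => N * (c - Complex.I * hM.eigenvalues k) with hb
  have hbre : ∀ k, 0 < (b k).re := fun k => by
    have : (b k).re = N * c.re := by simp [b]
    rw [this]; positivity
  have e1 : ∫ x, quadWeight M c x = ∏ k, ∫ t : ℝ, Complex.exp (-b k * (t : ℂ) ^ 2) := by
    simp_rw [hM.quadWeight_eq_prod]
    rw [integral_orthonormalBasis_repr hM.eigenvectorBasis
      (fun y => ∏ k, Complex.exp (-(N * (c - Complex.I * hM.eigenvalues k)) * (y k : ℂ) ^ 2))]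
    exact integral_fintype_prod_volume_eq_prod
      (fun k (t : ℝ) => Complex.exp (-b k * (t : ℂ) ^ 2))
  refine ⟨?_, ?_⟩
  · rw [e1, ← Finset.prod_pow]
    have : ∀ k, (∫ t : ℝ, Complex.exp (-b k * (t : ℂ) ^ 2)) ^ 2
        = (Real.pi / N) / (c - Complex.I * hM.eigenvalues k) := fun k => by
      rw [integral_gaussian_complex (hbre k), ← Complex.cpow_nat_mul]
      simp [b, div_div]
    simp_rw [this]
    rw [Finset.prod_div_distrib]
    simp [div_pow]
  · let φ : Fin N → Fin N → ℝ → ℂ := fun j k t =>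
      (if k = j then (t : ℂ) ^ 2 else 1) * Complex.exp (-b k * (t : ℂ) ^ 2)
    have hφi : ∀ j k, Integrable (φ j k) := fun j k => by
      by_cases h : k = j
      · simpa [φ, h] using integrable_sq_mul_cexp_neg_mul_sq (hbre j)
      · simpa [φ, h] using integrable_cexp_neg_mul_sq (hbre k)
    have hφ : ∀ j (y : Fin N → ℝ), ∏ k, φ j k (y k)
        = (y j : ℂ) ^ 2 * ∏ k, Complex.exp (-b k * (y k : ℂ) ^ 2) := fun j y => by
      simp only [φ, Finset.prod_mul_distrib, Finset.prod_ite_eq', Finset.mem_univ, if_true]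
    have e2 : ∀ x : EuclideanSpace ℝ (Fin N), ((‖x‖ ^ 2 : ℝ) : ℂ) * quadWeight M c x
        = ∑ j, ∏ k, φ j k (hM.eigenvectorBasis.repr x k) := fun x => by
      simp_rw [hφ]
      rw [← Finset.sum_mul, hM.quadWeight_eq_prod, ← hM.eigenvectorBasis.repr.norm_map x,
        EuclideanSpace.real_norm_sq_eq]
      push_cast
      rfl
    have hint : ∀ j, Integrable fun y : Fin N → ℝ => ∏ k, φ j k (y k) :=
      fun j => Integrable.fintype_prod (hφi j)
    simp_rw [e2]
    rw [integral_orthonormalBasis_repr hM.eigenvectorBasis (fun y => ∑ j, ∏ k, φ j k (y k)),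
      integral_finsetSum _ fun j _ => hint j, Finset.sum_mul]
    refine Finset.sum_congr rfl fun j _ => ?_
    rw [integral_fintype_prod_volume_eq_prod (φ j), e1,
      ← Finset.mul_prod_erase _ _ (Finset.mem_univ j),
      ← Finset.mul_prod_erase Finset.univ _ (Finset.mem_univ j), ← mul_assoc]
    congr 1
    · simp only [φ, if_true]
      exact integral_sq_mul_gaussian_complex (hbre j)
    · refine Finset.prod_congr rfl fun k hk => ?_
      simp [φ, Finset.ne_of_mem_erase hk]

/-- The bosonic representation of the inverse determinant and of the resolvent. -/
theorem Matrix.IsHermitian.integral_quadWeight_prod (hN : N ≠ 0) (hM : M.IsHermitian) {w : ℂ}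
    (hw : w.im < 0) :
    ((Complex.I * w) • (1 : Matrix (Fin N) (Fin N) ℂ) - Complex.I • M.map Complex.ofReal).det
        * ∫ p : EuclideanSpace ℝ (Fin N) × EuclideanSpace ℝ (Fin N),
          quadWeight M (Complex.I * w) p.1 * quadWeight M (Complex.I * w) p.2
        = (Real.pi / N) ^ N ∧
      ((Complex.I * w) • (1 : Matrix (Fin N) (Fin N) ℂ) - Complex.I • M.map Complex.ofReal).det
        * ∫ p : EuclideanSpace ℝ (Fin N) × EuclideanSpace ℝ (Fin N),
          ((‖p.1‖ ^ 2 + ‖p.2‖ ^ 2 : ℝ) : ℂ) *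
            (quadWeight M (Complex.I * w) p.1 * quadWeight M (Complex.I * w) p.2)
        = (Real.pi / N) ^ N * (-Complex.I / N * (matResolvent M w).trace) := by
  set c := Complex.I * w with hcdef
  have hc : 0 < c.re := by simp [c, hw]
  obtain ⟨h1, h2⟩ := hM.integral_quadWeight hN hc
  have hi := integrable_quadWeight hN M hc
  have hi2 := integrable_norm_sq_mul_quadWeight hN M hc
  have hne : ∏ k, (c - Complex.I * hM.eigenvalues k) ≠ 0 := by
    refine Finset.prod_ne_zero_iff.2 fun k _ h => ?_
    have := congrArg Complex.re h
    simp at this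
    exact hc.ne' this
  rw [hM.det_smul_one_sub_smul]
  have e1 : ∫ p : EuclideanSpace ℝ (Fin N) × EuclideanSpace ℝ (Fin N),
      quadWeight M c p.1 * quadWeight M c p.2 = (∫ x, quadWeight M c x) ^ 2 := by
    rw [sq]; exact integral_prod_mul _ _
  refine ⟨by rw [e1, h1, mul_div_cancel₀ _ hne], ?_⟩
  have e2 : ∀ p : EuclideanSpace ℝ (Fin N) × EuclideanSpace ℝ (Fin N),
      ((‖p.1‖ ^ 2 + ‖p.2‖ ^ 2 : ℝ) : ℂ) * (quadWeight M c p.1 * quadWeight M c p.2)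
      = ((‖p.1‖ ^ 2 : ℝ) : ℂ) * quadWeight M c p.1 * quadWeight M c p.2
        + quadWeight M c p.1 * (((‖p.2‖ ^ 2 : ℝ) : ℂ) * quadWeight M c p.2) := fun p => by
    push_cast; ring
  have e3 : ∫ p : EuclideanSpace ℝ (Fin N) × EuclideanSpace ℝ (Fin N),
      ((‖p.1‖ ^ 2 : ℝ) : ℂ) * quadWeight M c p.1 * quadWeight M c p.2
      = (∫ x, ((‖x‖ ^ 2 : ℝ) : ℂ) * quadWeight M c x) * ∫ x, quadWeight M c x :=
    integral_prod_mul (fun x : EuclideanSpace ℝ (Fin N) => ((‖x‖ ^ 2 : ℝ) : ℂ) * quadWeight M c x) _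
  have e4 : ∫ p : EuclideanSpace ℝ (Fin N) × EuclideanSpace ℝ (Fin N),
      quadWeight M c p.1 * (((‖p.2‖ ^ 2 : ℝ) : ℂ) * quadWeight M c p.2)
      = (∫ x, quadWeight M c x) * ∫ x, ((‖x‖ ^ 2 : ℝ) : ℂ) * quadWeight M c x :=
    integral_prod_mul _ (fun x : EuclideanSpace ℝ (Fin N) => ((‖x‖ ^ 2 : ℝ) : ℂ) * quadWeight M c x)
  have i1 : Integrable fun p : EuclideanSpace ℝ (Fin N) × EuclideanSpace ℝ (Fin N) =>
      ((‖p.1‖ ^ 2 : ℝ) : ℂ) * quadWeight M c p.1 * quadWeight M c p.2 := hi2.mul_prod hi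
  have i2 : Integrable fun p : EuclideanSpace ℝ (Fin N) × EuclideanSpace ℝ (Fin N) =>
      quadWeight M c p.1 * (((‖p.2‖ ^ 2 : ℝ) : ℂ) * quadWeight M c p.2) := hi.mul_prod hi2
  simp_rw [e2]
  rw [integral_add i1 i2, e3, e4, h2,
    hM.trace_matResolvent hw.ne]
  -- Each vector contributes half of the resolvent trace, because c - iλ = i(w - λ); the two vectors
  -- together remove the factor 1/2.
  have hs : ∑ k, 1 / (2 * (N * (c - Complex.I * hM.eigenvalues k)))
      = -Complex.I / (2 * N) * ∑ k, (w - hM.eigenvalues k)⁻¹ := by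
    rw [Finset.mul_sum]
    refine Finset.sum_congr rfl fun k _ => ?_
    have : c - Complex.I * hM.eigenvalues k = Complex.I * (w - hM.eigenvalues k) := by
      rw [hcdef]; ring
    rw [this, one_div, mul_inv, mul_inv, mul_inv, Complex.inv_I, div_eq_mul_inv, mul_inv]
    ring
  rw [hs]
  have h3 : (∏ k, (c - Complex.I * hM.eigenvalues k)) * (∫ x, quadWeight M c x) ^ 2
      = (Real.pi / N) ^ N := by rw [h1, mul_div_cancel₀ _ hne]
  rw [← h3]
  field_simp
  ring

end

/-! ### Averaging the bosonic integrand over the matrix. -/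

section

variable {N : ℕ} {c : ℂ} {h : ℝ → ℝ}

/-- The averaged characteristic determinant as a function of `τ = s + t` and
`δ = s t (1 - α²)`. -/
noncomputable def detMoment (N : ℕ) (c τ δ : ℂ) : ℂ :=
  shiftedMoment (1 / N) c N + 2 * τ * shiftedMoment (1 / N) c (N - 1)
    + 4 * δ * shiftedMoment (1 / N) c (N - 2)

/-- The Gaussian part `exp (-N (c (s + t) + s² + t² + 2 s t α²))` of the weight in the Gram
variables. -/
noncomputable def gramExp (N : ℕ) (c : ℂ) (q : ℝ × ℝ × ℝ) : ℂ :=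
  Complex.exp (-N * (c * (q.1 + q.2.1) + q.1 ^ 2 + q.2.1 ^ 2 + 2 * q.1 * q.2.1 * q.2.2 ^ 2))

/-- The integrand in the Gram variables `(s, t, α)` before the change of variables. -/
noncomputable def gramWeight (N : ℕ) (c : ℂ) (h : ℝ → ℝ) (q : ℝ × ℝ × ℝ) : ℂ :=
  h (q.1 + q.2.1) * gramExp N c q
    * detMoment N c (q.1 + q.2.1) (q.1 * q.2.1 * (1 - (q.2.2 : ℂ) ^ 2))

theorem continuous_symOfUpper : Continuous (symOfUpper (N := N)) := by
  unfold symOfUpper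
  fun_prop

theorem continuous_quadWeight_symOfUpper (c : ℂ) :
    Continuous fun a : (UpperIndex N → ℝ) × EuclideanSpace ℝ (Fin N) =>
      quadWeight (symOfUpper a.1) c a.2 := by
  unfold quadWeight
  have hs := continuous_symOfUpper (N := N)
  have h : Continuous fun a : (UpperIndex N → ℝ) × EuclideanSpace ℝ (Fin N) =>
      a.2.ofLp ⬝ᵥ (symOfUpper a.1).mulVec a.2.ofLp := by
    simp only [dotProduct, Matrix.mulVec]
    fun_prop
  fun_prop

/-- The modulus of the bosonic weight does not involve the matrix, so the majorant is an integrable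
determinant times a Gaussian in the two vectors, with the growth of h absorbed. -/
theorem integrable_weight_prod (hN : N ≠ 0) (hc : 0 < c.re)
    (hh : Continuous h) (hb : ∀ u, 0 ≤ u → |h u| ≤ 1 + u) :
    Integrable (fun a : (UpperIndex N → ℝ) × EuclideanSpace ℝ (Fin N) × EuclideanSpace ℝ (Fin N) =>
      (c • (1 : Matrix (Fin N) (Fin N) ℂ) - Complex.I • (symOfUpper a.1).map Complex.ofReal).det
        * ((h (‖a.2.1‖ ^ 2 + ‖a.2.2‖ ^ 2) : ℂ)
          * (quadWeight (symOfUpper a.1) c a.2.1 * quadWeight (symOfUpper a.1) c a.2.2)))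
      ((Measure.pi fun e : UpperIndex N => gaussianReal 0 (goeVar e)).prod volume) := by
  have hN' : (0 : ℝ) < N := by positivity
  set a := N * c.re with ha'
  have ha : 0 < a := mul_pos hN' hc
  have hdom := (integrable_det_symOfUpper (N := N) c).norm.mul_prod
    (((integrable_exp_neg_mul_norm_sq (N := N) (half_pos ha)).mul_prod
      (integrable_exp_neg_mul_norm_sq (N := N) (half_pos ha))).const_mul (1 + 2 / a))
  refine hdom.mono' ?_ (Filter.Eventually.of_forall fun b => ?_)
  · have hs := continuous_symOfUpper (N := N)
    have hq := continuous_quadWeight_symOfUpper (N := N) c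
    have h1 := hq.comp (f := fun a : (UpperIndex N → ℝ) × EuclideanSpace ℝ (Fin N) ×
      EuclideanSpace ℝ (Fin N) => (a.1, a.2.1)) (by fun_prop)
    have h2 := hq.comp (f := fun a : (UpperIndex N → ℝ) × EuclideanSpace ℝ (Fin N) ×
      EuclideanSpace ℝ (Fin N) => (a.1, a.2.2)) (by fun_prop)
    simp only [Function.comp_def] at h1 h2
    have h3 : Continuous fun a : (UpperIndex N → ℝ) × EuclideanSpace ℝ (Fin N) ×
        EuclideanSpace ℝ (Fin N) => (c • (1 : Matrix (Fin N) (Fin N) ℂ)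
          - Complex.I • (symOfUpper a.1).map Complex.ofReal).det := by
      refine Continuous.matrix_det (continuous_const.sub (Continuous.const_smul ?_ Complex.I))
      exact (hs.comp continuous_fst).matrix_map Complex.continuous_ofReal
    exact Continuous.aestronglyMeasurable (by fun_prop)
  · simp only [norm_mul, norm_quadWeight, Complex.norm_real, Real.norm_eq_abs]
    refine mul_le_mul_of_nonneg_left ?_ (norm_nonneg _)
    have hu : 0 ≤ ‖b.2.1‖ ^ 2 + ‖b.2.2‖ ^ 2 := by positivity
    calc _ ≤ (1 + (‖b.2.1‖ ^ 2 + ‖b.2.2‖ ^ 2))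
          * Real.exp (-a * (‖b.2.1‖ ^ 2 + ‖b.2.2‖ ^ 2)) := by
          rw [← Real.exp_add]
          refine mul_le_mul (hb _ hu) (le_of_eq ?_) (Real.exp_nonneg _) (by positivity)
          congr 1; ring
      _ ≤ _ := one_add_mul_exp_neg_le ha hu
      _ = _ := by rw [← Real.exp_add]; congr 2; ring

open Matrix in
theorem integral_det_mul_quadWeight (hN : 2 ≤ N) (x y : EuclideanSpace ℝ (Fin N)) :
    ∫ g, (c • (1 : Matrix (Fin N) (Fin N) ℂ)
        - Complex.I • (symOfUpper g).map Complex.ofReal).det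
        * ((h (‖x‖ ^ 2 + ‖y‖ ^ 2) : ℂ)
          * (quadWeight (symOfUpper g) c x * quadWeight (symOfUpper g) c y))
        ∂(Measure.pi fun e : UpperIndex N => gaussianReal 0 (goeVar e))
      = gramWeight N c h (‖x‖ ^ 2, ‖y‖ ^ 2, inner ℝ x y / (‖x‖ * ‖y‖)) := by
  have hx : ∀ x : EuclideanSpace ℝ (Fin N), x.ofLp ⬝ᵥ x.ofLp = ‖x‖ ^ 2 := fun x => by
    rw [EuclideanSpace.real_norm_sq_eq]; simp [dotProduct, sq]
  have hxy : x.ofLp ⬝ᵥ y.ofLp = inner ℝ x y := by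
    rw [EuclideanSpace.inner_eq_star_dotProduct]; simp [dotProduct_comm]
  -- For a zero vector the conventional value of the cosine is irrelevant, since both sides vanish.
  have hsq : (x.ofLp ⬝ᵥ y.ofLp) ^ 2
      = ‖x‖ ^ 2 * ‖y‖ ^ 2 * (inner ℝ x y / (‖x‖ * ‖y‖)) ^ 2 := by
    rw [hxy]
    by_cases h1 : ‖x‖ = 0
    · rw [norm_eq_zero.1 h1]; simp
    by_cases h2 : ‖y‖ = 0
    · rw [norm_eq_zero.1 h2]; simp
    field_simp
  have hg := integral_cexp_mul_det_gram hN c x.ofLp y.ofLp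
  rw [hsq, hx, hx] at hg
  have e : ∀ g : UpperIndex N → ℝ, (c • (1 : Matrix (Fin N) (Fin N) ℂ)
        - Complex.I • (symOfUpper g).map Complex.ofReal).det
        * ((h (‖x‖ ^ 2 + ‖y‖ ^ 2) : ℂ)
          * (quadWeight (symOfUpper g) c x * quadWeight (symOfUpper g) c y))
      = (h (‖x‖ ^ 2 + ‖y‖ ^ 2) * Complex.exp (-N * (c * (‖x‖ ^ 2 + ‖y‖ ^ 2))))
        * (Complex.exp (N * ((x.ofLp ⬝ᵥ symOfUpper g *ᵥ x.ofLp
          + y.ofLp ⬝ᵥ symOfUpper g *ᵥ y.ofLp : ℝ) : ℂ) * Complex.I)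
        * (c • (1 : Matrix (Fin N) (Fin N) ℂ)
          - Complex.I • (symOfUpper g).map Complex.ofReal).det) := fun g => by
    have : quadWeight (symOfUpper g) c x * quadWeight (symOfUpper g) c y
        = Complex.exp (-N * (c * (‖x‖ ^ 2 + ‖y‖ ^ 2)))
        * Complex.exp (N * ((x.ofLp ⬝ᵥ symOfUpper g *ᵥ x.ofLp
          + y.ofLp ⬝ᵥ symOfUpper g *ᵥ y.ofLp : ℝ) : ℂ) * Complex.I) := by
      rw [quadWeight, quadWeight, ← Complex.exp_add, ← Complex.exp_add]
      congr 1
      push_cast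
      ring
    rw [this]; ring
  simp_rw [e]
  rw [integral_const_mul, hg]
  have : gramExp N c (‖x‖ ^ 2, ‖y‖ ^ 2, inner ℝ x y / (‖x‖ * ‖y‖))
      = Complex.exp (-N * (c * (‖x‖ ^ 2 + ‖y‖ ^ 2)))
        * Complex.exp (-N * (((‖x‖ ^ 2) ^ 2 + (‖y‖ ^ 2) ^ 2
          + 2 * (‖x‖ ^ 2 * ‖y‖ ^ 2 * (inner ℝ x y / (‖x‖ * ‖y‖)) ^ 2) : ℝ) : ℂ)) := by
    rw [gramExp, ← Complex.exp_add]
    congr 1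
    push_cast
    ring
  rw [gramWeight, this, detMoment]
  push_cast
  ring

/-- Interchange of the average over the matrix with the integral over the bosonic vectors. -/
theorem integral_det_mul_integral_quadWeight (hN : 2 ≤ N) (hc : 0 < c.re)
    (hh : Continuous h) (hb : ∀ u, 0 ≤ u → |h u| ≤ 1 + u) :
    Integrable (fun g => (c • (1 : Matrix (Fin N) (Fin N) ℂ)
        - Complex.I • (symOfUpper g).map Complex.ofReal).det
        * ∫ p : EuclideanSpace ℝ (Fin N) × EuclideanSpace ℝ (Fin N),
          (h (‖p.1‖ ^ 2 + ‖p.2‖ ^ 2) : ℂ)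
          * (quadWeight (symOfUpper g) c p.1 * quadWeight (symOfUpper g) c p.2))
        (Measure.pi fun e : UpperIndex N => gaussianReal 0 (goeVar e)) ∧
      ∫ g, (c • (1 : Matrix (Fin N) (Fin N) ℂ)
        - Complex.I • (symOfUpper g).map Complex.ofReal).det
        * (∫ p : EuclideanSpace ℝ (Fin N) × EuclideanSpace ℝ (Fin N),
          (h (‖p.1‖ ^ 2 + ‖p.2‖ ^ 2) : ℂ)
          * (quadWeight (symOfUpper g) c p.1 * quadWeight (symOfUpper g) c p.2))
        ∂(Measure.pi fun e : UpperIndex N => gaussianReal 0 (goeVar e))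
      = ∫ p : EuclideanSpace ℝ (Fin N) × EuclideanSpace ℝ (Fin N),
        gramWeight N c h (‖p.1‖ ^ 2, ‖p.2‖ ^ 2, inner ℝ p.1 p.2 / (‖p.1‖ * ‖p.2‖)) := by
  have hi := integrable_weight_prod (N := N) (by omega) hc hh hb
  refine ⟨?_, ?_⟩
  · refine hi.integral_prod_left.congr (Filter.Eventually.of_forall fun g => ?_)
    simp only [integral_const_mul]
  · simp_rw [← integral_const_mul]
    rw [integral_integral_swap hi]
    exact integral_congr_ae (Filter.Eventually.of_forall fun p =>
      integral_det_mul_quadWeight hN p.1 p.2)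

end

/-! ### Integration over the Gram variables. -/

section

/-- The range of the Gram variables `(s, t, α)`. -/
def gramDomain : Set (ℝ × ℝ × ℝ) := Ioi 0 ×ˢ Ioi 0 ×ˢ Ioo (-1) 1

theorem measurableSet_gramDomain : MeasurableSet gramDomain :=
  measurableSet_Ioi.prod (measurableSet_Ioi.prod measurableSet_Ioo)

theorem one_sub_sq_pos {α : ℝ} (hα : α ∈ Ioo (-1 : ℝ) 1) : 0 < 1 - α ^ 2 := by
  nlinarith [hα.1, hα.2]

theorem gramDensity_nonneg {n : ℕ} {q : ℝ × ℝ × ℝ} (hq : q ∈ gramDomain) :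
    0 ≤ gramDensity n q := by
  have h1 : 0 < q.1 := hq.1
  have h2 : 0 < q.2.1 := hq.2.1
  have h3 := one_sub_sq_pos hq.2.2
  unfold gramDensity
  positivity

theorem integral_comp_gramMap {n : ℕ} (hn : 1 ≤ n) {f : ℝ × ℝ × ℝ → ℂ} (hf : Measurable f) :
    ∫ p : EuclideanSpace ℝ (Fin (n + 1)) × EuclideanSpace ℝ (Fin (n + 1)), f (gramMap p)
      = (gramConst n).toReal * ∫ q in gramDomain, gramDensity n q * f q := by
  rw [← integral_map (measurable_gramMap n).aemeasurable hf.aestronglyMeasurable, map_gramMap hn,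
    integral_smul_measure, integral_withDensity_eq_integral_toReal_smul
      (measurable_gramDensity n).ennreal_ofReal (by simp), ← Complex.real_smul]
  congr 1
  refine setIntegral_congr_fun measurableSet_gramDomain fun q hq => ?_
  simp only [ENNReal.toReal_ofReal (gramDensity_nonneg hq), Complex.real_smul]

theorem integral_gramDomain {f : ℝ × ℝ × ℝ → ℂ} (hf : IntegrableOn f gramDomain) :
    ∫ q in gramDomain, f q
      = ∫ s in Ioi (0 : ℝ), ∫ t in Ioi (0 : ℝ), ∫ α in (-1 : ℝ)..1, f (s, t, α) := by
  have hf' : IntegrableOn f (Ioi (0 : ℝ) ×ˢ Ioi (0 : ℝ) ×ˢ Ioo (-1 : ℝ) 1)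
      ((volume : Measure ℝ).prod volume) := hf
  have h1 := setIntegral_prod f hf'
  refine h1.trans (integral_congr_ae ?_)
  rw [IntegrableOn, ← Measure.prod_restrict] at hf'
  filter_upwards [hf'.prod_right_ae] with s hs
  have h2 := setIntegral_prod (μ := volume) (ν := volume) (fun y : ℝ × ℝ => f (s, y))
    (s := Ioi (0 : ℝ)) (t := Ioo (-1 : ℝ) 1) hs
  refine h2.trans ?_
  congr 1
  funext t
  rw [intervalIntegral.integral_of_le (by norm_num), integral_Ioc_eq_integral_Ioo]

theorem integrableOn_one_add_sq_mul_rpow_mul_exp_neg {a r : ℝ} (ha : 0 < a) (hr : -1 < r) :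
    IntegrableOn (fun s : ℝ => (1 + s) ^ 2 * (s ^ r * Real.exp (-a * s))) (Ioi 0) := by
  have h := (integrableOn_rpow_mul_exp_neg_mul_rpow hr one_pos (half_pos ha)).const_mul
    ((1 + 4 / a) ^ 2)
  refine h.mono' (by fun_prop) ((ae_restrict_iff' measurableSet_Ioi).2
    (Filter.Eventually.of_forall fun s hs => ?_))
  have hs' : 0 < s := hs
  rw [Real.norm_eq_abs, abs_of_nonneg (by positivity), Real.rpow_one]
  have h1 := pow_le_pow_left₀ (by positivity) (one_add_mul_exp_neg_le (half_pos ha) hs'.le) 2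
  rw [mul_pow, mul_pow, ← Real.exp_nat_mul, ← Real.exp_nat_mul] at h1
  calc _ = s ^ r * ((1 + s) ^ 2 * Real.exp ((2 : ℕ) * (-(a / 2) * s))) := by
        rw [show ((2 : ℕ) : ℝ) * (-(a / 2) * s) = -a * s by push_cast; ring]; ring
    _ ≤ s ^ r * ((1 + 2 / (a / 2)) ^ 2 * Real.exp ((2 : ℕ) * (-(a / 2 / 2) * s))) := by gcongr
    _ = _ := by
        rw [show ((2 : ℕ) : ℝ) * (-(a / 2 / 2) * s) = -(a / 2) * s by push_cast; ring,
          show 2 / (a / 2) = 4 / a by field_simp; norm_num]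
        ring

/-- The borderline exponent -1/2 gives the derivative of arcsin, and larger exponents are dominated
by it. With r = (N - 3)/2 the borderline is attained at N = 2. -/
theorem integrableOn_one_sub_sq_rpow {r : ℝ} (hr : -(1 / 2) ≤ r) :
    IntegrableOn (fun α : ℝ => (1 - α ^ 2) ^ r) (Ioo (-1) 1) := by
  have h : IntegrableOn (fun α : ℝ => 1 / √(1 - α ^ 2)) (Ioc (-1) 1) :=
    intervalIntegral.integrableOn_deriv_of_nonneg Real.continuous_arcsin.continuousOn
      (fun x hx => Real.hasDerivAt_arcsin hx.1.ne' hx.2.ne) fun x _ => by positivity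
  refine (h.mono_set Ioo_subset_Ioc_self).mono' (Measurable.aestronglyMeasurable (by fun_prop))
    ((ae_restrict_iff' measurableSet_Ioo).2 (Filter.Eventually.of_forall fun α hα => ?_))
  have h1 := one_sub_sq_pos hα
  rw [Real.norm_eq_abs, abs_of_nonneg (by positivity), one_div, Real.sqrt_eq_rpow,
    ← Real.rpow_neg h1.le]
  exact Real.rpow_le_rpow_of_exponent_ge h1 (by nlinarith [sq_nonneg α]) hr

end

/-! ### The integrand as Gram density times contour kernel, with majorants. -/

section

variable {N : ℕ} {c : ℂ} {h : ℝ → ℝ}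

/-- The integrand of the contour integral, as a function of `τ = s + t` and
`δ = s t (1 - α²)`. -/
noncomputable def contourKernel (N : ℕ) (c τ δ z : ℂ) : ℂ :=
  z * (z ^ N)⁻¹ * (1 / N + (z - c) ^ 2 - 2 * (z - c) * τ + 4 * δ) * contourWeight N c z

theorem cexp_half_mul_log {N : ℕ} {u : ℝ} (hu : 0 < u) (r : ℝ) :
    Complex.exp (N / 2 * (Real.log u : ℂ))
      = ((u ^ (N / 2 + r) : ℝ) : ℂ) * ((u ^ (-r) : ℝ) : ℂ) := by
  rw [← Complex.ofReal_mul, ← Real.rpow_add hu, Real.rpow_def_of_pos hu, Complex.ofReal_exp]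
  congr 1
  push_cast
  ring

/-- The logarithms in the action become the powers s^(N/2), t^(N/2), (1 - α²)^(N/2) and z^(-N), the
last for any branch. The prefactors 1/(st) and (1 - α²)^(-3/2) turn the first three into the Gram
density in dimension N. -/
theorem goeCompanionIntegrand_eq (hN : 2 ≤ N) (w : ℂ) {s t α : ℝ} (hq : (s, t, α) ∈ gramDomain)
    {z : ℂ} (hz : z ≠ 0) :
    goeCompanionIntegrand N w s t α z = gramDensity (N - 1) (s, t, α)
      * gramExp N (Complex.I * w) (s, t, α)
      * contourKernel N (Complex.I * w) (s + t) (s * t * (1 - (α : ℂ) ^ 2)) z := by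
  have hs : 0 < s := hq.1
  have ht : 0 < t := hq.2.1
  have hα := one_sub_sq_pos hq.2.2
  have hexp : Complex.exp (-(N : ℂ) * goeAction w s t α z)
      = gramExp N (Complex.I * w) (s, t, α) * contourWeight N (Complex.I * w) z
        * (z ^ N)⁻¹ * Complex.exp (N / 2 * (Real.log s : ℂ))
        * Complex.exp (N / 2 * (Real.log t : ℂ))
        * Complex.exp (N / 2 * (Real.log (1 - α ^ 2) : ℂ)) := by
    have hlog : (z ^ N)⁻¹ = Complex.exp (-(N * Complex.log z)) := by
      rw [Complex.exp_neg, Complex.exp_nat_mul, Complex.exp_log hz]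
    rw [hlog, gramExp, contourWeight, goeAction]
    simp only [← Complex.exp_add]
    congr 1
    ring
  have hpow : ∀ u : ℝ, 0 < u → Complex.exp (N / 2 * (Real.log u : ℂ))
      = ((u ^ ((((N - 1 : ℕ) : ℝ) - 1) / 2) : ℝ) : ℂ) * u := fun u hu => by
    rw [cexp_half_mul_log hu (-1), neg_neg, Real.rpow_one]
    congr 3
    push_cast [Nat.cast_sub (show 1 ≤ N by omega)]
    ring
  have hang : Complex.exp (N / 2 * (Real.log (1 - α ^ 2) : ℂ))
      * (((1 - α ^ 2) ^ (-(3 / 2) : ℝ) : ℝ) : ℂ)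
      = (((1 - α ^ 2) ^ ((((N - 1 : ℕ) : ℝ) - 2) / 2) : ℝ) : ℂ) := by
    rw [cexp_half_mul_log hα (-(3 / 2)), mul_assoc, ← Complex.ofReal_mul, ← Real.rpow_add hα,
      neg_neg, add_neg_cancel, Real.rpow_zero, Complex.ofReal_one, mul_one]
    congr 2
    push_cast [Nat.cast_sub (show 1 ≤ N by omega)]
    ring
  have hs' : (s : ℂ) ≠ 0 := by exact_mod_cast hs.ne'
  have ht' : (t : ℂ) ≠ 0 := by exact_mod_cast ht.ne'
  rw [goeCompanionIntegrand, hexp, hpow s hs, hpow t ht, contourKernel, gramDensity, goeBracket]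
  simp only [Complex.ofReal_mul]
  rw [← hang]
  field_simp

theorem goeIntegrand_eq (N : ℕ) (w : ℂ) (s t α : ℝ) (z : ℂ) :
    goeIntegrand N w s t α z = ((s + t : ℝ) : ℂ) * goeCompanionIntegrand N w s t α z := by
  rw [goeIntegrand, goeCompanionIntegrand]
  push_cast
  ring

theorem norm_gramExp_le {q : ℝ × ℝ × ℝ} (hq : q ∈ gramDomain) :
    ‖gramExp N c q‖ ≤ Real.exp (-(N * c.re) * q.1) * Real.exp (-(N * c.re) * q.2.1) := by
  have h1 : 0 < q.1 := hq.1
  have h2 : 0 < q.2.1 := hq.2.1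
  have : -(N : ℂ) * (c * (q.1 + q.2.1) + q.1 ^ 2 + q.2.1 ^ 2 + 2 * q.1 * q.2.1 * q.2.2 ^ 2)
      = ((-N * (q.1 + q.2.1) : ℝ) : ℂ) * c
        + ((-N * (q.1 ^ 2 + q.2.1 ^ 2 + 2 * q.1 * q.2.1 * q.2.2 ^ 2) : ℝ) : ℂ) := by
    push_cast; ring
  rw [gramExp, Complex.norm_exp, ← Real.exp_add, this, Complex.add_re, Complex.re_ofReal_mul,
    Complex.ofReal_re]
  refine Real.exp_le_exp.2 ?_
  have : 0 ≤ N * (q.1 ^ 2 + q.2.1 ^ 2 + 2 * q.1 * q.2.1 * q.2.2 ^ 2) := by positivity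
  nlinarith

/-- The one-variable majorant in the radial variables. -/
noncomputable def radialMajorant (N : ℕ) (c : ℂ) (s : ℝ) : ℝ :=
  (1 + s) ^ 2 * (s ^ ((((N - 1 : ℕ) : ℝ) - 1) / 2) * Real.exp (-(N * c.re) * s))

/-- The majorant in the Gram variables. -/
noncomputable def gramMajorant (N : ℕ) (c : ℂ) (q : ℝ × ℝ × ℝ) : ℝ :=
  radialMajorant N c q.1 * (radialMajorant N c q.2.1
    * (1 - q.2.2 ^ 2) ^ ((((N - 1 : ℕ) : ℝ) - 2) / 2))

theorem norm_weight_le (hb : ∀ u, 0 ≤ u → |h u| ≤ 1 + u)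
    {q : ℝ × ℝ × ℝ} (hq : q ∈ gramDomain) {K : ℝ} {X : ℂ}
    (hX : ‖X‖ ≤ K * (1 + (q.1 + q.2.1) + q.1 * q.2.1 * (1 - q.2.2 ^ 2))) :
    ‖gramDensity (N - 1) q * (h (q.1 + q.2.1) * gramExp N c q * X)‖
      ≤ K * gramMajorant N c q := by
  have h1 : 0 < q.1 := hq.1
  have h2 : 0 < q.2.1 := hq.2.1
  have h3 := one_sub_sq_pos hq.2.2
  have hK : 0 ≤ K := by
    by_contra hK
    have h4 : 0 < 1 + (q.1 + q.2.1) + q.1 * q.2.1 * (1 - q.2.2 ^ 2) := by positivity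
    nlinarith [norm_nonneg X]
  have h4 : q.1 * q.2.1 * (1 - q.2.2 ^ 2) ≤ q.1 * q.2.1 :=
    mul_le_of_le_one_right (by positivity) (by nlinarith [sq_nonneg q.2.2])
  -- The factor h and the factor X are each bounded through (1 + s)(1 + t), which accounts for the
  -- square in `radialMajorant`.
  have h5 : |h (q.1 + q.2.1)| ≤ (1 + q.1) * (1 + q.2.1) :=
    (hb _ (by positivity)).trans (by nlinarith [mul_pos h1 h2])
  have h6 : ‖X‖ ≤ K * ((1 + q.1) * (1 + q.2.1)) :=
    hX.trans (mul_le_mul_of_nonneg_left (by nlinarith) hK)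
  rw [norm_mul, norm_mul, norm_mul, Complex.norm_real, Complex.norm_real, Real.norm_eq_abs,
    Real.norm_eq_abs, abs_of_nonneg (gramDensity_nonneg hq)]
  calc _ ≤ gramDensity (N - 1) q * ((1 + q.1) * (1 + q.2.1)
        * (Real.exp (-(N * c.re) * q.1) * Real.exp (-(N * c.re) * q.2.1))
        * (K * ((1 + q.1) * (1 + q.2.1)))) := by
        have := gramDensity_nonneg (n := N - 1) hq
        have := norm_gramExp_le (N := N) (c := c) hq
        gcongr
    _ = _ := by
        simp only [gramDensity, gramMajorant, radialMajorant]
        ring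

end

/-! ### Absolute convergence and evaluation of the fourfold integral. -/

section

variable {N : ℕ} {c : ℂ} {h : ℝ → ℝ} {γ : ℝ → ℂ}

theorem integrableOn_radialMajorant (hN : 2 ≤ N) (hc : 0 < c.re) :
    IntegrableOn (radialMajorant N c) (Ioi 0) := by
  have hN' : (0 : ℝ) < N := by positivity
  have h1 : (1 : ℝ) ≤ (N - 1 : ℕ) := by exact_mod_cast (show 1 ≤ N - 1 by omega)
  exact integrableOn_one_add_sq_mul_rpow_mul_exp_neg (mul_pos hN' hc) (by linarith)

theorem integrableOn_gramAngle (hN : 2 ≤ N) :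
    IntegrableOn (fun α : ℝ => (1 - α ^ 2) ^ ((((N - 1 : ℕ) : ℝ) - 2) / 2)) (Ioo (-1) 1) := by
  have h1 : (1 : ℝ) ≤ (N - 1 : ℕ) := by exact_mod_cast (show 1 ≤ N - 1 by omega)
  exact integrableOn_one_sub_sq_rpow (by linarith)

theorem IntegrableOn.mul_prod_prod {f g : ℝ → ℝ} {X : Type*} [MeasurableSpace X] {μ : Measure X}
    [SFinite μ] {k : X → ℝ} {A B : Set ℝ} {C : Set X} (hf : IntegrableOn f A)
    (hg : IntegrableOn g B) (hk : IntegrableOn k C μ) :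
    IntegrableOn (fun p : ℝ × ℝ × X => f p.1 * (g p.2.1 * k p.2.2)) (A ×ˢ B ×ˢ C)
      (volume.prod (volume.prod μ)) := by
  rw [IntegrableOn, ← Measure.prod_restrict, ← Measure.prod_restrict]
  exact Integrable.mul_prod hf (Integrable.mul_prod hg hk)

theorem integrableOn_gramMajorant (hN : 2 ≤ N) (hc : 0 < c.re) :
    IntegrableOn (gramMajorant N c) gramDomain :=
  IntegrableOn.mul_prod_prod (integrableOn_radialMajorant hN hc)
    (integrableOn_radialMajorant hN hc) (integrableOn_gramAngle hN)

theorem measurable_gramExp (N : ℕ) (c : ℂ) : Measurable (gramExp N c) := by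
  unfold gramExp; fun_prop

theorem measurable_gramWeight (hh : Continuous h) : Measurable (gramWeight N c h) := by
  have := measurable_gramExp N c
  have := hh.measurable
  unfold gramWeight detMoment
  fun_prop

theorem integrableOn_gramDensity_mul_gramWeight (hN : 2 ≤ N) (hc : 0 < c.re) (hh : Continuous h)
    (hb : ∀ u, 0 ≤ u → |h u| ≤ 1 + u) :
    IntegrableOn (fun q => (gramDensity (N - 1) q : ℂ) * gramWeight N c h q) gramDomain := by
  set K := ‖shiftedMoment (1 / N) c N‖ + 2 * ‖shiftedMoment (1 / N) c (N - 1)‖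
    + 4 * ‖shiftedMoment (1 / N) c (N - 2)‖ with hK
  refine ((integrableOn_gramMajorant hN hc).const_mul K).mono'
    (((measurable_gramDensity _).complex_ofReal).mul
      (measurable_gramWeight hh)).aestronglyMeasurable
    ((ae_restrict_iff' measurableSet_gramDomain).2 (Filter.Eventually.of_forall fun q hq => ?_))
  refine norm_weight_le hb hq ?_
  have h1 : 0 < q.1 := hq.1
  have h2 : 0 < q.2.1 := hq.2.1
  have h3 := one_sub_sq_pos hq.2.2
  have e1 : ‖(q.1 : ℂ) + q.2.1‖ = q.1 + q.2.1 := by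
    rw [← Complex.ofReal_add, Complex.norm_real, Real.norm_eq_abs, abs_of_nonneg (by positivity)]
  have e2 : ‖(q.1 : ℂ) * q.2.1 * (1 - (q.2.2 : ℂ) ^ 2)‖ = q.1 * q.2.1 * (1 - q.2.2 ^ 2) := by
    have : (q.1 : ℂ) * q.2.1 * (1 - (q.2.2 : ℂ) ^ 2)
        = ((q.1 * q.2.1 * (1 - q.2.2 ^ 2) : ℝ) : ℂ) := by push_cast; rfl
    rw [this, Complex.norm_real, Real.norm_eq_abs, abs_of_nonneg (by positivity)]
  have h4 : 0 < q.1 * q.2.1 * (1 - q.2.2 ^ 2) := by positivity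
  have h5 : 0 < q.1 + q.2.1 := by positivity
  refine (norm_add₃_le).trans ?_
  simp only [norm_mul, e1, Complex.norm_ofNat]
  rw [← norm_mul, ← norm_mul, e2, hK]
  set A := ‖shiftedMoment (1 / N) c N‖
  set B := ‖shiftedMoment (1 / N) c (N - 1)‖
  set C := ‖shiftedMoment (1 / N) c (N - 2)‖
  have hA : 0 ≤ A := norm_nonneg _
  have hB : 0 ≤ B := norm_nonneg _
  have hC : 0 ≤ C := norm_nonneg _
  nlinarith [mul_nonneg hA h4.le, mul_nonneg hA h5.le, mul_nonneg hB h4.le, mul_nonneg hB h5.le,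
    mul_nonneg hC h4.le, mul_nonneg hC h5.le]

/-- The curve is compact and avoids the pole, and the kernel is affine in τ and δ. -/
theorem IsContourAboutZero.exists_norm_contourKernel_le (hγ : IsContourAboutZero γ) (N : ℕ)
    (c : ℂ) : ∃ K, ∀ u ∈ Icc (0 : ℝ) 1, ∀ τ δ : ℝ, 0 ≤ τ → 0 ≤ δ →
      ‖contourKernel N c τ δ (γ u)‖ ≤ K * (1 + τ + δ) := by
  have hb : ∀ f : ℂ → ℂ, ContinuousOn f {0}ᶜ → ∃ K, ∀ u ∈ Icc (0 : ℝ) 1, ‖f (γ u)‖ ≤ K :=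
    fun f hf => isCompact_Icc.exists_bound_of_continuousOn
      (hf.comp hγ.continuousOn fun u hu => hγ.ne_zero u hu)
  obtain ⟨K₁, h₁⟩ := hb (fun z => z * (z ^ N)⁻¹ * contourWeight N c z) (by
    have := continuous_contourWeight N c
    exact (continuousOn_id.mul ((by fun_prop : ContinuousOn (fun z : ℂ => z ^ N) _).inv₀
      fun z hz => pow_ne_zero _ hz)).mul this.continuousOn)
  obtain ⟨K₂, h₂⟩ := hb (fun z => 1 / N + (z - c) ^ 2) (by fun_prop)
  obtain ⟨K₃, h₃⟩ := hb (fun z => z - c) (by fun_prop)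
  refine ⟨K₁ * (K₂ + 2 * K₃ + 4), fun u hu τ δ hτ hδ => ?_⟩
  have h₁ := h₁ u hu
  have h₂ := h₂ u hu
  have h₃ := h₃ u hu
  have k₁ := (norm_nonneg _).trans h₁
  have k₂ := (norm_nonneg _).trans h₂
  have k₃ := (norm_nonneg _).trans h₃
  have e : contourKernel N c τ δ (γ u) = (γ u * (γ u ^ N)⁻¹ * contourWeight N c (γ u))
      * ((1 / N + (γ u - c) ^ 2) + -(2 * (γ u - c) * τ) + 4 * δ) := by
    rw [contourKernel]; ring
  rw [e, norm_mul, mul_assoc K₁]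
  refine mul_le_mul h₁ ?_ (norm_nonneg _) k₁
  refine norm_add₃_le.trans ?_
  simp only [norm_neg, norm_mul, Complex.norm_ofNat, Complex.norm_real, Real.norm_eq_abs,
    abs_of_nonneg hτ, abs_of_nonneg hδ]
  have h₄ : 2 * ‖γ u - c‖ * τ ≤ 2 * K₃ * τ := by gcongr
  nlinarith [mul_nonneg k₂ hτ, mul_nonneg k₂ hδ, mul_nonneg k₃ hτ, mul_nonneg k₃ hδ]

theorem IsContourAboutZero.fourfoldIntegrable (hγ : IsContourAboutZero γ) (hN : 2 ≤ N) {w : ℂ}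
    (hw : w.im < 0) (hh : Continuous h) (hb : ∀ u, 0 ≤ u → |h u| ≤ 1 + u) :
    FourfoldIntegrable γ fun s t α z => (h (s + t) : ℂ) * goeCompanionIntegrand N w s t α z := by
  set c := Complex.I * w with hcdef
  have hc : 0 < c.re := by simp [c, hw]
  obtain ⟨K, hK⟩ := hγ.exists_norm_contourKernel_le N c
  have hd : IntegrableOn (deriv γ) (Ioo 0 1) :=
    ((intervalIntegrable_iff_integrableOn_Ioo_of_le zero_le_one).1 hγ.integrable_deriv)
  have hmaj : IntegrableOn (fun p : ℝ × ℝ × ℝ × ℝ => K * (radialMajorant N c p.1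
      * (radialMajorant N c p.2.1 * ((1 - p.2.2.1 ^ 2) ^ ((((N - 1 : ℕ) : ℝ) - 2) / 2)
        * ‖deriv γ p.2.2.2‖))))
      (Ioi (0 : ℝ) ×ˢ Ioi (0 : ℝ) ×ˢ Ioo (-1 : ℝ) 1 ×ˢ Ioo (0 : ℝ) 1) := by
    refine Integrable.const_mul ?_ K
    refine IntegrableOn.mul_prod_prod (μ := (volume : Measure (ℝ × ℝ)))
      (integrableOn_radialMajorant hN hc) (integrableOn_radialMajorant hN hc)
      (k := fun y : ℝ × ℝ => (1 - y.1 ^ 2) ^ ((((N - 1 : ℕ) : ℝ) - 2) / 2) * ‖deriv γ y.2‖) ?_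
    rw [IntegrableOn, Measure.volume_eq_prod, ← Measure.prod_restrict]
    exact Integrable.mul_prod (integrableOn_gramAngle hN) hd.norm
  have hmeas : MeasurableSet
      (Ioi (0 : ℝ) ×ˢ Ioi (0 : ℝ) ×ˢ Ioo (-1 : ℝ) 1 ×ˢ Ioo (0 : ℝ) 1) :=
    measurableSet_Ioi.prod (measurableSet_Ioi.prod (measurableSet_Ioo.prod measurableSet_Ioo))
  have heq : ∀ p ∈ Ioi (0 : ℝ) ×ˢ Ioi (0 : ℝ) ×ˢ Ioo (-1 : ℝ) 1 ×ˢ Ioo (0 : ℝ) 1,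
      (h (p.1 + p.2.1) : ℂ) * goeCompanionIntegrand N w p.1 p.2.1 p.2.2.1 (γ p.2.2.2)
      = gramDensity (N - 1) (p.1, p.2.1, p.2.2.1) * (h (p.1 + p.2.1)
        * gramExp N c (p.1, p.2.1, p.2.2.1) * contourKernel N c (p.1 + p.2.1)
          (p.1 * p.2.1 * (1 - (p.2.2.1 : ℂ) ^ 2)) (γ p.2.2.2)) := fun p hp => by
    rw [goeCompanionIntegrand_eq hN w ⟨hp.1, hp.2.1, hp.2.2.1⟩
      (hγ.ne_zero _ (Ioo_subset_Icc_self hp.2.2.2))]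
    ring
  unfold FourfoldIntegrable
  refine IntegrableOn.congr_fun (f := fun p : ℝ × ℝ × ℝ × ℝ =>
    (gramDensity (N - 1) (p.1, p.2.1, p.2.2.1) * (h (p.1 + p.2.1)
        * gramExp N c (p.1, p.2.1, p.2.2.1) * contourKernel N c (p.1 + p.2.1)
          (p.1 * p.2.1 * (1 - (p.2.2.1 : ℂ) ^ 2)) (γ p.2.2.2))) * deriv γ p.2.2.2) ?_
    (fun p hp => by simp only [heq p hp]) hmeas
  refine hmaj.mono' ?_ ((ae_restrict_iff' hmeas).2 (Filter.Eventually.of_forall fun p hp => ?_))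
  · have hγm : AEMeasurable (fun p : ℝ × ℝ × ℝ × ℝ => γ p.2.2.2) (volume.restrict
        (Ioi (0 : ℝ) ×ˢ Ioi (0 : ℝ) ×ˢ Ioo (-1 : ℝ) 1 ×ˢ Ioo (0 : ℝ) 1)) :=
      ContinuousOn.aemeasurable (hγ.continuousOn.comp (by fun_prop)
        fun p hp => Ioo_subset_Icc_self hp.2.2.2) hmeas
    have hk : Measurable fun y : (ℝ × ℝ × ℝ × ℝ) × ℂ =>
        (gramDensity (N - 1) (y.1.1, y.1.2.1, y.1.2.2.1) * (h (y.1.1 + y.1.2.1)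
        * gramExp N c (y.1.1, y.1.2.1, y.1.2.2.1) * contourKernel N c (y.1.1 + y.1.2.1)
          (y.1.1 * y.1.2.1 * (1 - (y.1.2.2.1 : ℂ) ^ 2)) y.2)) * deriv γ y.1.2.2.2 := by
      have := measurable_gramExp N c
      have := measurable_gramDensity (N - 1)
      have := hh.measurable
      have := measurable_deriv γ
      have := (continuous_contourWeight N c).measurable
      unfold contourKernel
      fun_prop
    exact (hk.comp_aemeasurable (aemeasurable_id.prodMk hγm)).aestronglyMeasurable
  · have hq : (p.1, p.2.1, p.2.2.1) ∈ gramDomain := ⟨hp.1, hp.2.1, hp.2.2.1⟩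
    have h1 : 0 < p.1 := hp.1
    have h2 : 0 < p.2.1 := hp.2.1
    have h3 := one_sub_sq_pos hp.2.2.1
    have h4 := norm_weight_le (N := N) (c := c) (h := h) hb hq (K := K)
      (X := contourKernel N c (p.1 + p.2.1) (p.1 * p.2.1 * (1 - (p.2.2.1 : ℂ) ^ 2)) (γ p.2.2.2)) (by
      have := hK _ (Ioo_subset_Icc_self hp.2.2.2) (p.1 + p.2.1) (p.1 * p.2.1 * (1 - p.2.2.1 ^ 2))
        (by positivity) (by positivity)
      push_cast at this
      exact this)
    rw [norm_mul]
    refine (mul_le_mul_of_nonneg_right h4 (norm_nonneg _)).trans (le_of_eq ?_)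
    simp only [gramMajorant]
    ring

/-- The contour integral is innermost and is evaluated for fixed (s, t, α), where it restores the
averaged determinant. -/
theorem IsContourAboutZero.fourfoldIntegral_eq (hγ : IsContourAboutZero γ) (hN : 2 ≤ N) {w : ℂ}
    (hw : w.im < 0) (hh : Continuous h) (hb : ∀ u, 0 ≤ u → |h u| ≤ 1 + u) :
    fourfoldIntegral γ (fun s t α z => (h (s + t) : ℂ) * goeCompanionIntegrand N w s t α z)
      = 2 * Real.pi * Complex.I * (-N) ^ (N - 2) / (N - 2).factorial
        * ∫ q in gramDomain, gramDensity (N - 1) q * gramWeight N (Complex.I * w) h q := by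
  have hc : 0 < (Complex.I * w).re := by simp [hw]
  rw [integral_gramDomain (integrableOn_gramDensity_mul_gramWeight hN hc hh hb), fourfoldIntegral,
    ← integral_const_mul]
  refine setIntegral_congr_fun measurableSet_Ioi fun s hs => ?_
  rw [← integral_const_mul]
  refine setIntegral_congr_fun measurableSet_Ioi fun t ht => ?_
  rw [← intervalIntegral.integral_const_mul, intervalIntegral.integral_of_le (by norm_num),
    intervalIntegral.integral_of_le (by norm_num), integral_Ioc_eq_integral_Ioo,
    integral_Ioc_eq_integral_Ioo]
  refine setIntegral_congr_fun measurableSet_Ioo fun α hα => ?_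
  have e : ∀ z : ℂ, z ≠ 0 → (h (s + t) : ℂ) * goeCompanionIntegrand N w s t α z
      = (h (s + t) * gramDensity (N - 1) (s, t, α) * gramExp N (Complex.I * w) (s, t, α))
        * contourKernel N (Complex.I * w) (s + t) (s * t * (1 - (α : ℂ) ^ 2)) z := fun z hz => by
    rw [goeCompanionIntegrand_eq hN w ⟨hs, ht, hα⟩ hz]
    ring
  rw [hγ.integral_congr e, contourIntegral_const_mul]
  have hk : contourIntegral γ
      (contourKernel N (Complex.I * w) (s + t) (s * t * (1 - (α : ℂ) ^ 2))) = _ :=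
    hγ.integral_bracket hN (Complex.I * w) (s + t) (s * t * (1 - (α : ℂ) ^ 2))
  rw [hk, gramWeight, detMoment]
  ring

end

/-! ### Constants and conclusion. -/

theorem isHermitian_symOfUpper {N : ℕ} (g : UpperIndex N → ℝ) : (symOfUpper g).IsHermitian := by
  ext i j
  simp only [symOfUpper, Matrix.conjTranspose_apply, Matrix.sum_apply, Matrix.smul_apply,
    star_trivial]
  refine Finset.sum_congr rfl fun e _ => ?_
  congr 1
  unfold symUnit
  split_ifs with h
  · simp [Matrix.single_apply, h, and_comm]
  · simp [Matrix.single_apply, and_comm, add_comm]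

/-- With N = m + 2, the signs (-1)^N and (-1)^(N-2) cancel, as do all powers of N. There remains i
π^(N-1) 2^(N-2)/(N-2)!, the i coming from 2πi. -/
theorem goeConst_mul_contour_const (m : ℕ) :
    goeConst (m + 2) * (2 * Real.pi * Complex.I * (-((m + 2 : ℕ) : ℂ)) ^ m / m.factorial)
        * (Real.pi / ((m + 2 : ℕ) : ℂ)) ^ (m + 2)
      = Complex.I * ((gramConst (m + 1)).toReal : ℂ) := by
  have h1 : (m.factorial : ℂ) ≠ 0 := by exact_mod_cast m.factorial_ne_zero
  have h2 : ((m + 2 : ℕ) : ℂ) ≠ 0 := by exact_mod_cast (show m + 2 ≠ 0 by omega)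
  have h3 : (Real.pi : ℂ) ≠ 0 := by exact_mod_cast Real.pi_ne_zero
  have h4 : ((-1 : ℂ) ^ m) ^ 2 = 1 := by rw [← pow_mul, mul_comm, pow_mul]; simp
  rw [gramConst_eq (by omega), ENNReal.toReal_ofReal (by positivity), goeConst,
    neg_pow ((m + 2 : ℕ) : ℂ), div_pow]
  simp only [Nat.add_sub_cancel]
  push_cast at h2 ⊢
  field_simp
  ring_nf
  ring_nf at h4
  rw [h4]
  ring

theorem IsContourAboutZero.fourfoldIntegral_eq_integral_det {γ : ℝ → ℂ}
    (hγ : IsContourAboutZero γ) {N : ℕ} (hN : 2 ≤ N) {w : ℂ} (hw : w.im < 0) {h : ℝ → ℝ}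
    (hh : Continuous h) (hb : ∀ u, 0 ≤ u → |h u| ≤ 1 + u) :
    (Real.pi / N : ℂ) ^ N * (goeConst N * fourfoldIntegral γ
        (fun s t α z => (h (s + t) : ℂ) * goeCompanionIntegrand N w s t α z))
      = Complex.I * ∫ g, ((Complex.I * w) • (1 : Matrix (Fin N) (Fin N) ℂ)
        - Complex.I • (symOfUpper g).map Complex.ofReal).det
        * (∫ p : EuclideanSpace ℝ (Fin N) × EuclideanSpace ℝ (Fin N),
          (h (‖p.1‖ ^ 2 + ‖p.2‖ ^ 2) : ℂ) * (quadWeight (symOfUpper g) (Complex.I * w) p.1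
            * quadWeight (symOfUpper g) (Complex.I * w) p.2))
        ∂(Measure.pi fun e : UpperIndex N => gaussianReal 0 (goeVar e)) := by
  have hc : 0 < (Complex.I * w).re := by simp [hw]
  obtain ⟨m, rfl⟩ := Nat.exists_eq_add_of_le' hN
  have hJ := integral_comp_gramMap (n := m + 1) (by omega)
    (measurable_gramWeight (N := m + 2) (c := Complex.I * w) hh)
  rw [(integral_det_mul_integral_quadWeight hN hc hh hb).2, hγ.fourfoldIntegral_eq hN hw hh hb]
  refine Eq.trans ?_ (congrArg (Complex.I * ·) hJ.symm)
  simp only [Nat.add_sub_cancel, show m + 2 - 1 = m + 1 by omega]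
  linear_combination (∫ q in gramDomain, (gramDensity (m + 1) q : ℂ)
    * gramWeight (m + 2) (Complex.I * w) h q) * goeConst_mul_contour_const m

theorem lemma2 {Ω : Type*} [MeasurableSpace Ω] (P : Measure Ω) [IsProbabilityMeasure P]
    (N : ℕ) (hN : 2 ≤ N) (H : Ω → Matrix (Fin N) (Fin N) ℝ) (hH : IsGOE P N H)
    (E ε : ℝ) (hε : 0 < ε) (γ : ℝ → ℂ) (hγ : IsContourAboutZero γ) :
    (Integrable (fun ω => (matResolvent (H ω) (regEnergy E ε)).trace) P ∧
      FourfoldIntegrable γ (goeIntegrand N (regEnergy E ε)) ∧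
      (1 / (N : ℂ)) * ∫ ω, (matResolvent (H ω) (regEnergy E ε)).trace ∂P =
        goeConst N * fourfoldIntegral γ (goeIntegrand N (regEnergy E ε))) ∧
    (FourfoldIntegrable γ (goeCompanionIntegrand N (regEnergy E ε)) ∧
      Complex.I = goeConst N * fourfoldIntegral γ (goeCompanionIntegrand N (regEnergy E ε))) := by
  set w := regEnergy E ε with hwdef
  have hw : w.im < 0 := by simp [w, regEnergy, hε]
  have hc : 0 < (Complex.I * w).re := by simp [hw]
  have hN0 : N ≠ 0 := by omega
  have hN' : (N : ℂ) ≠ 0 := by exact_mod_cast hN0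
  have hpi : (Real.pi / N : ℂ) ^ N ≠ 0 :=
    pow_ne_zero _ (div_ne_zero (by exact_mod_cast Real.pi_ne_zero) hN')
  have hid : ∀ u : ℝ, 0 ≤ u → |id u| ≤ 1 + u := fun u hu => by
    rw [id, abs_of_nonneg hu]; linarith
  have hone : ∀ u : ℝ, 0 ≤ u → |(1 : ℝ)| ≤ 1 + u := fun u hu => by
    rw [abs_one]; linarith
  have e1 : goeIntegrand N w
      = fun s t α z => ((id (s + t) : ℝ) : ℂ) * goeCompanionIntegrand N w s t α z := by
    funext s t α z
    exact goeIntegrand_eq N w s t α z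
  have e2 : goeCompanionIntegrand N w
      = fun s t α z => ((1 : ℝ) : ℂ) * goeCompanionIntegrand N w s t α z := by
    funext s t α z
    simp
  -- The choice h = id yields the trace formula, and h = 1 the companion formula.
  have f1 := hγ.fourfoldIntegral_eq_integral_det hN hw continuous_id hid
  have f2 := hγ.fourfoldIntegral_eq_integral_det hN hw (h := fun _ => 1) continuous_const hone
  have i1 := (integral_det_mul_integral_quadWeight hN hc continuous_id hid).1
  have t1 : ∀ g : UpperIndex N → ℝ, _ := fun g =>
    ((isHermitian_symOfUpper g).integral_quadWeight_prod hN0 hw).1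
  have t2 : ∀ g : UpperIndex N → ℝ, _ := fun g =>
    ((isHermitian_symOfUpper g).integral_quadWeight_prod hN0 hw).2
  simp only [id, t2] at f1 i1
  -- For h = 1 determinant and bosonic integral cancel to the constant (π/N)^N for every matrix, so
  -- the average is trivial.
  simp only [Complex.ofReal_one, one_mul, t1, integral_const, probReal_univ, one_smul] at f2
  have hI : -Complex.I / N ≠ 0 := div_ne_zero (neg_ne_zero.2 Complex.I_ne_zero) hN'
  have i2 : Integrable (fun g => (matResolvent (symOfUpper g) w).trace)
      (Measure.pi fun e : UpperIndex N => gaussianReal 0 (goeVar e)) := by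
    -- The trace is a nonzero constant times the integrand already known to be integrable by Fubini.
    refine ((i1.const_mul (((Real.pi / N : ℂ) ^ N) * (-Complex.I / N))⁻¹)).congr
      (Filter.Eventually.of_forall fun g => ?_)
    simp only
    rw [← mul_assoc ((Real.pi / N : ℂ) ^ N), inv_mul_cancel_left₀ (mul_ne_zero hpi hI)]
  obtain ⟨j1, j2⟩ := hH.integral_eq (Φ := fun M => (matResolvent M w).trace) i2
  refine ⟨⟨j1, ?_, ?_⟩, ?_, ?_⟩
  · rw [e1]
    exact hγ.fourfoldIntegrable hN hw continuous_id hid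
  · rw [integral_const_mul, integral_const_mul, ← j2] at f1
    refine mul_left_cancel₀ hpi (Eq.trans ?_ (f1.symm.trans ?_))
    -- The prefactor is i·(-i/N) = 1/N.
    · linear_combination (((Real.pi / N : ℂ) ^ N * (1 / N)
        * ∫ ω, (matResolvent (H ω) w).trace ∂P)) * Complex.I_mul_I
    · rw [e1]; rfl
  · rw [e2]
    exact hγ.fourfoldIntegrable (h := fun _ => 1) hN hw continuous_const hone
  · refine mul_left_cancel₀ hpi ?_
    rw [mul_comm, ← f2]
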